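/- Let $\Sigma=\{z=a_0+a_1x+a_2y+a_3xy\}\subset\mathbb R^3\times\mathbb R^4$ with coordinates $(x,y,a)=(x,y,a_0,a_1,a_2,a_3)$, $\lambda=da_0+x\,da_1+y\,da_2+xy\,da_3$, and let the flat para-CR structure of type $(1,2,3)$ on $\Sigma$ be given by the integrable distributions $H^+=\{\lambda=da_1=da_2=da_3=0\}$ and $H^-=\{\lambda=dx=dy=0\}$. Let $M$ be a connected 6-manifold with a smooth para-CR structure $(H^+,H^-)$ of type $(1,2,3)$, and let $\Phi$ be a para-CR diffeomorphism (one preserving $H^+$ and $H^-$) of $M$ onto $\Sigma$, or, more generally, onto an open subset of $\Sigma$ (so that the statement applies near every point of a para-CR manifold locally equivalent to $\Sigma$). Let $\pi:M\to\mathbb R^4$ be the $a$-component of $\Phi$, and $\mathcal S=\pi(M)$. Put $\eta=\begin{pmatrix}0&1&0&0\\1&0&0&0\\0&0&0&1\\0&0&1&0\end{pmatrix}$, $\mathbf{CO}(2,2)=\{b\in GL(4,\mathbb R): b^T\eta b=c\,\eta\text{ for some }c>0\}$, and $g_0=2(da_0da_3-da_1da_2)$. (1) Solution space. The map $a\mapsto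 a_0+a_1x+a_2y+a_3xy$ is a bijection of $\mathbb R^4$ onto the space of $C^2$ solutions $z:\mathbb R^2\to\mathbb R$ of $z_{xx}=0=z_{yy}$. The map $\pi$ is a smooth submersion with $\ker d\pi=H^+$ and open image $\mathcal S$; if $\Phi$ is onto $\Sigma$, then $\mathcal S=\mathbb R^4$ and the fibres of $\pi$ are connected, so that the leaf space of $H^+$ is the solution space. (2) The bundle. For a submersion $\pi$ of $M$ onto an open set $\mathcal S\subset\mathbb R^4$ with $\ker d\pi=H^+$, call *Cartan bundle of $(M,\pi)$* an 11-dimensional principal $\mathbf{CO}(2,2)$-bundle $q:P\to\mathcal S$ with a smooth coframe $(\theta^1,\dots,\theta^4,\Omega_1,\dots,\Omega_6,A)$ such that, with $$\Gamma^i{}_j=\eta^{ik}\big(\Gamma_{[kj]}+\tfrac12A\,\eta_{kj}\big),\qquad \Gamma_{[ij]}=\begin{pmatrix}0&\Omega_1&\Omega_2&\Omega_4\\-\Omega_1&0&\Omega_3&\Omega_5\\-\Omega_2&-\Omega_3&0&\Omega_6\\-\Omega_4&-\Omega_5&-\Omega_6&0\end{pmatrix},$$ one has $d\theta^i+\Gamma^i{}_j\wedge\theta^j=0$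 and $d\Gamma^i{}_j+\Gamma^i{}_k\wedge\Gamma^k{}_j=0$; the $\theta^i$ vanish exactly on vertical vectors; $R_b^*\theta=b^{-1}\theta$, $R_b^*\Gamma=b^{-1}\Gamma b$, and $\Gamma$ is the Maurer–Cartan form on the fibres; together with a smooth map $\rho$ of an open set $P^\circ\subset P$ onto $M$, with $\pi\circ\rho=q$ on $P^\circ$, such that on $P^\circ$ one has $d\rho(v)\in H^+$ iff $\theta^1(v)=\dots=\theta^4(v)=0$, and $d\rho(v)\in H^-$ iff $\theta^4(v)=\Omega_2(v)=\Omega_3(v)=0$; here $P^\circ$ is maximal: if $\pi(m)=q(p)$ and $\theta^4_p$ vanishes on every $v$ with $dq(v)\in d\pi(H^+_m\oplus H^-_m)$, then $p\in P^\circ$ and $\rho(p)=m$. Then a Cartan bundle of $(M,\pi)$ exists, and any two are related by a unique bundle isomorphism over $\mathcal S$ compatible with $\theta$, $\Gamma$, $P^\circ$ and $\rho$, up to the automorphism of $\mathbf{CO}(2,2)$ and of the coframe given by $\mathrm{diag}(\varepsilon,1,\varepsilon,1)$, $\varepsilon=\pm1$. Each of them is isomorphic, over a linear isomorphism $L$ of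 $\mathbb R^4$ with $L^*\eta=\varepsilon\, g_0$ for some $\varepsilon=\pm1$, to the part over $L(\mathcal S)$ of the principal bundle $\mathbf{CO}(2,2)\to\mathbb R^4\rtimes\mathbf{CO}(2,2)\to\mathbb R^4$, in such a way that $(\theta,\Gamma)$ is the Maurer–Cartan form $(b^{-1}dv,b^{-1}db)$; in particular $P\cong\mathbb R^4\rtimes\mathbf{CO}(2,2)$ if $\Phi$ is onto $\Sigma$. (3) Weyl geometry. Let $G=2(\theta^1\theta^2+\theta^3\theta^4)$. Say that a pair $(g,\mathsf A)$ of a smooth metric of signature $(2,2)$ and a 1-form on $\mathcal S$ is induced by $P$ if $G=e^{2f}q^*g$ and $A=q^*\mathsf A-2df$ for a smooth function $f$ on $P$. The pairs induced by $P$ form exactly one Weyl class $[g,\mathsf A]$, i.e. one class modulo $(g,\mathsf A)\mapsto(e^{2\phi}g,\mathsf A-2d\phi)$, namely that of $(\varepsilon g_0,0)$, with the sign $\varepsilon$ of (2). This Weyl geometry is flat (the torsion-free connection with $\nabla g=-\mathsf A\otimes g$ has zero curvature). There is a Cartan bundle with $\varepsilon=1$, that is, one whose Weyl geometry is represented by $g=2(da_0da_3-da_1da_2)$,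 $\mathsf A=0$. (4) Point transformations. The para-CR structure of $M$ is induced from the splitting $\mathbb R^3\times\mathbb R^4$ by the embedding $m\mapsto((x,y,z),a)$ given by $\Phi$ and the inclusion of $\Sigma$. Let $F$ be a diffeomorphism between open sets of $\mathbb R^3$, the first of which contains all points $(x,y,z)$ of $M$, and let $\beta$ be a diffeomorphism of $\mathcal S$ onto an open set of $\mathbb R^4$ (the transformed system has the solution surfaces $F(\mathrm{graph})$, with the new parameters $\bar a=\beta(a)$). Then $m\mapsto(F(x,y,z),\beta(a))$ again embeds $M$ as a hypersurface in $\mathbb R^3\times\mathbb R^4$ that induces the para-CR structure of $M$; $(M,\beta\circ\pi)$ has a Cartan bundle, which induces a Weyl geometry on $\beta(\mathcal S)$; and if $(g,\mathsf A)$ and $(\bar g,\bar{\mathsf A})$ are induced by any Cartan bundles of $(M,\pi)$ and $(M,\beta\circ\pi)$, then $\beta^*\bar g=\pm e^{2\phi}g$ and $\beta^*\bar{\mathsf A}=\mathsf A-2d\phi$ for a smooth function $\phi$ on $\mathcal S$ and a constant sign. -/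

import Mathlib

open Set Filter Topology Matrix
open scoped Manifold ContDiff

noncomputable section

namespace ParaCRFlat

/-! ### Para-CR structures -/

section ParaCR

variable {E H : Type*} [NormedAddCommGroup E] [NormedSpace ℝ E] [TopologicalSpace H]

/-- A field of subspaces of the tangent spaces is a smooth distribution of rank `r` if it is
locally the span of `r` smooth, pointwise linearly independent vector fields. -/
def IsSmoothDistribution (I : ModelWithCorners ℝ E H) {M : Type*} [TopologicalSpace M]
    [ChartedSpace H M] [IsManifold I ∞ M] (r : ℕ) (D : ∀ p : M, Submodule ℝ (TangentSpace I p)) : Prop :=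
  ∀ p₀ : M, ∃ U : Set M, IsOpen U ∧ p₀ ∈ U ∧ ∃ X : Fin r → ∀ p : M, TangentSpace I p,
    (∀ i, ContMDiffOn I I.tangent ∞ (fun p => (⟨p, X i p⟩ : TangentBundle I M)) U) ∧
    ∀ p ∈ U, LinearIndependent ℝ (fun i => X i p) ∧ D p = Submodule.span ℝ (range fun i => X i p)

/-- Integrability `[D, D] ⊆ D`, for locally defined smooth vector fields. -/
def IsInvolutive (I : ModelWithCorners ℝ E H) {M : Type*} [TopologicalSpace M]
    [ChartedSpace H M] [IsManifold I ∞ M] (D : ∀ p : M, Submodule ℝ (TangentSpace I p)) : Prop :=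
  ∀ (U : Set M) (X Y : ∀ p : M, TangentSpace I p), IsOpen U →
    ContMDiffOn I I.tangent ∞ (fun p => (⟨p, X p⟩ : TangentBundle I M)) U →
    ContMDiffOn I I.tangent ∞ (fun p => (⟨p, Y p⟩ : TangentBundle I M)) U →
    (∀ p ∈ U, X p ∈ D p) → (∀ p ∈ U, Y p ∈ D p) →
    ∀ p ∈ U, VectorField.mlieBracket I X Y p ∈ D p

/-- A smooth (integrable) para-CR structure with `dim H⁺ = r`, `dim H⁻ = s` on a manifold `M`,
of type `(dim M - r - s, r, s)`: `H = H⁺ ⊕ H⁻` and `K = ± id` on `H^±`, so that the pair `(H, K)`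
is the same as the pair of its integrable eigendistributions `(H⁺, H⁻)`. -/
structure ParaCR (I : ModelWithCorners ℝ E H) (M : Type*) [TopologicalSpace M]
    [ChartedSpace H M] [IsManifold I ∞ M] (r s : ℕ) where
  plus : ∀ p : M, Submodule ℝ (TangentSpace I p)
  minus : ∀ p : M, Submodule ℝ (TangentSpace I p)
  disjoint : ∀ p, Disjoint (plus p) (minus p)
  smooth_plus : IsSmoothDistribution I r plus
  smooth_minus : IsSmoothDistribution I s minus
  involutive_plus : IsInvolutive I plus
  involutive_minus : IsInvolutive I minus

/-- `Φ` is a para-CR diffeomorphism of `M` onto an open subset of `N`. It is a para-CR equivalence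
of `M` and `N` iff it is moreover surjective. -/
structure IsParaCREmbedding {E' H' : Type*} [NormedAddCommGroup E'] [NormedSpace ℝ E']
    [TopologicalSpace H'] {I : ModelWithCorners ℝ E H} {I' : ModelWithCorners ℝ E' H'}
    {M N : Type*} [TopologicalSpace M] [ChartedSpace H M] [IsManifold I ∞ M]
    [TopologicalSpace N] [ChartedSpace H' N] [IsManifold I' ∞ N]
    {r s : ℕ} (𝓜 : ParaCR I M r s) (𝓝' : ParaCR I' N r s) (Φ : M → N) : Prop where
  isOpenEmbedding : IsOpenEmbedding Φ
  contMDiff : ContMDiff I I' ∞ Φ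
  bijective_mfderiv : ∀ p, Function.Bijective (mfderiv I I' Φ p)
  map_plus : ∀ p, (𝓜.plus p).map (mfderiv I I' Φ p).toLinearMap = 𝓝'.plus (Φ p)
  map_minus : ∀ p, (𝓜.minus p).map (mfderiv I I' Φ p).toLinearMap = 𝓝'.minus (Φ p)

end ParaCR

/-! ### The flat model -/

/-- `ℝ⁴`, with the coordinates `(a₀, a₁, a₂, a₃)`. -/
abbrev R4 : Type := Fin 4 → ℝ

/-- The hypersurface `z = a₀ + a₁ x + a₂ y + a₃ x y`, with the coordinates `(x, y, a)`. -/
abbrev Flat : Type := (ℝ × ℝ) × R4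

/-- The function `(x, y) ↦ a₀ + a₁ x + a₂ y + a₃ x y`. -/
def solution (a : R4) : ℝ × ℝ → ℝ := fun w => a 0 + a 1 * w.1 + a 2 * w.2 + a 3 * (w.1 * w.2)

/-- The solution space of the system `z_xx = 0 = z_yy`. -/
def solutionSpace : Set (ℝ × ℝ → ℝ) :=
  {z | ContDiff ℝ 2 z ∧ ∀ x y : ℝ,
    deriv (deriv fun t => z (t, y)) x = 0 ∧ deriv (deriv fun t => z (x, t)) y = 0}

/-- The hypersurface as a subset of the correspondence space `ℝ³ × ℝ⁴`:
`(x, y, a) ↦ ((x, y, z), a)` with `z = a₀ + a₁ x + a₂ y + a₃ x y`. -/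
def corr (p : Flat) : (ℝ × ℝ × ℝ) × R4 := ((p.1.1, p.1.2, solution p.2 p.1), p.2)

/-- The coordinates `(x, y, z)` of the points of `M`, for a map `Φ : M → Flat`. -/
def surf {M : Type*} (Φ : M → Flat) (m : M) : ℝ × ℝ × ℝ := (corr (Φ m)).1

/-- The parameters `a` of the points of `M`, for a map `Φ : M → Flat`. -/
def params {M : Type*} (Φ : M → Flat) (m : M) : R4 := (Φ m).2

/-- The 1-form `λ = da₀ + x da₁ + y da₂ + x y da₃`. -/
def lam (p : Flat) : Flat →ₗ[ℝ] ℝ where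
  toFun v := v.2 0 + p.1.1 * v.2 1 + p.1.2 * v.2 2 + p.1.1 * p.1.2 * v.2 3
  map_add' v w := by simp; ring
  map_smul' c v := by simp; ring

/-- `H⁺`, the annihilator of `λ, da₁, da₂, da₃`. -/
def flatPlus (p : Flat) : Submodule ℝ Flat where
  carrier := {v | lam p v = 0 ∧ v.2 1 = 0 ∧ v.2 2 = 0 ∧ v.2 3 = 0}
  add_mem' {v w} hv hw := by simp_all
  zero_mem' := by simp
  smul_mem' c v hv := by simp_all

/-- `H⁻`, the annihilator of `λ, dx, dy`. -/
def flatMinus (p : Flat) : Submodule ℝ Flat where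
  carrier := {v | lam p v = 0 ∧ v.1.1 = 0 ∧ v.1.2 = 0}
  add_mem' {v w} hv hw := by simp_all
  zero_mem' := by simp
  smul_mem' c v hv := by simp_all

theorem contMDiffOn_section {U : Set Flat} {X : Flat → Flat} (hX : ContDiffOn ℝ ∞ X U) :
    ContMDiffOn 𝓘(ℝ, Flat) 𝓘(ℝ, Flat).tangent ∞
      (fun p => (⟨p, X p⟩ : TangentBundle 𝓘(ℝ, Flat) Flat)) U :=
  (contMDiffOn_vectorSpace_iff_contDiffOn (V := fun p => X p)).2 hX

theorem flat_frame {n : ℕ} {D : Submodule ℝ Flat} {X : Fin n → Flat} (c : Flat → Fin n → ℝ)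
    (hX : ∀ i, X i ∈ D) (hD : ∀ v ∈ D, v = ∑ i, c v i • X i)
    (hc : ∀ g : Fin n → ℝ, c (∑ i, g i • X i) = g) (h0 : c 0 = 0) :
    LinearIndependent ℝ X ∧ D = Submodule.span ℝ (range X) := by
  constructor
  · rw [Fintype.linearIndependent_iff]
    intro g hg i
    have := hc g
    rw [hg, h0] at this
    exact (congrFun this i).symm
  · apply le_antisymm
    · intro v hv
      rw [hD v hv]
      exact Submodule.sum_mem _ fun i _ =>
        Submodule.smul_mem _ _ (Submodule.subset_span (mem_range_self i))
    · rw [Submodule.span_le]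
      rintro _ ⟨i, rfl⟩
      exact hX i

theorem flat_smooth_plus : IsSmoothDistribution 𝓘(ℝ, Flat) 2 (M := Flat) flatPlus := by
  intro p₀
  let X : Fin 2 → Flat → Flat := ![fun _ => ((1, 0), 0), fun _ => ((0, 1), 0)]
  refine ⟨univ, isOpen_univ, mem_univ _, X, ?_, ?_⟩
  · intro i
    apply contMDiffOn_section
    fin_cases i <;> exact contDiffOn_const
  · intro p _
    refine flat_frame (X := fun i => X i p) (fun v => ![v.1.1, v.1.2]) ?_ ?_ ?_ ?_
    · intro i
      fin_cases i <;> simp [X, flatPlus, lam]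
    · rintro v ⟨h0, h1, h2, h3⟩
      have h0' : v.2 0 = 0 := by simpa [lam, h1, h2, h3] using h0
      refine Prod.ext (Prod.ext ?_ ?_) (funext fun i => ?_)
      · simp [X]
      · simp [X]
      · fin_cases i <;> simp [X, h0', h1, h2, h3]
    · intro g
      ext i
      fin_cases i <;> simp [X]
    · ext i
      fin_cases i <;> simp

theorem flat_smooth_minus : IsSmoothDistribution 𝓘(ℝ, Flat) 3 (M := Flat) flatMinus := by
  intro p₀
  let X : Fin 3 → Flat → Flat := ![fun p => (0, ![-p.1.1, 1, 0, 0]), fun p => (0, ![-p.1.2, 0, 1, 0]),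
    fun p => (0, ![-(p.1.1 * p.1.2), 0, 0, 1])]
  refine ⟨univ, isOpen_univ, mem_univ _, X, ?_, ?_⟩
  · intro i
    apply contMDiffOn_section
    apply ContDiff.contDiffOn
    fin_cases i
    all_goals
      refine ContDiff.prodMk contDiff_const (contDiff_pi.2 fun j => ?_)
      fin_cases j <;> simp <;> fun_prop
  · intro p _
    refine flat_frame (X := fun i => X i p) (fun v => ![v.2 1, v.2 2, v.2 3]) ?_ ?_ ?_ ?_
    · intro i
      fin_cases i <;> simp [X, flatMinus, lam]
    · rintro v ⟨h0, h1, h2⟩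
      have h0' : v.2 0 = -(p.1.1 * v.2 1 + p.1.2 * v.2 2 + p.1.1 * p.1.2 * v.2 3) := by
        have : v.2 0 + p.1.1 * v.2 1 + p.1.2 * v.2 2 + p.1.1 * p.1.2 * v.2 3 = 0 := h0
        linarith
      refine Prod.ext (Prod.ext ?_ ?_) (funext fun i => ?_)
      · simp [X, h1, Fin.sum_univ_three]
      · simp [X, h2, Fin.sum_univ_three]
      · fin_cases i <;> simp [X, h0', Fin.sum_univ_three]
        ring
    · intro g
      ext i
      fin_cases i <;> simp [X, Fin.sum_univ_three]
    · ext i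
      fin_cases i <;> simp

theorem flat_bracket (X Y : Flat → Flat) (p : Flat) :
    VectorField.mlieBracket 𝓘(ℝ, Flat) (M := Flat) X Y p
      = fderiv ℝ Y p (X p) - fderiv ℝ X p (Y p) := by
  have h1 := congrFun (VectorField.mlieBracketWithin_univ (I := 𝓘(ℝ, Flat)) (V := X) (W := Y)) p
  have h2 := congrFun
    (VectorField.mlieBracketWithin_eq_lieBracketWithin (𝕜 := ℝ) (V := X) (W := Y) (s := univ)) p
  have h3 := congrFun (VectorField.lieBracketWithin_univ (𝕜 := ℝ) (V := X) (W := Y)) p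
  exact (h1.symm.trans h2).trans h3

theorem flat_differentiableAt {U : Set Flat} {X : Flat → Flat} (hU : IsOpen U)
    (hX : ContMDiffOn 𝓘(ℝ, Flat) 𝓘(ℝ, Flat).tangent ∞
      (fun p => (⟨p, X p⟩ : TangentBundle 𝓘(ℝ, Flat) Flat)) U) {p : Flat} (hp : p ∈ U) :
    DifferentiableAt ℝ X p :=
  (((contMDiffOn_vectorSpace_iff_contDiffOn (V := fun p => X p)).1 hX).contDiffAt
    (hU.mem_nhds hp)).differentiableAt (by simp)

/-- A linear function that vanishes along `X` near `p` kills the derivatives of `X` at `p`. -/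
theorem flat_fderiv_zero {U : Set Flat} {X : Flat → Flat} (hU : IsOpen U) {p : Flat} (hp : p ∈ U)
    (hX : DifferentiableAt ℝ X p) (l : Flat →L[ℝ] ℝ) (h : ∀ q ∈ U, l (X q) = 0) (v : Flat) :
    l (fderiv ℝ X p v) = 0 := by
  have h1 : HasFDerivAt (fun q => l (X q)) (l.comp (fderiv ℝ X p)) p :=
    l.hasFDerivAt.comp p hX.hasFDerivAt
  have h2 : HasFDerivAt (fun q => l (X q)) (0 : Flat →L[ℝ] ℝ) p := by
    refine (hasFDerivAt_const (0 : ℝ) p).congr_of_eventuallyEq ?_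
    filter_upwards [hU.mem_nhds hp] with q hq using h q hq
  have := congrArg (fun f : Flat →L[ℝ] ℝ => f v) (h1.unique h2)
  simpa using this

/-- The coordinate forms `da_i`, `dx`, `dy`. -/
def da (i : Fin 4) : Flat →L[ℝ] ℝ :=
  (ContinuousLinearMap.proj i : R4 →L[ℝ] ℝ).comp (ContinuousLinearMap.snd ℝ _ _)

def dx : Flat →L[ℝ] ℝ :=
  (ContinuousLinearMap.fst ℝ ℝ ℝ).comp (ContinuousLinearMap.fst ℝ _ _)

def dy : Flat →L[ℝ] ℝ :=
  (ContinuousLinearMap.snd ℝ ℝ ℝ).comp (ContinuousLinearMap.fst ℝ _ _)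

theorem flat_involutive_plus : IsInvolutive 𝓘(ℝ, Flat) (M := Flat) flatPlus := by
  intro U X Y hU hX hY hXp hYp p hp
  have key : ∀ (X : Flat → Flat), DifferentiableAt ℝ X p → (∀ q ∈ U, X q ∈ flatPlus q) →
      ∀ v i, da i (fderiv ℝ X p v) = 0 := by
    intro X hX hXp v i
    refine flat_fderiv_zero hU hp hX (da i) (fun q hq => ?_) v
    obtain ⟨h0, h1, h2, h3⟩ := hXp q hq
    have h0' : (X q).2 0 = 0 := by simpa [lam, h1, h2, h3] using h0
    fin_cases i
    exacts [h0', h1, h2, h3]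
  have hX' := key X (flat_differentiableAt hU hX hp) hXp
  have hY' := key Y (flat_differentiableAt hU hY hp) hYp
  have e := flat_bracket X Y p
  have h : ∀ i, da i (fderiv ℝ Y p (X p) - fderiv ℝ X p (Y p)) = 0 := fun i =>
    (map_sub (da i) _ _).trans (sub_eq_zero.2 ((hY' _ i).trans (hX' _ i).symm))
  refine Eq.mpr (congrArg (fun w => w ∈ flatPlus p) e) ⟨?_, h 1, h 2, h 3⟩
  have a0 := h 0
  have a1 := h 1
  have a2 := h 2
  have a3 := h 3
  generalize fderiv ℝ Y p (X p) - fderiv ℝ X p (Y p) = w at *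
  change w.2 0 = 0 at a0
  change w.2 1 = 0 at a1
  change w.2 2 = 0 at a2
  change w.2 3 = 0 at a3
  simp [lam, a0, a1, a2, a3]

theorem flat_involutive_minus : IsInvolutive 𝓘(ℝ, Flat) (M := Flat) flatMinus := by
  intro U X Y hU hX hY hXp hYp p hp
  have key : ∀ (X Y : Flat → Flat), DifferentiableAt ℝ X p → (∀ q ∈ U, X q ∈ flatMinus q) →
      (∀ q ∈ U, Y q ∈ flatMinus q) → fderiv ℝ X p (Y p) ∈ flatMinus p := by
    intro X Y hX hXp hYp
    have kx : ∀ v, dx (fderiv ℝ X p v) = 0 :=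
      flat_fderiv_zero hU hp hX dx fun q hq => (hXp q hq).2.1
    have ky : ∀ v, dy (fderiv ℝ X p v) = 0 :=
      flat_fderiv_zero hU hp hX dy fun q hq => (hXp q hq).2.2
    refine ⟨?_, kx _, ky _⟩
    obtain ⟨-, yx, yy⟩ := hYp p hp
    have dX : ∀ i, HasFDerivAt (fun q => (X q).2 i) ((da i).comp (fderiv ℝ X p)) p := fun i =>
      (da i).hasFDerivAt.comp p hX.hasFDerivAt
    have hx : HasFDerivAt (fun q : Flat => q.1.1) dx p := dx.hasFDerivAt
    have hy : HasFDerivAt (fun q : Flat => q.1.2) dy p := dy.hasFDerivAt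
    have h1 := (((dX 0).add (hx.mul (dX 1))).add (hy.mul (dX 2))).add ((hx.mul hy).mul (dX 3))
    have h2 : HasFDerivAt (fun q : Flat => (X q).2 0 + q.1.1 * (X q).2 1 + q.1.2 * (X q).2 2
        + q.1.1 * q.1.2 * (X q).2 3) (0 : Flat →L[ℝ] ℝ) p := by
      refine (hasFDerivAt_const (0 : ℝ) p).congr_of_eventuallyEq ?_
      filter_upwards [hU.mem_nhds hp] with q hq using (hXp q hq).1
    have := congrArg (fun f : Flat →L[ℝ] ℝ => f (Y p)) (h1.unique h2)
    have ex : dx (Y p) = 0 := yx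
    have ey : dy (Y p) = 0 := yy
    simpa [ex, ey, lam, da] using this
  have hX' := key X Y (flat_differentiableAt hU hX hp) hXp hYp
  have hY' := key Y X (flat_differentiableAt hU hY hp) hYp hXp
  exact Eq.mpr (congrArg (fun w => w ∈ flatMinus p) (flat_bracket X Y p))
    (Submodule.sub_mem _ hY' hX')

theorem flat_disjoint (p : Flat) : Disjoint (flatPlus p) (flatMinus p) := by
  rw [Submodule.disjoint_def]
  rintro v ⟨h0, h1, h2, h3⟩ ⟨-, h4, h5⟩
  have h0' : v.2 0 = 0 := by simpa [lam, h1, h2, h3] using h0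
  refine Prod.ext (Prod.ext h4 h5) (funext fun i => ?_)
  fin_cases i
  exacts [h0', h1, h2, h3]

/-- The flat para-CR structure of type `(1, 2, 3)`. -/
def flatParaCR : ParaCR 𝓘(ℝ, Flat) Flat 2 3 where
  plus := flatPlus
  minus := flatMinus
  disjoint := flat_disjoint
  smooth_plus := flat_smooth_plus
  smooth_minus := flat_smooth_minus
  involutive_plus := flat_involutive_plus
  involutive_minus := flat_involutive_minus

/-! ### The groups `CO(2,2)` and `ℝ⁴ ⋊ CO(2,2)` -/

/-- The matrix `g_ij` of the form `2 (θ¹ θ² + θ³ θ⁴)`; it is its own inverse. -/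
def eta : Matrix (Fin 4) (Fin 4) ℝ := !![0, 1, 0, 0; 1, 0, 0, 0; 0, 0, 0, 1; 0, 0, 1, 0]

/-- The homothetic group `CO(2,2) = {b | bᵀ η b = c η for some c > 0}`, topologized as a subspace
of the space of matrices. -/
def CO22 : Subgroup (GL (Fin 4) ℝ) where
  carrier := {b | ∃ c : ℝ, 0 < c ∧
    (b : Matrix (Fin 4) (Fin 4) ℝ)ᵀ * eta * (b : Matrix (Fin 4) (Fin 4) ℝ) = c • eta}
  one_mem' := ⟨1, one_pos, by simp⟩
  mul_mem' := by
    rintro a b ⟨c, hc, h⟩ ⟨d, hd, k⟩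
    refine ⟨c * d, mul_pos hc hd, ?_⟩
    calc ((a * b : GL (Fin 4) ℝ) : Matrix (Fin 4) (Fin 4) ℝ)ᵀ * eta * ((a * b : GL (Fin 4) ℝ) :)
        = (b : Matrix (Fin 4) (Fin 4) ℝ)ᵀ * ((a : Matrix (Fin 4) (Fin 4) ℝ)ᵀ * eta * a) * b := by
          simp [Matrix.transpose_mul, Matrix.mul_assoc]
      _ = (c * d) • eta := by rw [h, Matrix.mul_smul, Matrix.smul_mul, k, smul_smul]
  inv_mem' := by
    rintro a ⟨c, hc, h⟩
    refine ⟨c⁻¹, inv_pos.2 hc, ?_⟩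
    have e : (a : Matrix (Fin 4) (Fin 4) ℝ) * ((a⁻¹ : GL (Fin 4) ℝ) : Matrix _ _ ℝ) = 1 := by
      rw [← Units.val_mul, mul_inv_cancel, Units.val_one]
    have e' : ((a⁻¹ : GL (Fin 4) ℝ) : Matrix _ _ ℝ)ᵀ * (a : Matrix (Fin 4) (Fin 4) ℝ)ᵀ = 1 := by
      rw [← Matrix.transpose_mul, e, Matrix.transpose_one]
    have h' : eta = c⁻¹ • ((a : Matrix (Fin 4) (Fin 4) ℝ)ᵀ * eta * a) := by
      rw [h, smul_smul, inv_mul_cancel₀ hc.ne', one_smul]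
    calc ((a⁻¹ : GL (Fin 4) ℝ) : Matrix _ _ ℝ)ᵀ * eta * ((a⁻¹ : GL (Fin 4) ℝ) : Matrix _ _ ℝ)
        = c⁻¹ • ((((a⁻¹ : GL (Fin 4) ℝ) : Matrix _ _ ℝ)ᵀ * (a : Matrix (Fin 4) (Fin 4) ℝ)ᵀ) * eta
            * ((a : Matrix (Fin 4) (Fin 4) ℝ) * ((a⁻¹ : GL (Fin 4) ℝ) : Matrix _ _ ℝ))) := by
          conv_lhs => rw [h']
          simp only [Matrix.mul_smul, Matrix.smul_mul, Matrix.mul_assoc]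
      _ = c⁻¹ • eta := by rw [e, e', Matrix.one_mul, Matrix.mul_one]

/-- The matrix of an element of `CO(2,2)`. -/
def coMat (b : CO22) : Matrix (Fin 4) (Fin 4) ℝ := ((b : GL (Fin 4) ℝ) : Matrix _ _ ℝ)

/-- The same matrix as a point of the normed space `ℝ^(4×4)`. -/
def coEntries (b : CO22) : Fin 4 → Fin 4 → ℝ := fun i j => coMat b i j

theorem coMat_mul (a b : CO22) : coMat (a * b) = coMat a * coMat b := rfl

theorem coMat_one : coMat 1 = 1 := rfl

/-- The linear action of `CO(2,2)` on `ℝ⁴`. -/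
def coAction : CO22 →* MulAut (Multiplicative R4) where
  toFun b :=
    { toFun := fun v => Multiplicative.ofAdd (coMat b *ᵥ v.toAdd)
      invFun := fun v => Multiplicative.ofAdd (coMat b⁻¹ *ᵥ v.toAdd)
      left_inv := fun v => by
        simp [← coMat_mul, coMat_one]
      right_inv := fun v => by
        simp [← coMat_mul, coMat_one]
      map_mul' := fun v w => by simp [Matrix.mulVec_add] }
  map_one' := by
    ext v
    simp [coMat_one]
  map_mul' a b := by
    ext v
    simp [coMat_mul]

/-- The group `ℝ⁴ ⋊ CO(2,2)` of homothetic motions, `(v, a) (w, b) = (v + a w, a b)`. -/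
abbrev Sim : Type := Multiplicative R4 ⋊[coAction] CO22

/-- The embedding of `ℝ⁴ ⋊ CO(2,2)` in `ℝ⁴ × ℝ^(4×4)`. -/
def Sim.coords (x : Sim) : R4 × (Fin 4 → Fin 4 → ℝ) := (x.left.toAdd, coEntries x.right)

/-! ### Differential forms of degree one -/

section Forms

variable {E H : Type*} [NormedAddCommGroup E] [NormedSpace ℝ E] [TopologicalSpace H]

/-- Fields of covectors. -/
abbrev OneForm (I : ModelWithCorners ℝ E H) (P : Type*) [TopologicalSpace P] [ChartedSpace H P] :
    Type _ := ∀ p : P, TangentSpace I p →L[ℝ] ℝ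

variable {I : ModelWithCorners ℝ E H} {P : Type*} [TopologicalSpace P] [ChartedSpace H P]

/-- The differential at `p` of a map to a normed space. -/
def dmap (I : ModelWithCorners ℝ E H) {F : Type*} [NormedAddCommGroup F] [NormedSpace ℝ F]
    (f : P → F) (p : P) : TangentSpace I p →L[ℝ] F := mfderiv I 𝓘(ℝ, F) f p

/-- The expression of a 1-form in the preferred chart at `p₀`. -/
def OneForm.inChart (α : OneForm I P) (p₀ : P) (y : E) : E →L[ℝ] ℝ :=
  (α ((extChartAt I p₀).symm y)).comp (mfderiv 𝓘(ℝ, E) I (extChartAt I p₀).symm y)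

/-- Smoothness of a 1-form. -/
def OneForm.IsSmooth (α : OneForm I P) : Prop :=
  ∀ p₀ : P, ContDiffOn ℝ ∞ (OneForm.inChart α p₀) (extChartAt I p₀).target

/-- The exterior derivative `dα (u, v)` at `p` (for a boundaryless manifold), computed in the
preferred chart at `p`, through which Mathlib identifies `T_p P` with the model space. -/
def OneForm.d (α : OneForm I P) (p : P) (u v : TangentSpace I p) : ℝ :=
  (fderiv ℝ (OneForm.inChart α p) (extChartAt I p p) : E →L[ℝ] E →L[ℝ] ℝ) u v -
  (fderiv ℝ (OneForm.inChart α p) (extChartAt I p p) : E →L[ℝ] E →L[ℝ] ℝ) v u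

/-- The wedge product `α ∧ β` of 1-forms, at a point. -/
def OneForm.wedge (α β : OneForm I P) (p : P) (u v : TangentSpace I p) : ℝ :=
  α p u * β p v - α p v * β p u

/-- The forms `Γ_ij = Γ_[ij] + ½ A g_ij`, with `Γ_[ij]` built from `Ω₁, …, Ω₆`
(here `Ω 0, …, Ω 5`). -/
def gammaLow (Ω : Fin 6 → OneForm I P) (A : OneForm I P) (i j : Fin 4) : OneForm I P := fun p =>
  (!![0, Ω 0 p, Ω 1 p, Ω 3 p;
      -Ω 0 p, 0, Ω 2 p, Ω 4 p;
      -Ω 1 p, -Ω 2 p, 0, Ω 5 p;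
      -Ω 3 p, -Ω 4 p, -Ω 5 p, 0] : Matrix (Fin 4) (Fin 4) (TangentSpace I p →L[ℝ] ℝ)) i j
    + (1 / 2 * eta i j) • A p

/-- The forms `Γ^i_j = g^{ik} Γ_kj`. -/
def gamma (Ω : Fin 6 → OneForm I P) (A : OneForm I P) (i j : Fin 4) : OneForm I P := fun p =>
  ∑ k, eta i k • gammaLow Ω A k j p

/-- Smooth embeddings in a normed space. -/
structure IsSmoothEmb {F : Type*} [NormedAddCommGroup F] [NormedSpace ℝ F]
    (I : ModelWithCorners ℝ E H) (f : P → F) : Prop where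
  contMDiff : ContMDiff I 𝓘(ℝ, F) ∞ f
  injective_mfderiv : ∀ p, Function.Injective (dmap I f p)
  isEmbedding : IsEmbedding f

end Forms

/-! ### The principal bundle of a para-CR structure of type `(1, 2, 3)` -/

/-- `π : M → ℝ⁴` is a submersion on an open set whose fibres are tangent to `H⁺`, so that `π`
identifies the (local) leaf space of the foliation `H⁺` with the open set `range π` of `ℝ⁴`. -/
structure IsLeafProjection {M : Type*} [TopologicalSpace M]
    [ChartedSpace (EuclideanSpace ℝ (Fin 6)) M] [IsManifold (𝓡 6) ∞ M]
    (𝓜 : ParaCR (𝓡 6) M 2 3) (π : M → R4) : Prop where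
  contMDiff : ContMDiff (𝓡 6) 𝓘(ℝ, R4) ∞ π
  surjective_mfderiv : ∀ m, Function.Surjective (dmap (𝓡 6) π m)
  isOpen_range : IsOpen (range π)
  ker_mfderiv : ∀ m, (dmap (𝓡 6) π m).toLinearMap.ker = 𝓜.plus m

/-- The structure that a para-CR manifold `M` of type `(1, 2, 3)` with leaf space
`π : M → S`, `S = range π ⊆ ℝ⁴`, induces on an 11-dimensional manifold `P`:
a principal `CO(2,2)`-bundle `q : P → S` with an equivariant coframe
`(θ^i, Ω_μ, A)` that satisfies `dθ + Γ ∧ θ = 0`, `dΓ + Γ ∧ Γ = 0`, and that is adapted to the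
para-CR structure over an open set `dom` of `P` which is mapped to `M` by `ρ`. -/
structure CartanBundle {M : Type*} [TopologicalSpace M]
    [ChartedSpace (EuclideanSpace ℝ (Fin 6)) M] [IsManifold (𝓡 6) ∞ M]
    (𝓜 : ParaCR (𝓡 6) M 2 3) (π : M → R4) (P : Type*) [TopologicalSpace P]
    [ChartedSpace (EuclideanSpace ℝ (Fin 11)) P] [IsManifold (𝓡 11) ∞ P] where
  /-- the bundle projection -/
  q : P → R4
  /-- the right action of the structure group -/
  act : P → CO22 → P
  contMDiff_q : ContMDiff (𝓡 11) 𝓘(ℝ, R4) ∞ q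
  range_q : range q = range π
  act_one : ∀ p, act p 1 = p
  act_mul : ∀ p b b', act p (b * b') = act (act p b) b'
  q_act : ∀ p b, q (act p b) = q p
  /-- local triviality: locally `P` is equivariantly diffeomorphic to `W × CO(2,2)` (an embedded
  submanifold of `ℝ⁴ × ℝ^(4×4)`) -/
  local_triv : ∀ s ∈ range π, ∃ W : Set R4, IsOpen W ∧ s ∈ W ∧ W ⊆ range π ∧ ∃ t : P → CO22,
    (∀ p, q p ∈ W → ∀ b, t (act p b) = t p * b) ∧
    BijOn (fun p => (q p, t p)) (q ⁻¹' W) (W ×ˢ univ) ∧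
    ContMDiffOn (𝓡 11) 𝓘(ℝ, R4 × (Fin 4 → Fin 4 → ℝ)) ∞ (fun p => (q p, coEntries (t p)))
      (q ⁻¹' W) ∧
    (∀ p ∈ q ⁻¹' W, Function.Injective (dmap (𝓡 11)
      (fun p => (q p, coEntries (t p))) p)) ∧
    IsEmbedding ((q ⁻¹' W).domRestrict fun p => (q p, coEntries (t p)))
  θ : Fin 4 → OneForm (𝓡 11) P
  Ω : Fin 6 → OneForm (𝓡 11) P
  A : OneForm (𝓡 11) P
  smooth_θ : ∀ i, (θ i).IsSmooth
  smooth_Ω : ∀ μ, (Ω μ).IsSmooth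
  smooth_A : A.IsSmooth
  /-- the eleven forms are linearly independent at every point -/
  coframe : ∀ p v, (∀ i, θ i p v = 0) → (∀ μ, Ω μ p v = 0) → A p v = 0 → v = 0
  dθ_eq : ∀ i p u v, (θ i).d p u v + ∑ j, (gamma Ω A i j).wedge (θ j) p u v = 0
  dΓ_eq : ∀ i j p u v,
    (gamma Ω A i j).d p u v + ∑ k, (gamma Ω A i k).wedge (gamma Ω A k j) p u v = 0
  /-- the fibres are the leaves of the foliation `θ¹ = θ² = θ³ = θ⁴ = 0` -/
  θ_vertical : ∀ p v, (∀ i, θ i p v = 0) ↔ dmap (𝓡 11) q p v = 0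
  θ_act : ∀ b p v i, θ i (act p b) (mfderiv (𝓡 11) (𝓡 11) (fun p => act p b) p v)
    = ∑ j, coMat b⁻¹ i j * θ j p v
  Γ_act : ∀ b p v i j,
    gamma Ω A i j (act p b) (mfderiv (𝓡 11) (𝓡 11) (fun p => act p b) p v)
      = (coMat b⁻¹ * Matrix.of (fun k l => gamma Ω A k l p v) * coMat b) i j
  /-- `Γ` is the Maurer–Cartan form on the fibres -/
  Γ_vertical : ∀ (p : P) (b : ℝ → CO22), b 0 = 1 → ContDiff ℝ ∞ (fun τ => coEntries (b τ)) →
    ∀ i j, gamma Ω A i j (act p (b 0))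
      (mfderiv 𝓘(ℝ, ℝ) (𝓡 11) (fun τ => act p (b τ)) 0 (1 : ℝ)) = deriv (fun τ => coMat (b τ) i j) 0
  dom : Set P
  ρ : P → M
  isOpen_dom : IsOpen dom
  contMDiffOn_ρ : ContMDiffOn (𝓡 11) (𝓡 6) ∞ ρ dom
  image_dom : ρ '' dom = univ
  π_ρ : ∀ p ∈ dom, π (ρ p) = q p
  /-- `(θ⁴; θ¹, θ², θ³)` are combinations of `(λ; ν₁, ν₂, ν₃)` with `θ⁴` a multiple of `λ` … -/
  adapted_plus : ∀ p ∈ dom, ∀ v,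
    mfderiv (𝓡 11) (𝓡 6) ρ p v ∈ 𝓜.plus (ρ p) ↔ ∀ i, θ i p v = 0
  /-- … and `(θ⁴; Ω₂, Ω₃)` are combinations of `(λ; μ₁, μ₂)` -/
  adapted_minus : ∀ p ∈ dom, ∀ v,
    mfderiv (𝓡 11) (𝓡 6) ρ p v ∈ 𝓜.minus (ρ p) ↔ θ 3 p v = 0 ∧ Ω 1 p v = 0 ∧ Ω 2 p v = 0
  /-- `dom` contains every point at which `θ⁴` is a multiple of `λ` at some point of `M` -/
  dom_maximal : ∀ p m, π m = q p →
    (∀ v, ∀ w ∈ 𝓜.plus m ⊔ 𝓜.minus m,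
      dmap (𝓡 11) q p v = dmap (𝓡 6) π m w → θ 3 p v = 0) →
    p ∈ dom ∧ ρ p = m

/-! ### Weyl geometry on an open subset of `ℝ⁴` -/

/-- Fields of bilinear forms on `ℝ⁴`. -/
abbrev BilinField : Type := R4 → R4 →L[ℝ] R4 →L[ℝ] ℝ

/-- Fields of covectors on `ℝ⁴`. -/
abbrev CovField : Type := R4 → R4 →L[ℝ] ℝ

/-- A pair `(g, A)` of a smooth metric of signature `(2,2)` and a smooth 1-form on `V`. -/
structure IsWeylPair (V : Set R4) (g : BilinField) (A : CovField) : Prop where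
  contDiffOn_g : ContDiffOn ℝ ∞ g V
  contDiffOn_A : ContDiffOn ℝ ∞ A V
  symm : ∀ s ∈ V, ∀ u v, g s u v = g s v u
  signature : ∀ s ∈ V, ∃ e : Module.Basis (Fin 4) ℝ R4,
    ∀ i j, g s (e i) (e j) = Matrix.diagonal ![1, 1, -1, -1] i j

/-- `(g', A') = (e^{2φ} g, A - 2 dφ)` on `V` for a smooth function `φ`: both pairs represent the
same Weyl geometry `[g, A]`. -/
def WeylEquiv (V : Set R4) (g : BilinField) (A : CovField) (g' : BilinField) (A' : CovField) :
    Prop :=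
  ∃ φ : R4 → ℝ, ContDiffOn ℝ ∞ φ V ∧
    ∀ s ∈ V, g' s = Real.exp (2 * φ s) • g s ∧ A' s = A s - (2 : ℝ) • fderiv ℝ φ s

/-- The Weyl connection `∇_X Y = D_X Y + C(X, Y)` of `(g, A)` on `V`: it is torsion-free and
satisfies `∇g = - A ⊗ g`. -/
def IsWeylConnection (V : Set R4) (g : BilinField) (A : CovField) (C : R4 → R4 →L[ℝ] R4 →L[ℝ] R4) :
    Prop :=
  ContDiffOn ℝ ∞ C V ∧ ∀ s ∈ V, (∀ x y, C s x y = C s y x) ∧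
    ∀ x y z, (fderiv ℝ g s x) y z - g s (C s x y) z - g s y (C s x z) = -(A s x) * g s y z

/-- The Weyl geometry of `(g, A)` is flat: the curvature of its Weyl connection vanishes. -/
def IsFlatWeyl (V : Set R4) (g : BilinField) (A : CovField) : Prop :=
  ∃ C : R4 → R4 →L[ℝ] R4 →L[ℝ] R4, IsWeylConnection V g A C ∧ ∀ s ∈ V, ∀ x y z,
    (fderiv ℝ C s x) y z - (fderiv ℝ C s y) x z + C s x (C s y z) - C s y (C s x z) = 0

/-- The bilinear form of `2 (da₀ da₃ - da₁ da₂)`. -/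
def g0 : R4 →L[ℝ] R4 →L[ℝ] ℝ :=
  let a : Fin 4 → R4 →L[ℝ] ℝ := fun i => ContinuousLinearMap.proj i
  (a 0).smulRight (a 3) + (a 3).smulRight (a 0) - (a 1).smulRight (a 2) - (a 2).smulRight (a 1)

/-- The diagonal matrix `diag(ε, 1, ε, 1)`; for `ε = -1` it takes `η` to `-η`. -/
def signMat (ε : ℝ) : Matrix (Fin 4) (Fin 4) ℝ := Matrix.diagonal ![ε, 1, ε, 1]

namespace CartanBundle

variable {M : Type*} [TopologicalSpace M] [ChartedSpace (EuclideanSpace ℝ (Fin 6)) M]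
  [IsManifold (𝓡 6) ∞ M] {𝓜 : ParaCR (𝓡 6) M 2 3} {π : M → R4}
  {P : Type*} [TopologicalSpace P] [ChartedSpace (EuclideanSpace ℝ (Fin 11)) P]
  [IsManifold (𝓡 11) ∞ P]
  {P' : Type*} [TopologicalSpace P'] [ChartedSpace (EuclideanSpace ℝ (Fin 11)) P']
  [IsManifold (𝓡 11) ∞ P']

/-- The bilinear form `G = 2 (θ¹ θ² + θ³ θ⁴)` on `P`. -/
def G (𝓒 : CartanBundle 𝓜 π P) (p : P) (u v : TangentSpace (𝓡 11) p) : ℝ :=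
  ∑ i, ∑ j, eta i j * (𝓒.θ i p u * 𝓒.θ j p v)

/-- `(G, A)` descends to the Weyl geometry of `(g, A)` on the base: on `P` the pair `(G, A)` is
`(e^{2f} q^*g, q^*A - 2 df)` for a smooth function `f`. -/
def Induces (𝓒 : CartanBundle 𝓜 π P) (g : BilinField) (A : CovField) : Prop :=
  IsWeylPair (range π) g A ∧ ∃ f : P → ℝ, ContMDiff (𝓡 11) 𝓘(ℝ, ℝ) ∞ f ∧ ∀ p,
    (∀ u v, 𝓒.G p u v = Real.exp (2 * f p) *
      g (𝓒.q p) (dmap (𝓡 11) 𝓒.q p u) (dmap (𝓡 11) 𝓒.q p v)) ∧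
    ∀ u, 𝓒.A p u = A (𝓒.q p) (dmap (𝓡 11) 𝓒.q p u)
      - 2 * dmap (𝓡 11) f p u

/-- `T` identifies `P`, equivariantly and over the linear isomorphism `L` on the bases, with the
open set over `L (range π)` of the principal bundle `CO(2,2) → ℝ⁴ ⋊ CO(2,2) → ℝ⁴`, and the coframe
with the Maurer–Cartan form `(a⁻¹ dv, a⁻¹ da)` of this group. -/
structure IsGroupModel (𝓒 : CartanBundle 𝓜 π P) (L : R4 ≃L[ℝ] R4) (T : P → Sim) : Prop where
  emb : IsSmoothEmb (𝓡 11) (fun p => (T p).coords)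
  range_eq : range T = {x : Sim | x.left.toAdd ∈ L '' range π}
  left_eq : ∀ p, (T p).left.toAdd = L (𝓒.q p)
  act_eq : ∀ p b, T (𝓒.act p b) = T p * SemidirectProduct.inr b
  θ_eq : ∀ p v i, 𝓒.θ i p v = ∑ j, coMat (T p).right⁻¹ i j *
    (dmap (𝓡 11) (fun p => (T p).left.toAdd j) p v)
  Γ_eq : ∀ p v i j, gamma 𝓒.Ω 𝓒.A i j p v = ∑ k, coMat (T p).right⁻¹ i k *
    (dmap (𝓡 11) (fun p => coMat (T p).right k j) p v)

/-- `F` is an isomorphism of principal bundles over the base, compatible with the coframes and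
with the maps to `M`, up to the automorphism of `CO(2,2)` by `J = diag(ε, 1, ε, 1)` (the identity
for `ε = 1`; for `ε = -1` it replaces `G` by `-G`). -/
structure IsIso (𝓒 : CartanBundle 𝓜 π P) (𝓒' : CartanBundle 𝓜 π P') (ε : ℝ) (F : P → P') :
    Prop where
  q_eq : ∀ p, 𝓒'.q (F p) = 𝓒.q p
  act_eq : ∀ p (b b' : CO22), coMat b' * signMat ε = signMat ε * coMat b →
    F (𝓒.act p b) = 𝓒'.act (F p) b'
  θ_eq : ∀ p v i, 𝓒'.θ i (F p) (mfderiv (𝓡 11) (𝓡 11) F p v) = signMat ε i i * 𝓒.θ i p v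
  Γ_eq : ∀ p v i j, gamma 𝓒'.Ω 𝓒'.A i j (F p) (mfderiv (𝓡 11) (𝓡 11) F p v)
    = signMat ε i i * gamma 𝓒.Ω 𝓒.A i j p v * signMat ε j j
  dom_iff : ∀ p, F p ∈ 𝓒'.dom ↔ p ∈ 𝓒.dom
  ρ_eq : ∀ p ∈ 𝓒.dom, 𝓒'.ρ (F p) = 𝓒.ρ p

end CartanBundle

/-! ### Point transformations -/

/-- `f` restricts to a diffeomorphism of the open set `O` onto an open set. -/
def IsDiffeoOn {X : Type*} [NormedAddCommGroup X] [NormedSpace ℝ X] (f : X → X) (O : Set X) :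
    Prop :=
  IsOpen O ∧ ContDiffOn ℝ ∞ f O ∧ InjOn f O ∧ ∀ x ∈ O, Function.Bijective (fderiv ℝ f x)

/-- `j` embeds `M` as a hypersurface in the correspondence space `ℝ³ × ℝ⁴`, and the para-CR
structure of `M` is induced from the splitting of this space: `H⁺`, `H⁻` are the parts of the
tangent spaces of the hypersurface that lie in `ℝ³` and in `ℝ⁴`. -/
structure IsCorrespondence {M : Type*} [TopologicalSpace M]
    [ChartedSpace (EuclideanSpace ℝ (Fin 6)) M] [IsManifold (𝓡 6) ∞ M]
    (𝓜 : ParaCR (𝓡 6) M 2 3) (j : M → (ℝ × ℝ × ℝ) × R4) : Prop where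
  emb : IsSmoothEmb (𝓡 6) j
  plus_iff : ∀ m v, v ∈ 𝓜.plus m ↔
    (dmap (𝓡 6) j m v).2 = 0
  minus_iff : ∀ m v, v ∈ 𝓜.minus m ↔
    (dmap (𝓡 6) j m v).1 = 0

/-- `β^*ḡ = ± e^{2φ} g` and `β^*Ā = A - 2 dφ` on `V`, for a constant sign and a smooth `φ`. -/
def ChangesConformally (V : Set R4) (β : R4 → R4) (g : BilinField) (A : CovField)
    (g' : BilinField) (A' : CovField) : Prop :=
  ∃ (ε : ℝ) (φ : R4 → ℝ), (ε = 1 ∨ ε = -1) ∧ ContDiffOn ℝ ∞ φ V ∧ ∀ s ∈ V,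
    (∀ u v, g' (β s) (fderiv ℝ β s u) (fderiv ℝ β s v) = ε * Real.exp (2 * φ s) * g s u v) ∧
    ∀ u, A' (β s) (fderiv ℝ β s u) = A s u - 2 * fderiv ℝ φ s u

end ParaCRFlat

end

/-!
The points of a Cartan bundle are frames of `ℝ⁴`, and the theorem holds because the frames that
occur are exactly the conformal frames of `ε g₀`, for one sign `ε`.

*The conformal class.* At a point of `M` with the coordinates `(x, y, a)` the sum `H⁺ ⊕ H⁻` is the
kernel of the covector `(1, x, y, xy)` on the parameter space. These covectors are null for `g₀`,
and, for `(x, y)` in any non-empty open set, `g₀` is up to a factor the only symmetric form for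
which they are (`eq_smul_g0mat`). In a Cartan bundle the null covector `θ⁴` of a frame in the
domain of `ρ` is a multiple of such a covector (`nullRow_eq_of_annihilates`), and every point of `M`
arises in this way from any frame over its parameters, by the action of `CO(2,2)`. So the metric of
a frame is a multiple of `g₀` (`CartanBundle.frameForm_eq`), with a sign that is constant as `M` is
connected (`CartanBundle.exists_sign`).

*The connection.* After the choice of a linear isomorphism `L` of `ℝ⁴` that takes `ε g₀` to `η`, the
frames become elements `b` of `CO(2,2)` with `θ = b⁻¹ L dq`. Both `Γ` and the Maurer–Cartan form
`b⁻¹ db` satisfy the structure equation `dθ + Γ ∧ θ = 0`, so that their difference is a semibasic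
form determined by its trace: this is the first prolongation of `𝔠𝔬(2,2)`, `torsionFree_form`. The
trace is invariant, hence a 1-form on the base, and it is not determined by `H⁺` and `θ`: the
condition that `θ⁴, Ω₂, Ω₃` define `H⁻` is what makes it vanish. Indeed `Ω₂, Ω₃` have to agree,
modulo `θ⁴`, with the components of `b⁻¹ db` that express the change of the null direction `θ⁴`;
this annihilates the component of the 1-form along one null vector for each point `(x, y)` of a
fibre, and these null vectors span `ℝ⁴` (`covector_eq_zero`). Thus `Γ = b⁻¹ db`
(`CartanBundle.exists_isFrameMap`).

*Consequences.* The map `p ↦ (q p, b p)` is an embedding of `P` onto `S × CO(2,2)`, which gives the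
identification with a part of `ℝ⁴ ⋊ CO(2,2)` and reduces isomorphisms of Cartan bundles to
`b' = J b J` (`existsUnique_iso`). The form `G` is `ε g₀` divided by the dilation factor of `b`, and
`A` is the logarithmic differential of this factor, so that the induced pairs are those of the flat
Weyl geometry (`induces_iff`).

*Existence.* Conversely `S × CO(2,2)` with `θ = b⁻¹ L ds` and `Γ = b⁻¹ db` is a Cartan bundle
(`Model.cartanBundle`), where `ρ` takes a frame to the point of `M` with the null direction `θ⁴`. It
is a submanifold of `ℝ⁴ × ℝ^(4×4)`, with charts given by the Cayley transform.

*Point transformations.* A change of the parameters by a diffeomorphism `β` takes Cartan bundles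
to Cartan bundles with the same forms (`CartanBundle.transport`), in both directions, so that the
induced Weyl geometries correspond under `β` up to the sign.
-/

noncomputable section

namespace ParaCRFlat

/-! ### Smooth maps from manifolds to normed spaces -/

section Calculus

variable {E H : Type*} [NormedAddCommGroup E] [NormedSpace ℝ E] [TopologicalSpace H]
  {I : ModelWithCorners ℝ E H} {P : Type*} [TopologicalSpace P] [ChartedSpace H P]
  {F : Type*} [NormedAddCommGroup F] [NormedSpace ℝ F]
  {F' : Type*} [NormedAddCommGroup F'] [NormedSpace ℝ F']

theorem dmap_eq_fderiv [I.Boundaryless] {f : P → F} {p : P}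
    (hf : MDifferentiableAt I 𝓘(ℝ, F) f p) :
    dmap I f p = fderiv ℝ (f ∘ (extChartAt I p).symm) (extChartAt I p p) := by
  unfold dmap
  rw [hf.mfderiv, I.range_eq_univ, fderivWithin_univ]
  rfl

theorem _root_.ContMDiffAt.mdiff {E' H' : Type*} [NormedAddCommGroup E'] [NormedSpace ℝ E']
    [TopologicalSpace H'] {I' : ModelWithCorners ℝ E' H'} {N : Type*} [TopologicalSpace N]
    [ChartedSpace H' N] {f : P → N} {p : P} (hf : ContMDiffAt I I' ∞ f p) :
    MDifferentiableAt I I' f p :=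
  hf.mdifferentiableAt (by simp)

theorem hasMFDerivAt_dmap {f : P → F} {p : P} (hf : MDifferentiableAt I 𝓘(ℝ, F) f p) :
    HasMFDerivAt I 𝓘(ℝ, F) f p (dmap I f p) := hf.hasMFDerivAt

theorem dmap_comp {g : F → F'} {f : P → F} {p : P} {g' : F →L[ℝ] F'}
    (hg : HasFDerivAt g g' (f p)) (hf : MDifferentiableAt I 𝓘(ℝ, F) f p)
    (v : TangentSpace I p) : dmap I (fun p => g (f p)) p v = g' (dmap I f p v) := by
  have h := (hg.hasMFDerivAt.comp p (hasMFDerivAt_dmap hf)).mfderiv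
  exact congrArg (fun l : TangentSpace I p →L[ℝ] F' => l v) h

theorem dmap_clm (l : F →L[ℝ] F') {f : P → F} {p : P} (hf : MDifferentiableAt I 𝓘(ℝ, F) f p)
    (v : TangentSpace I p) : dmap I (fun p => l (f p)) p v = l (dmap I f p v) :=
  dmap_comp l.hasFDerivAt hf v

theorem dmap_apply {ι : Type*} [Fintype ι] {f : P → ι → F} {p : P}
    (hf : MDifferentiableAt I 𝓘(ℝ, ι → F) f p) (i : ι) (v : TangentSpace I p) :
    dmap I (fun p => f p i) p v = dmap I f p v i :=
  dmap_clm (ContinuousLinearMap.proj i : (ι → F) →L[ℝ] F) hf v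

theorem dmap_fst {f : P → F × F'} {p : P}
    (hf : MDifferentiableAt I 𝓘(ℝ, F × F') f p) (v : TangentSpace I p) :
    dmap I (fun p => (f p).1) p v = (dmap I f p v).1 :=
  dmap_clm (ContinuousLinearMap.fst ℝ F F') hf v

theorem dmap_snd {f : P → F × F'} {p : P}
    (hf : MDifferentiableAt I 𝓘(ℝ, F × F') f p) (v : TangentSpace I p) :
    dmap I (fun p => (f p).2) p v = (dmap I f p v).2 :=
  dmap_clm (ContinuousLinearMap.snd ℝ F F') hf v

theorem dmap_congr {f g : P → F} {p : P} (h : f =ᶠ[𝓝 p] g) : dmap I f p = dmap I g p :=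
  h.mfderiv_eq

theorem dmap_mul {f g : P → ℝ} {p : P} (hf : MDifferentiableAt I 𝓘(ℝ, ℝ) f p)
    (hg : MDifferentiableAt I 𝓘(ℝ, ℝ) g p) (v : TangentSpace I p) :
    dmap I (fun p => f p * g p) p v = f p * dmap I g p v + g p * dmap I f p v := by
  have h := ((hasMFDerivAt_dmap hf).mul (hasMFDerivAt_dmap hg)).mfderiv
  have := congrArg (fun l : TangentSpace I p →L[ℝ] ℝ => l v) h
  exact this

theorem clm_sum_apply {ι : Type*} (s : Finset ι) (f : ι → F →L[ℝ] F') (v : F) :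
    (∑ k ∈ s, f k) v = ∑ k ∈ s, f k v := by
  simp

theorem dmap_add {f g : P → F} {p : P} (hf : MDifferentiableAt I 𝓘(ℝ, F) f p)
    (hg : MDifferentiableAt I 𝓘(ℝ, F) g p) (v : TangentSpace I p) :
    dmap I (fun p => f p + g p) p v = dmap I f p v + dmap I g p v :=
  congrArg (fun l : TangentSpace I p →L[ℝ] F => l v)
    ((hasMFDerivAt_dmap hf).add (hasMFDerivAt_dmap hg)).mfderiv

theorem dmap_const (c : F) (p : P) (v : TangentSpace I p) : dmap I (fun _ : P => c) p v = 0 :=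
  congrArg (fun l : TangentSpace I p →L[ℝ] F => l v) mfderiv_const

theorem mdifferentiableAt_sum {ι : Type*} (s : Finset ι) {f : ι → P → F} {p : P}
    (hf : ∀ k ∈ s, MDifferentiableAt I 𝓘(ℝ, F) (f k) p) :
    MDifferentiableAt I 𝓘(ℝ, F) (fun p => ∑ k ∈ s, f k p) p := by
  classical
  induction s using Finset.induction_on with
  | empty => simpa using mdifferentiableAt_const
  | insert a s ha ih =>
    simp only [Finset.sum_insert ha]
    exact (hf a (by simp)).add (ih fun k hk => hf k (by simp [hk]))

theorem dmap_sum {ι : Type*} (s : Finset ι) {f : ι → P → F} {p : P}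
    (hf : ∀ k ∈ s, MDifferentiableAt I 𝓘(ℝ, F) (f k) p) (v : TangentSpace I p) :
    dmap I (fun p => ∑ k ∈ s, f k p) p v = ∑ k ∈ s, dmap I (f k) p v := by
  classical
  induction s using Finset.induction_on with
  | empty => simpa using dmap_const (0 : F) p v
  | insert a s ha ih =>
    simp only [Finset.sum_insert ha]
    rw [dmap_add (hf a (by simp)) (mdifferentiableAt_sum s fun k hk => hf k (by simp [hk])),
      ih fun k hk => hf k (by simp [hk])]

variable {E' H' : Type*} [NormedAddCommGroup E'] [NormedSpace ℝ E']
    [TopologicalSpace H'] {I' : ModelWithCorners ℝ E' H'} {N : Type*} [TopologicalSpace N]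
    [ChartedSpace H' N]

theorem dmap_mfderiv {g : N → F} {f : P → N} {p : P} (hg : MDifferentiableAt I' 𝓘(ℝ, F) g (f p))
    (hf : MDifferentiableAt I I' f p) (v : TangentSpace I p) :
    dmap I (fun p => g (f p)) p v = dmap I' g (f p) (mfderiv I I' f p v) :=
  congrArg (fun l : TangentSpace I p →L[ℝ] F => l v) (mfderiv_comp p hg hf)

/-- The inverse function theorem for maps to a normed space: a continuous map is smooth if its
composition with an immersion is. -/
theorem contMDiffAt_of_immersion [IsManifold I' ∞ N] [I'.Boundaryless] [FiniteDimensional ℝ E']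
    [FiniteDimensional ℝ F] {j : N → F} {g : P → N} {p : P} (hj : ContMDiffAt I' 𝓘(ℝ, F) ∞ j (g p))
    (hinj : Function.Injective (dmap I' j (g p))) (hg : ContinuousAt g p)
    (hjg : ContMDiffAt I 𝓘(ℝ, F) ∞ (fun x => j (g x)) p) : ContMDiffAt I I' ∞ g p := by
  have : CompleteSpace E' := FiniteDimensional.complete ℝ E'
  rw [contMDiffAt_iff_target]
  refine ⟨hg, ?_⟩
  set φ := extChartAt I' (g p) with hφ
  set y₀ := φ (g p) with hy₀
  have hJ : ContDiffAt ℝ ∞ (j ∘ φ.symm) y₀ := by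
    have := (contMDiffAt_iff.1 hj).2
    rw [I'.range_eq_univ, contDiffWithinAt_univ] at this
    exact this
  have hd : dmap I' j (g p) = fderiv ℝ (j ∘ φ.symm) y₀ := dmap_eq_fderiv hj.mdiff
  rw [hd] at hinj
  obtain ⟨l₀, hl₀⟩ := LinearMap.exists_leftInverse_of_injective
    (fderiv ℝ (j ∘ φ.symm) y₀).toLinearMap (LinearMap.ker_eq_bot.2 hinj)
  let l : F →L[ℝ] E' := LinearMap.toContinuousLinearMap l₀
  have hl : l.comp (fderiv ℝ (j ∘ φ.symm) y₀) = ContinuousLinearMap.id ℝ E' := by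
    ext v
    exact congrArg (fun f : E' →ₗ[ℝ] E' => f v) hl₀
  have hh : ContDiffAt ℝ ∞ (fun y => l (j (φ.symm y))) y₀ := l.contDiff.contDiffAt.comp y₀ hJ
  have hh' : HasFDerivAt (fun y => l (j (φ.symm y)))
      ((ContinuousLinearEquiv.refl ℝ E' : E' ≃L[ℝ] E') : E' →L[ℝ] E') y₀ := by
    have := l.hasFDerivAt.comp y₀ (hJ.differentiableAt (by simp)).hasFDerivAt
    rw [hl] at this
    exact this
  set K := hh.localInverse hh' (by simp) with hK
  have hKs : ContDiffAt ℝ ∞ K (l (j (φ.symm y₀))) := hh.to_localInverse hh' (by simp)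
  have hKl : ∀ᶠ y in 𝓝 y₀, K (l (j (φ.symm y))) = y :=
    (hh.hasStrictFDerivAt' hh' (by simp)).eventually_left_inverse
  have hsy : φ.symm y₀ = g p := extChartAt_to_inv (I := I') (g p)
  have hcont : Tendsto (fun x => φ (g x)) (𝓝 p) (𝓝 y₀) :=
    (continuousAt_extChartAt (I := I') (g p)).tendsto.comp hg
  have hev : ∀ᶠ x in 𝓝 p, (φ ∘ g) x = K (l (j (g x))) := by
    filter_upwards [hcont.eventually hKl,
      hg.eventually (extChartAt_source_mem_nhds (I := I') (g p))] with x hx hx'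
    rw [φ.left_inv hx'] at hx
    exact hx.symm
  refine ContMDiffAt.congr_of_eventuallyEq ?_ hev
  rw [hsy] at hKs
  exact (hKs.comp_contMDiffAt (x := p) (f := fun x => l (j (g x)))
    (l.contDiff.contDiffAt.comp_contMDiffAt hjg))

theorem isOpenMap_of_surjective_dmap [IsManifold I ∞ P] [I.Boundaryless] [CompleteSpace E]
    [CompleteSpace F] {f : P → F} (hf : ContMDiff I 𝓘(ℝ, F) ∞ f)
    (hs : ∀ p, Function.Surjective (dmap I f p)) : IsOpenMap f := by
  rw [isOpenMap_iff_nhds_le]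
  intro p
  set φ := extChartAt I p with hφ
  have hJ : ContDiffAt ℝ ∞ (f ∘ φ.symm) (φ p) := by
    have := (contMDiffAt_iff.1 (hf p)).2
    rw [I.range_eq_univ, contDiffWithinAt_univ] at this
    exact this
  have h1 := hJ.hasStrictFDerivAt (by simp)
  have h2 := h1.map_nhds_eq_of_surj (LinearMap.range_eq_top.2
    (by rw [← dmap_eq_fderiv (hf p).mdiff]; exact hs p))
  have hsy : φ.symm (φ p) = p := extChartAt_to_inv (I := I) p
  simp only [Function.comp, hsy] at h2
  rw [← h2]
  have : Tendsto φ.symm (𝓝 (φ p)) (𝓝 p) := by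
    have := continuousAt_extChartAt_symm (I := I) p
    rwa [ContinuousAt, extChartAt_to_inv] at this
  have h3 := Filter.map_mono (m := f) this
  rwa [Filter.map_map] at h3

end Calculus

/-! ### One-forms that are combinations of differentials of functions -/

section Forms

variable {E H : Type*} [NormedAddCommGroup E] [NormedSpace ℝ E] [TopologicalSpace H]
  {I : ModelWithCorners ℝ E H} [I.Boundaryless] {P : Type*} [TopologicalSpace P]
  [ChartedSpace H P] [IsManifold I ∞ P]
  {F : Type*} [NormedAddCommGroup F] [NormedSpace ℝ F]

omit [I.Boundaryless] in
theorem contDiffOn_comp_extChartAt_symm {f : P → F} (hf : ContMDiff I 𝓘(ℝ, F) ∞ f) (p₀ : P) :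
    ContDiffOn ℝ ∞ (f ∘ (extChartAt I p₀).symm) (extChartAt I p₀).target :=
  contMDiffOn_iff_contDiffOn.1 (hf.comp_contMDiffOn (contMDiffOn_extChartAt_symm p₀))

theorem inChart_dmap {f : P → F} (hf : ContMDiff I 𝓘(ℝ, F) ∞ f) (p₀ : P) {y : E}
    (hy : y ∈ (extChartAt I p₀).target) :
    (dmap I f ((extChartAt I p₀).symm y)).comp (mfderiv 𝓘(ℝ, E) I (extChartAt I p₀).symm y)
      = fderiv ℝ (f ∘ (extChartAt I p₀).symm) y := by
  rw [← mfderiv_eq_fderiv]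
  refine (mfderiv_comp y (hf _).mdiff ?_).symm
  exact ((contMDiffOn_extChartAt_symm p₀).contMDiffAt
    ((isOpen_extChartAt_target p₀).mem_nhds hy)).mdiff

theorem inChart_sum {ι : Type*} [Fintype ι] {α : OneForm I P} {f g : ι → P → ℝ}
    (hg : ∀ k, ContMDiff I 𝓘(ℝ, ℝ) ∞ (g k))
    (hα : ∀ p v, α p v = ∑ k, f k p * dmap I (g k) p v) (p₀ : P) {y : E}
    (hy : y ∈ (extChartAt I p₀).target) :
    α.inChart p₀ y = ∑ k, f k ((extChartAt I p₀).symm y) •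
      fderiv ℝ (g k ∘ (extChartAt I p₀).symm) y := by
  ext v
  refine (hα _ _).trans (Eq.trans ?_ (clm_sum_apply _ _ _).symm)
  exact Finset.sum_congr rfl fun k _ => congrArg (fun l : E →L[ℝ] ℝ => _ * l v)
    (inChart_dmap (hg k) p₀ hy)

theorem isSmooth_of_eq_sum {ι : Type*} [Fintype ι] {α : OneForm I P} {f g : ι → P → ℝ}
    (hf : ∀ k, ContMDiff I 𝓘(ℝ, ℝ) ∞ (f k)) (hg : ∀ k, ContMDiff I 𝓘(ℝ, ℝ) ∞ (g k))
    (hα : ∀ p v, α p v = ∑ k, f k p * dmap I (g k) p v) : α.IsSmooth := by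
  intro p₀
  refine ContDiffOn.congr (f := fun y => ∑ k, f k ((extChartAt I p₀).symm y) •
      fderiv ℝ (g k ∘ (extChartAt I p₀).symm) y) ?_ fun y hy => inChart_sum hg hα p₀ hy
  refine ContDiffOn.sum fun k _ => ContDiffOn.smul (contDiffOn_comp_extChartAt_symm (hf k) p₀) ?_
  exact (contDiffOn_comp_extChartAt_symm (hg k) p₀).fderiv_of_isOpen
    (isOpen_extChartAt_target p₀) (by simp)

/-- The exterior derivative of `∑ f_k dg_k` is `∑ df_k ∧ dg_k`. -/
theorem d_eq_sum {ι : Type*} [Fintype ι] {α : OneForm I P} {f g : ι → P → ℝ}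
    (hf : ∀ k, ContMDiff I 𝓘(ℝ, ℝ) ∞ (f k)) (hg : ∀ k, ContMDiff I 𝓘(ℝ, ℝ) ∞ (g k))
    (hα : ∀ p v, α p v = ∑ k, f k p * dmap I (g k) p v) (p : P) (u v : TangentSpace I p) :
    α.d p u v = ∑ k, (dmap I (f k) p u * dmap I (g k) p v
      - dmap I (f k) p v * dmap I (g k) p u) := by
  set φ := extChartAt I p with hφ
  have hmem : φ.target ∈ 𝓝 (φ p) := extChartAt_target_mem_nhds p
  have hsy : φ.symm (φ p) = p := extChartAt_to_inv (I := I) p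
  have hev : α.inChart p =ᶠ[𝓝 (φ p)] fun y => ∑ k, f k (φ.symm y) •
      fderiv ℝ (g k ∘ φ.symm) y := by
    filter_upwards [hmem] with y hy using inChart_sum hg hα p hy
  have hfd : ∀ k, HasFDerivAt (f k ∘ φ.symm) (dmap I (f k) p : E →L[ℝ] ℝ) (φ p) := fun k => by
    rw [show (dmap I (f k) p : E →L[ℝ] ℝ) = _ from dmap_eq_fderiv (hf k p).mdiff]
    exact (((contDiffOn_comp_extChartAt_symm (hf k) p).contDiffAt hmem).differentiableAt
      (by simp)).hasFDerivAt
  have hgC : ∀ k, ContDiffAt ℝ ∞ (g k ∘ φ.symm) (φ p) := fun k =>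
    (contDiffOn_comp_extChartAt_symm (hg k) p).contDiffAt hmem
  have hgd : ∀ k, fderiv ℝ (g k ∘ φ.symm) (φ p) = (dmap I (g k) p : E →L[ℝ] ℝ) := fun k =>
    (dmap_eq_fderiv (hg k p).mdiff).symm
  have hgdd : ∀ k, DifferentiableAt ℝ (fderiv ℝ (g k ∘ φ.symm)) (φ p) := fun k =>
    ((hgC k).fderiv_right (m := ∞) (by simp)).differentiableAt (by simp)
  let df : ι → E →L[ℝ] ℝ := fun k => dmap I (f k) p
  let dg : ι → E →L[ℝ] ℝ := fun k => dmap I (g k) p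
  have hD : HasFDerivAt (α.inChart p) (∑ k, ((f k p) • fderiv ℝ (fderiv ℝ (g k ∘ φ.symm)) (φ p)
      + (df k).smulRight (dg k))) (φ p) := by
    refine HasFDerivAt.congr_of_eventuallyEq ?_ hev
    refine HasFDerivAt.fun_sum fun k _ => ?_
    have := (hfd k).smul (hgdd k).hasFDerivAt
    rw [hgd k] at this
    simp only [Function.comp, hsy] at this
    exact this
  unfold OneForm.d
  rw [hD.fderiv]
  have hsymm : ∀ k, ∀ a b : E, fderiv ℝ (fderiv ℝ (g k ∘ φ.symm)) (φ p) a b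
      = fderiv ℝ (fderiv ℝ (g k ∘ φ.symm)) (φ p) b a := fun k a b =>
    ((hgC k).isSymmSndFDerivAt (by simpa using WithTop.coe_le_coe.2 (le_top : (2 : ℕ∞) ≤ ⊤))).eq a b
  have hE : ∀ a b : E, (∑ k, ((f k p) • fderiv ℝ (fderiv ℝ (g k ∘ φ.symm)) (φ p)
      + (df k).smulRight (dg k))) a b
      = ∑ k, (f k p * fderiv ℝ (fderiv ℝ (g k ∘ φ.symm)) (φ p) a b + df k a * dg k b) := by
    intro a b
    rw [clm_sum_apply, clm_sum_apply]
    rfl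
  refine (congrArg₂ (· - ·) (hE u v) (hE v u)).trans ?_
  simp only [← Finset.sum_sub_distrib]
  refine Finset.sum_congr rfl fun k _ => ?_
  rw [hsymm k u v]
  change _ = df k u * dg k v - df k v * dg k u
  ring

theorem contDiffAt_det {n : ℕ} {A : E → Matrix (Fin n) (Fin n) ℝ} {x : E}
    (hA : ∀ i j, ContDiffAt ℝ ∞ (fun y => A y i j) x) :
    ContDiffAt ℝ ∞ (fun y => (A y).det) x := by
  simp only [Matrix.det_apply']
  exact ContDiffAt.sum fun σ _ => contDiffAt_const.mul (contDiffAt_prod fun i _ => hA _ _)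

theorem contDiffAt_inv_apply {n : ℕ} {A : E → Matrix (Fin n) (Fin n) ℝ} {x : E}
    (hA : ∀ i j, ContDiffAt ℝ ∞ (fun y => A y i j) x) (h : (A x).det ≠ 0) (i j : Fin n) :
    ContDiffAt ℝ ∞ (fun y => (A y)⁻¹ i j) x := by
  simp only [Matrix.inv_def, Ring.inverse_eq_inv', Matrix.smul_apply, smul_eq_mul,
    Matrix.adjugate_apply]
  refine ((contDiffAt_det hA).inv h).mul (contDiffAt_det fun k l => ?_)
  by_cases hk : k = j
  · simp only [hk, Matrix.updateRow_self]
    exact contDiffAt_const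
  · simp only [Matrix.updateRow_ne hk]
    exact hA _ _

/-- The coefficients of a smooth form with respect to the differentials of the components of a
submersion are smooth. -/
theorem contMDiff_of_isSmooth [FiniteDimensional ℝ E] {n : ℕ} {α : OneForm I P}
    {q : P → Fin n → ℝ} {B : P → Fin n → ℝ} (hα : α.IsSmooth)
    (hq : ContMDiff I 𝓘(ℝ, Fin n → ℝ) ∞ q) (hs : ∀ p, Function.Surjective (dmap I q p))
    (h : ∀ p v, α p v = ∑ k, B p k * dmap I q p v k) :
    ContMDiff I 𝓘(ℝ, Fin n → ℝ) ∞ B := by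
  intro p
  set φ := extChartAt I p with hφ
  have hmem : φ.target ∈ 𝓝 (φ p) := extChartAt_target_mem_nhds p
  have hqk : ∀ k, ContMDiff I 𝓘(ℝ, ℝ) ∞ fun x => q x k := contMDiff_pi_space.1 hq
  have hsum := fun y (hy : y ∈ φ.target) => inChart_sum (α := α) (f := fun k x => B x k)
    (g := fun k x => q x k) hqk (fun x v => by
      rw [h]
      exact Finset.sum_congr rfl fun k _ => by rw [dmap_apply (hq x).mdiff]) p hy
  -- the derivative of `q` in the chart, restricted to a complement of its kernel at `φ p`
  choose e he using fun k : Fin n => hs p (Pi.single k 1)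
  let D : E → Matrix (Fin n) (Fin n) ℝ := fun y k l => fderiv ℝ ((fun x => q x k) ∘ φ.symm) y (e l)
  have hD1 : D (φ p) = 1 := by
    ext k l
    have h1 : fderiv ℝ ((fun x => q x k) ∘ φ.symm) (φ p) = dmap I (fun x => q x k) p :=
      (dmap_eq_fderiv (hqk k p).mdiff).symm
    have h2 : D (φ p) k l = dmap I q p (e l) k := by
      rw [← dmap_apply (hq p).mdiff k (e l), ← h1]
      rfl
    rw [h2, he, Matrix.one_apply, Pi.single_apply]
  have hDs : ∀ k l, ContDiffAt ℝ ∞ (fun y => D y k l) (φ p) := fun k l =>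
    (((contDiffOn_comp_extChartAt_symm (hqk k) p).contDiffAt hmem).fderiv_right (m := ∞)
      (by simp)).clm_apply contDiffAt_const
  have hdet0 : (D (φ p)).det ≠ 0 := by simp [hD1]
  have hαs : ∀ l, ContDiffAt ℝ ∞ (fun y => α.inChart p y (e l)) (φ p) := fun l =>
    ((hα p).contDiffAt hmem).clm_apply contDiffAt_const
  have key : ∀ l, ContDiffAt ℝ ∞ (fun y => B (φ.symm y) l) (φ p) := by
    intro l
    have : ContDiffAt ℝ ∞ (fun y => ∑ k, α.inChart p y (e k) * (D y)⁻¹ k l) (φ p) :=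
      ContDiffAt.sum fun k _ => (hαs k).mul (contDiffAt_inv_apply hDs hdet0 k l)
    refine this.congr_of_eventuallyEq ?_
    filter_upwards [hmem, (contDiffAt_det hDs).continuousAt.eventually_ne hdet0] with y hy hy0
    have hv : (fun k => α.inChart p y (e k)) = (fun k => B (φ.symm y) k) ᵥ* D y := by
      ext k
      exact (congrArg (fun l : E →L[ℝ] ℝ => l (e k)) (hsum y hy)).trans (clm_sum_apply _ _ _)
    have h3 : ∑ k, α.inChart p y (e k) * (D y)⁻¹ k l
        = ((fun k => α.inChart p y (e k)) ᵥ* (D y)⁻¹) l := rfl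
    rw [h3, hv, Matrix.vecMul_vecMul, Matrix.mul_nonsing_inv _ (isUnit_iff_ne_zero.2 hy0),
      Matrix.vecMul_one]
  have key' : ContMDiffAt 𝓘(ℝ, E) 𝓘(ℝ, Fin n → ℝ) ∞ (fun y => B (φ.symm y)) (φ p) :=
    (contDiffAt_pi.2 key).contMDiffAt
  refine (key'.comp p contMDiffAt_extChartAt).congr_of_eventuallyEq ?_
  filter_upwards [extChartAt_source_mem_nhds (I := I) p] with x hx
  simp only [Function.comp]
  rw [φ.left_inv hx]

omit [I.Boundaryless] [IsManifold I ∞ P] in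
theorem OneForm.IsSmooth.congr_sum {ι : Type*} [Fintype ι] {α : OneForm I P}
    {β : ι → OneForm I P} (c : ι → ℝ) (hβ : ∀ k, (β k).IsSmooth)
    (h : ∀ p v, α p v = ∑ k, c k * β k p v) : α.IsSmooth := by
  intro p₀
  have : α.inChart p₀ = fun y => ∑ k, c k • (β k).inChart p₀ y := by
    funext y
    ext v
    exact (h _ _).trans (clm_sum_apply _ (fun k => c k • (β k).inChart p₀ y) v).symm
  rw [this]
  exact ContDiffOn.sum fun k _ => contDiffOn_const.smul (f := fun _ => c k) (hβ k p₀)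

end Forms

/-! ### Linear algebra of the conformal group `CO(2,2)` -/

/-- `b ∈ CO(2,2)`, for a matrix `b`. -/
def IsCO (b : Matrix (Fin 4) (Fin 4) ℝ) : Prop := ∃ c : ℝ, 0 < c ∧ bᵀ * eta * b = c • eta

/-- The number `c` with `bᵀ η b = c η`, for a matrix `b` in `CO(2,2)`. -/
def scale (b : Matrix (Fin 4) (Fin 4) ℝ) : ℝ := (bᵀ * eta * b) 0 1

/-- The matrix of the form `g₀ = 2 (da₀ da₃ - da₁ da₂)`; it is its own inverse. -/
def g0mat : Matrix (Fin 4) (Fin 4) ℝ := !![0, 0, 0, 1; 0, 0, -1, 0; 0, -1, 0, 0; 1, 0, 0, 0]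

/-- A linear map `L` of `ℝ⁴` with `L^* η = ε g₀`, for `ε = ±1`. -/
def modelMat (ε : ℝ) : Matrix (Fin 4) (Fin 4) ℝ := !![ε, 0, 0, 0; 0, 0, 0, 1; 0, -ε, 0, 0; 0, 0, 1, 0]

/-- The coefficients of `λ` at a point `(x, y, a)`: a null covector of `g₀`. -/
def nullCov (w : ℝ × ℝ) : R4 := ![1, w.1, w.2, w.1 * w.2]

theorem eta_mul_eta : eta * eta = 1 := by
  ext i j
  fin_cases i <;> fin_cases j <;> simp [eta, Matrix.mul_apply, Fin.sum_univ_four]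

theorem eta_transpose : etaᵀ = eta := by
  ext i j
  fin_cases i <;> fin_cases j <;> simp [eta]

theorem g0_apply (u v : R4) : g0 u v = u 0 * v 3 + u 3 * v 0 - u 1 * v 2 - u 2 * v 1 := by
  simp [g0]

theorem g0_eq_dotProduct (u v : R4) : g0 u v = u ⬝ᵥ (g0mat *ᵥ v) := by
  rw [g0_apply]
  simp [g0mat, Matrix.mulVec, dotProduct, Fin.sum_univ_four]
  ring

theorem modelMat_conj {ε : ℝ} (hε : ε = 1 ∨ ε = -1) :
    (modelMat ε)ᵀ * eta * modelMat ε = ε • g0mat := by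
  rcases hε with rfl | rfl <;> ext i j <;> fin_cases i <;> fin_cases j <;>
    simp [eta, modelMat, g0mat, Matrix.mul_apply, Fin.sum_univ_four]

theorem modelMat_conj' {ε : ℝ} (hε : ε = 1 ∨ ε = -1) :
    modelMat ε * g0mat * (modelMat ε)ᵀ = ε • eta := by
  rcases hε with rfl | rfl <;> ext i j <;> fin_cases i <;> fin_cases j <;>
    simp [eta, modelMat, g0mat, Matrix.mul_apply, Fin.sum_univ_four]

theorem modelMat_mul_transpose {ε : ℝ} (hε : ε = 1 ∨ ε = -1) :
    modelMat ε * (modelMat ε)ᵀ = 1 := by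
  rcases hε with rfl | rfl <;> ext i j <;> fin_cases i <;> fin_cases j <;>
    simp [modelMat, Matrix.mul_apply, Fin.sum_univ_four]

theorem modelMat_transpose_mul {ε : ℝ} (hε : ε = 1 ∨ ε = -1) :
    (modelMat ε)ᵀ * modelMat ε = 1 :=
  mul_eq_one_comm.1 (modelMat_mul_transpose hε)

theorem signMat_mul_modelMat (δ ε : ℝ) : signMat δ * modelMat ε = modelMat (δ * ε) := by
  ext i j
  fin_cases i <;> fin_cases j <;> simp [signMat, modelMat]

theorem signMat_mul_self {ε : ℝ} (hε : ε = 1 ∨ ε = -1) : signMat ε * signMat ε = 1 := by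
  rcases hε with rfl | rfl <;> ext i j <;> fin_cases i <;> fin_cases j <;>
    simp [signMat, Matrix.mul_apply, Fin.sum_univ_four]

theorem signMat_transpose (ε : ℝ) : (signMat ε)ᵀ = signMat ε := by
  simp [signMat]

theorem signMat_conj_eta {ε : ℝ} (hε : ε = 1 ∨ ε = -1) :
    signMat ε * eta * signMat ε = ε • eta := by
  rcases hε with rfl | rfl <;> ext i j <;> fin_cases i <;> fin_cases j <;>
    simp [eta, signMat, Matrix.mul_apply, Fin.sum_univ_four]

theorem smul_eta_inj {c d : ℝ} (h : c • eta = d • eta) : c = d := by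
  have := congrFun (congrFun h 0) 1
  simpa [eta] using this

theorem scale_eq {b : Matrix (Fin 4) (Fin 4) ℝ} {c : ℝ} (h : bᵀ * eta * b = c • eta) :
    scale b = c := by
  rw [scale, h]
  simp [eta]

namespace IsCO

variable {a b : Matrix (Fin 4) (Fin 4) ℝ}

theorem conj_eq (hb : IsCO b) : bᵀ * eta * b = scale b • eta := by
  obtain ⟨c, -, h⟩ := hb
  rw [scale_eq h, h]

theorem scale_pos (hb : IsCO b) : 0 < scale b := by
  obtain ⟨c, hc, h⟩ := hb
  rwa [scale_eq h]

theorem left_inv (hb : IsCO b) : ((scale b)⁻¹ • (eta * bᵀ * eta)) * b = 1 := by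
  rw [Matrix.smul_mul, Matrix.mul_assoc, Matrix.mul_assoc, ← Matrix.mul_assoc bᵀ, hb.conj_eq,
    Matrix.mul_smul, eta_mul_eta, smul_smul, inv_mul_cancel₀ hb.scale_pos.ne', one_smul]

theorem isUnit_det (hb : IsCO b) : IsUnit b.det :=
  (Matrix.isUnit_iff_isUnit_det b).1 (IsUnit.of_mul_eq_one_right _ hb.left_inv)

theorem det_ne_zero (hb : IsCO b) : b.det ≠ 0 := isUnit_iff_ne_zero.1 hb.isUnit_det

theorem inv_mul (hb : IsCO b) : b⁻¹ * b = 1 := Matrix.nonsing_inv_mul _ hb.isUnit_det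

theorem mul_inv (hb : IsCO b) : b * b⁻¹ = 1 := Matrix.mul_nonsing_inv _ hb.isUnit_det

/-- The element of the group `CO(2,2)` with the matrix `b`. -/
def toCO (hb : IsCO b) : CO22 := ⟨Matrix.nonsingInvUnit b hb.isUnit_det, hb⟩

theorem coMat_toCO (hb : IsCO b) : coMat hb.toCO = b := rfl

end IsCO

theorem isCO_coMat (b : CO22) : IsCO (coMat b) := b.2

theorem coMat_injective : Function.Injective coMat := fun _ _ h => Subtype.ext (Units.ext h)

theorem coMat_inv (b : CO22) : coMat b⁻¹ = (coMat b)⁻¹ := by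
  refine (Matrix.inv_eq_left_inv ?_).symm
  rw [← coMat_mul, inv_mul_cancel, coMat_one]

theorem IsCO.mul {a b : Matrix (Fin 4) (Fin 4) ℝ} (ha : IsCO a) (hb : IsCO b) : IsCO (a * b) :=
  isCO_coMat (ha.toCO * hb.toCO)

theorem IsCO.inv {b : Matrix (Fin 4) (Fin 4) ℝ} (hb : IsCO b) : IsCO b⁻¹ := by
  have := isCO_coMat hb.toCO⁻¹
  rwa [coMat_inv] at this

/-- `b ∈ CO(2,2)` if `b` preserves the inverse form up to a positive factor. -/
theorem isCO_of_conj_transpose {b : Matrix (Fin 4) (Fin 4) ℝ} {c : ℝ} (hc : 0 < c)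
    (h : b * eta * bᵀ = c • eta) : IsCO b := by
  have h1 : IsCO bᵀ := ⟨c, hc, by rw [Matrix.transpose_transpose, h]⟩
  have h2 : (c⁻¹ • (eta * b * eta)) * bᵀ = 1 := by
    have := h1.left_inv
    rwa [scale_eq (c := c) (by rw [Matrix.transpose_transpose, h]), Matrix.transpose_transpose]
      at this
  have h3 := mul_eq_one_comm.1 h2
  refine ⟨c, hc, ?_⟩
  have h4 : bᵀ * (eta * b * eta) = c • (1 : Matrix (Fin 4) (Fin 4) ℝ) := by
    rw [Matrix.mul_smul] at h3
    rw [← h3, smul_smul, mul_inv_cancel₀ hc.ne', one_smul]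
  calc bᵀ * eta * b = bᵀ * (eta * b * eta) * eta := by
        simp only [Matrix.mul_assoc, eta_mul_eta, Matrix.mul_one]
    _ = c • eta := by rw [h4, Matrix.smul_mul, Matrix.one_mul]

theorem IsCO.conj_transpose {b : Matrix (Fin 4) (Fin 4) ℝ} (hb : IsCO b) :
    b * eta * bᵀ = scale b • eta := by
  have h1 := mul_eq_one_comm.1 hb.left_inv
  rw [Matrix.mul_smul] at h1
  have h4 : b * (eta * bᵀ * eta) = scale b • (1 : Matrix (Fin 4) (Fin 4) ℝ) := by
    rw [← h1, smul_smul, mul_inv_cancel₀ hb.scale_pos.ne', one_smul]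
  calc b * eta * bᵀ = b * (eta * bᵀ * eta) * eta := by
        simp only [Matrix.mul_assoc, eta_mul_eta, Matrix.mul_one]
    _ = _ := by rw [h4, Matrix.smul_mul, Matrix.one_mul]

/-- Conjugation by `diag(ε, 1, ε, 1)` is an automorphism of `CO(2,2)`. -/
theorem IsCO.signMat_conj {b : Matrix (Fin 4) (Fin 4) ℝ} (hb : IsCO b) {ε : ℝ}
    (hε : ε = 1 ∨ ε = -1) : IsCO (signMat ε * b * signMat ε) := by
  refine ⟨scale b, hb.scale_pos, ?_⟩
  have hεε : ε * ε = 1 := by rcases hε with rfl | rfl <;> norm_num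
  calc (signMat ε * b * signMat ε)ᵀ * eta * (signMat ε * b * signMat ε)
      = signMat ε * (bᵀ * (signMat ε * eta * signMat ε) * b) * signMat ε := by
        simp only [Matrix.transpose_mul, signMat_transpose, Matrix.mul_assoc]
    _ = (scale b * (ε * ε)) • eta := by
        rw [signMat_conj_eta hε, Matrix.mul_smul, Matrix.smul_mul, hb.conj_eq, smul_smul,
          Matrix.mul_smul, Matrix.smul_mul, signMat_conj_eta hε, smul_smul]
        congr 1
        ring
    _ = _ := by rw [hεε, mul_one]

theorem isCO_modelMat_mul {b : Matrix (Fin 4) (Fin 4) ℝ} {c ε : ℝ} (hc : 0 < c)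
    (hε : ε = 1 ∨ ε = -1) (h : b * eta * bᵀ = (c * ε) • g0mat) : IsCO (modelMat ε * b) := by
  refine isCO_of_conj_transpose hc ?_
  calc (modelMat ε * b) * eta * (modelMat ε * b)ᵀ
      = modelMat ε * (b * eta * bᵀ) * (modelMat ε)ᵀ := by
        simp only [Matrix.transpose_mul, Matrix.mul_assoc]
    _ = _ := by
      rw [h, Matrix.mul_smul, Matrix.smul_mul, modelMat_conj' hε, smul_smul]
      rcases hε with rfl | rfl <;> simp

/-! ### Null covectors -/

theorem quadratic_eq_zero {p q r x₀ δ : ℝ} (hδ : 0 < δ)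
    (h : ∀ x, |x - x₀| < δ → p + q * x + r * x ^ 2 = 0) : p = 0 ∧ q = 0 ∧ r = 0 := by
  have h0 := h x₀ (by simpa using hδ)
  have h1 := h (x₀ + δ / 2) (by rw [add_sub_cancel_left, abs_of_pos] <;> linarith)
  have h2 := h (x₀ - δ / 2) (by
    rw [sub_sub_cancel_left, abs_neg, abs_of_pos] <;> linarith)
  have hr : r = 0 := by
    have : r * (δ ^ 2 / 2) = 0 := by linear_combination h1 + h2 - 2 * h0
    simpa [hδ.ne'] using this
  subst hr
  have hq : q = 0 := by
    have : q * δ = 0 := by linear_combination h1 - h2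
    simpa [hδ.ne'] using this
  subst hq
  exact ⟨by linarith, rfl, rfl⟩

theorem biquadratic_eq_zero {c : Fin 3 → Fin 3 → ℝ} {U : Set (ℝ × ℝ)} (hU : IsOpen U)
    (hne : U.Nonempty) (h : ∀ w ∈ U, (c 0 0 + c 0 1 * w.2 + c 0 2 * w.2 ^ 2)
      + (c 1 0 + c 1 1 * w.2 + c 1 2 * w.2 ^ 2) * w.1
      + (c 2 0 + c 2 1 * w.2 + c 2 2 * w.2 ^ 2) * w.1 ^ 2 = 0) : ∀ i j, c i j = 0 := by
  obtain ⟨⟨x₀, y₀⟩, hw⟩ := hne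
  obtain ⟨δ, hδ, hb⟩ := Metric.isOpen_iff.1 hU _ hw
  have key : ∀ y, |y - y₀| < δ → (c 0 0 + c 0 1 * y + c 0 2 * y ^ 2) = 0 ∧
      (c 1 0 + c 1 1 * y + c 1 2 * y ^ 2) = 0 ∧ (c 2 0 + c 2 1 * y + c 2 2 * y ^ 2) = 0 := by
    intro y hy
    refine quadratic_eq_zero (x₀ := x₀) hδ fun x hx => h (x, y) (hb ?_)
    rw [Metric.mem_ball, Prod.dist_eq, max_lt_iff]
    exact ⟨hx, hy⟩
  obtain ⟨a0, a1, a2⟩ := quadratic_eq_zero hδ fun y hy => (key y hy).1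
  obtain ⟨b0, b1, b2⟩ := quadratic_eq_zero hδ fun y hy => (key y hy).2.1
  obtain ⟨c0, c1, c2⟩ := quadratic_eq_zero hδ fun y hy => (key y hy).2.2
  intro i j
  fin_cases i <;> fin_cases j <;> assumption

/-- A quadratic form for which an open set of the covectors `(1, x, y, xy)` is null is a multiple
of the inverse of `g₀`. -/
theorem eq_smul_g0mat {h : Matrix (Fin 4) (Fin 4) ℝ} (hs : hᵀ = h) {U : Set (ℝ × ℝ)}
    (hU : IsOpen U) (hne : U.Nonempty) (hn : ∀ w ∈ U, nullCov w ⬝ᵥ (h *ᵥ nullCov w) = 0) :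
    h = h 0 3 • g0mat := by
  have hs' : ∀ i j, h j i = h i j := fun i j => congrFun (congrFun hs i) j
  have key := biquadratic_eq_zero (c := ![![h 0 0, 2 * h 0 2, h 2 2],
    ![2 * h 0 1, 2 * h 0 3 + 2 * h 1 2, 2 * h 2 3], ![h 1 1, 2 * h 1 3, h 3 3]]) hU hne (by
      intro w hw
      have := hn w hw
      simp only [nullCov, Matrix.mulVec, dotProduct, Fin.sum_univ_four, hs' 0 1, hs' 0 2, hs' 0 3,
        hs' 1 2, hs' 1 3, hs' 2 3] at this
      simp at this ⊢
      linear_combination this)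
  have k00 := key 0 0
  have k01 := key 0 1
  have k02 := key 0 2
  have k10 := key 1 0
  have k11 := key 1 1
  have k12 := key 1 2
  have k20 := key 2 0
  have k21 := key 2 1
  have k22 := key 2 2
  simp at k00 k01 k02 k10 k11 k12 k20 k21 k22
  have k11' : h 1 2 = - h 0 3 := by linarith
  ext i j
  fin_cases i <;> fin_cases j <;>
    simp [g0mat, hs' 0 1, hs' 0 2, hs' 0 3, hs' 1 2, hs' 1 3, hs' 2 3, *]

theorem covector_eq_zero {κ : R4} {U : Set (ℝ × ℝ)} (hU : IsOpen U) (hne : U.Nonempty)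
    (hn : ∀ w ∈ U, κ ⬝ᵥ (g0mat *ᵥ nullCov w) = 0) : κ = 0 := by
  have key := biquadratic_eq_zero (c := ![![κ 3, -κ 1, 0], ![-κ 2, κ 0, 0], ![0, 0, 0]]) hU hne (by
      intro w hw
      have := hn w hw
      simp [nullCov, g0mat, Matrix.mulVec, dotProduct, Fin.sum_univ_four] at this ⊢
      linear_combination this)
  have k00 := key 0 0
  have k01 := key 0 1
  have k10 := key 1 0
  have k11 := key 1 1
  simp at k00 k01 k10 k11
  ext i
  fin_cases i <;> assumption

/-! ### The first prolongation of the Lie algebra of `CO(2,2)` -/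

/-- The index `i'` with `η_{i i'} = 1`. -/
def dualIdx : Fin 4 → Fin 4 := ![1, 0, 3, 2]

theorem eta_mul_apply (m : Matrix (Fin 4) (Fin 4) ℝ) (i j : Fin 4) :
    (eta * m) i j = m (dualIdx i) j := by
  fin_cases i <;> simp [eta, dualIdx, Matrix.mul_apply, Fin.sum_univ_four]

theorem mul_eta_apply (m : Matrix (Fin 4) (Fin 4) ℝ) (i j : Fin 4) :
    (m * eta) i j = m i (dualIdx j) := by
  fin_cases j <;> simp [eta, dualIdx, Matrix.mul_apply, Fin.sum_univ_four]

theorem dualIdx_dualIdx (i : Fin 4) : dualIdx (dualIdx i) = i := by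
  fin_cases i <;> rfl

theorem prolongation_eq {C : Fin 4 → Fin 4 → Fin 4 → ℝ} {κ : Fin 4 → ℝ}
    (h1 : ∀ i j k, C i j k = C i k j)
    (h2 : ∀ i j k, C (dualIdx j) i k + C (dualIdx i) j k = κ k * eta i j) (i j k : Fin 4) :
    2 * C (dualIdx i) j k = κ k * eta i j + κ j * eta k i - κ i * eta j k := by
  linear_combination h2 i j k + h2 k i j - h2 j k i + h1 (dualIdx i) j k
    + h1 (dualIdx k) j i - h1 (dualIdx j) i k

/-- A `co(2,2)`-valued one-form `Δ` with `Δ ∧ θ = 0` is determined by its trace part `k`. -/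
theorem torsionFree_form {V : Type*} {Δ : V → Matrix (Fin 4) (Fin 4) ℝ} {θ : V → Fin 4 → ℝ}
    {k : V → ℝ} {e : Fin 4 → V} (he : ∀ i j, θ (e i) j = if j = i then 1 else 0)
    (h1 : ∀ u v i, ∑ j, (Δ u i j * θ v j - Δ v i j * θ u j) = 0)
    (h2 : ∀ v, (Δ v)ᵀ * eta + eta * Δ v = k v • eta) :
    (∀ i j u, Δ u i j = ∑ l, Δ (e j) i l * θ u l) ∧
    ∀ i j l, 2 * Δ (e l) (dualIdx i) j
      = k (e l) * eta i j + k (e j) * eta l i - k (e i) * eta j l := by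
  have h3 : ∀ i j u, Δ u i j = ∑ l, Δ (e j) i l * θ u l := by
    intro i j u
    have := h1 u (e j) i
    rw [Finset.sum_sub_distrib] at this
    simp only [he, mul_ite, mul_one, mul_zero, Finset.sum_ite_eq', Finset.mem_univ, if_true] at this
    linarith
  refine ⟨h3, fun i j l => prolongation_eq (C := fun i j l => Δ (e l) i j) (κ := fun l => k (e l))
    (fun i j l => ?_) (fun i j l => ?_) i j l⟩
  · rw [h3 i j (e l)]
    simp [he]
  · have := congrFun (congrFun (h2 (e l)) i) j
    rw [Matrix.add_apply, mul_eta_apply, eta_mul_apply] at this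
    simpa using this

/-! ### Submanifolds given by local parametrizations -/

section Submanifold

variable {F E : Type*} [NormedAddCommGroup F] [NormedSpace ℝ F] [NormedAddCommGroup E]
  [NormedSpace ℝ E]

/-- A subset `S` of a normed space as a smooth submanifold: around each point `x`, the set `S` is
parametrized by `param x`, defined on the open set `dom x`, whose inverse is the restriction of a
map `coord x` that is smooth on the open set `nbhd x` of the ambient space. -/
structure LocalParam (S : Set F) (E : Type*) [NormedAddCommGroup E] [NormedSpace ℝ E] where
  nbhd : S → Set F
  coord : S → F → E
  dom : S → Set E
  param : S → E → F
  isOpen_nbhd : ∀ x, IsOpen (nbhd x)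
  isOpen_dom : ∀ x, IsOpen (dom x)
  mem_nbhd : ∀ x : S, (x : F) ∈ nbhd x
  contDiffOn_coord : ∀ x, ContDiffOn ℝ ∞ (coord x) (nbhd x)
  contDiffOn_param : ∀ x, ContDiffOn ℝ ∞ (param x) (dom x)
  coord_mem : ∀ x, ∀ y ∈ S, y ∈ nbhd x → coord x y ∈ dom x
  param_coord : ∀ x, ∀ y ∈ S, y ∈ nbhd x → param x (coord x y) = y
  param_mem : ∀ x, ∀ w ∈ dom x, param x w ∈ S
  param_mem_nbhd : ∀ x, ∀ w ∈ dom x, param x w ∈ nbhd x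
  coord_param : ∀ x, ∀ w ∈ dom x, coord x (param x w) = w

namespace LocalParam

variable {S : Set F} (𝓐 : LocalParam S E)

/-- The chart around `x`. -/
def chart (x : S) : OpenPartialHomeomorph S E where
  toFun y := 𝓐.coord x y
  invFun w := by
    classical
    exact if h : w ∈ 𝓐.dom x then ⟨𝓐.param x w, 𝓐.param_mem x w h⟩ else x
  source := Subtype.val ⁻¹' 𝓐.nbhd x
  target := 𝓐.dom x
  map_source' y hy := 𝓐.coord_mem x y y.2 hy
  map_target' w hw := by
    rw [dif_pos hw]
    exact 𝓐.param_mem_nbhd x w hw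
  left_inv' y hy := by
    rw [dif_pos (𝓐.coord_mem x y y.2 hy)]
    exact Subtype.ext (𝓐.param_coord x y y.2 hy)
  right_inv' w hw := by
    rw [dif_pos hw]
    exact 𝓐.coord_param x w hw
  open_source := (𝓐.isOpen_nbhd x).preimage continuous_subtype_val
  open_target := 𝓐.isOpen_dom x
  continuousOn_toFun := (𝓐.contDiffOn_coord x).continuousOn.comp
    continuous_subtype_val.continuousOn fun _ hy => hy
  continuousOn_invFun := by
    rw [Topology.IsInducing.subtypeVal.continuousOn_iff]
    refine (𝓐.contDiffOn_param x).continuousOn.congr fun w hw => ?_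
    simp only [Function.comp]
    rw [dif_pos hw]

theorem coe_chart_symm (x : S) {w : E} (hw : w ∈ 𝓐.dom x) :
    ((𝓐.chart x).symm w : F) = 𝓐.param x w :=
  congrArg Subtype.val (dif_pos hw)

/-- The atlas of the charts `chart x`. -/
@[reducible] def chartedSpace : ChartedSpace E S where
  atlas := range 𝓐.chart
  chartAt := 𝓐.chart
  mem_chart_source := 𝓐.mem_nbhd
  chart_mem_atlas x := mem_range_self x

theorem isManifold : letI := 𝓐.chartedSpace; IsManifold 𝓘(ℝ, E) ∞ S := by
  let := 𝓐.chartedSpace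
  refine isManifold_of_contDiffOn _ _ _ ?_
  rintro _ _ ⟨x, rfl⟩ ⟨x', rfl⟩
  refine ContDiffOn.congr (f := 𝓐.coord x' ∘ 𝓐.param x) ?_ ?_
  · refine (𝓐.contDiffOn_coord x').comp ((𝓐.contDiffOn_param x).mono ?_) ?_
    · rintro w ⟨⟨hw, -⟩, -⟩
      exact hw
    · rintro w ⟨⟨hw, hw'⟩, -⟩
      have hw₀ : w ∈ 𝓐.dom x := hw
      rw [← coe_chart_symm 𝓐 x hw₀]
      exact hw'
  · rintro w ⟨⟨hw, -⟩, -⟩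
    exact congrArg (𝓐.coord x') (coe_chart_symm 𝓐 x hw)

theorem contDiffAt_param (x : S) : ContDiffAt ℝ ∞ (𝓐.param x) (𝓐.coord x x) :=
  (𝓐.contDiffOn_param x).contDiffAt ((𝓐.isOpen_dom x).mem_nhds
    (𝓐.coord_mem x x x.2 (𝓐.mem_nbhd x)))

theorem eventuallyEq_param (x : S) : (Subtype.val ∘ (𝓐.chart x).symm)
    =ᶠ[𝓝 (𝓐.coord x x)] 𝓐.param x := by
  filter_upwards [(𝓐.isOpen_dom x).mem_nhds (𝓐.coord_mem x x x.2 (𝓐.mem_nbhd x))] with w hw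
    using coe_chart_symm 𝓐 x hw

theorem contMDiff_val : letI := 𝓐.chartedSpace; ContMDiff 𝓘(ℝ, E) 𝓘(ℝ, F) ∞
    (Subtype.val : S → F) := by
  let := 𝓐.chartedSpace
  intro x
  rw [contMDiffAt_iff]
  refine ⟨continuous_subtype_val.continuousAt, ContDiffAt.contDiffWithinAt ?_⟩
  exact (𝓐.contDiffAt_param x).congr_of_eventuallyEq (𝓐.eventuallyEq_param x)

theorem injective_dmap_val (x : S) : letI := 𝓐.chartedSpace; Function.Injective
    (dmap 𝓘(ℝ, E) (Subtype.val : S → F) x) := by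
  let := 𝓐.chartedSpace
  have := 𝓐.isManifold
  have h1 : dmap 𝓘(ℝ, E) (Subtype.val : S → F) x = fderiv ℝ (𝓐.param x) (𝓐.coord x x) :=
    (dmap_eq_fderiv (𝓐.contMDiff_val x).mdiff).trans (𝓐.eventuallyEq_param x).fderiv_eq
  have hx := 𝓐.coord_mem x x x.2 (𝓐.mem_nbhd x)
  have h2 : HasFDerivAt (fun w => 𝓐.coord x (𝓐.param x w))
      ((fderiv ℝ (𝓐.coord x) (𝓐.param x (𝓐.coord x x))).comp
        (fderiv ℝ (𝓐.param x) (𝓐.coord x x))) (𝓐.coord x x) := by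
    refine HasFDerivAt.comp _ (DifferentiableAt.hasFDerivAt ?_)
      ((𝓐.contDiffAt_param x).differentiableAt (by simp)).hasFDerivAt
    exact ((𝓐.contDiffOn_coord x).contDiffAt ((𝓐.isOpen_nbhd x).mem_nhds
      (𝓐.param_mem_nbhd x _ hx))).differentiableAt (by simp)
  have h3 : HasFDerivAt (fun w => 𝓐.coord x (𝓐.param x w)) (ContinuousLinearMap.id ℝ E)
      (𝓐.coord x x) := by
    refine (hasFDerivAt_id _).congr_of_eventuallyEq ?_
    filter_upwards [(𝓐.isOpen_dom x).mem_nhds hx] with w hw using 𝓐.coord_param x w hw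
  have h4 := h2.unique h3
  rw [h1]
  exact Function.LeftInverse.injective fun v => congrArg (fun f : E →L[ℝ] E => f v) h4

end LocalParam

end Submanifold

/-! ### The group `ℝ⁴ ⋊ CO(2,2)`, over an open set of `ℝ⁴`, as a manifold -/

/-- The space `ℝ⁴ × ℝ^(4×4)`. -/
abbrev Amb : Type := R4 × (Fin 4 → Fin 4 → ℝ)

/-- The points `(s, b)` with `s ∈ V` and `b ∈ CO(2,2)`. -/
def modelSet (V : Set R4) : Set Amb := {x | x.1 ∈ V ∧ IsCO (Matrix.of x.2)}

/-- Coordinates of the point `(s, b)`: `s`, the Cayley transform of a multiple of `b`, and the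
factor. -/
abbrev CayleyCoord : Type := R4 × (Fin 6 → ℝ) × ℝ

/-- The element of `so(2,2)` with the coordinates `s`. -/
def skewMat (s : Fin 6 → ℝ) : Matrix (Fin 4) (Fin 4) ℝ :=
  eta * !![0, s 0, s 1, s 3; -s 0, 0, s 2, s 4; -s 1, -s 2, 0, s 5; -s 3, -s 4, -s 5, 0]

/-- The coordinates of an element of `so(2,2)`. -/
def skewCoord (X : Matrix (Fin 4) (Fin 4) ℝ) : Fin 6 → ℝ :=
  ![X 1 1, X 1 2, X 0 2, X 1 3, X 0 3, X 3 3]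

theorem skewMat_apply (s : Fin 6 → ℝ) (i j : Fin 4) : skewMat s i j =
    !![-s 0, 0, s 2, s 4; 0, s 0, s 1, s 3; -s 3, -s 4, -s 5, 0; -s 1, -s 2, 0, s 5] i j := by
  fin_cases i <;> fin_cases j <;> simp [skewMat, eta, Matrix.mul_apply, Fin.sum_univ_four]

theorem skewMat_skew (s : Fin 6 → ℝ) : (skewMat s)ᵀ * eta + eta * skewMat s = 0 := by
  ext i j
  rw [Matrix.add_apply, mul_eta_apply, eta_mul_apply, Matrix.transpose_apply, skewMat_apply,
    skewMat_apply]
  fin_cases i <;> fin_cases j <;> simp [dualIdx]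

theorem skewCoord_skewMat (s : Fin 6 → ℝ) : skewCoord (skewMat s) = s := by
  ext i
  fin_cases i <;> simp [skewCoord, skewMat_apply]

theorem skewMat_skewCoord {X : Matrix (Fin 4) (Fin 4) ℝ} (hX : Xᵀ * eta + eta * X = 0) :
    skewMat (skewCoord X) = X := by
  have h : ∀ i j, X (dualIdx j) i + X (dualIdx i) j = 0 := fun i j => by
    have := congrFun (congrFun hX i) j
    rwa [Matrix.add_apply, mul_eta_apply, eta_mul_apply] at this
  have h00 := h 0 0
  have h11 := h 1 1
  have h22 := h 2 2
  have h33 := h 3 3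
  have h01 := h 0 1
  have h02 := h 0 2
  have h03 := h 0 3
  have h12 := h 1 2
  have h13 := h 1 3
  have h23 := h 2 3
  simp [dualIdx] at h00 h11 h22 h33 h01 h02 h03 h12 h13 h23
  ext i j
  rw [skewMat_apply]
  fin_cases i <;> fin_cases j <;> simp [skewCoord] <;> linarith

/-- The relation `N (1 - X) = τ (1 + X)` of the Cayley transform `X` of `N / τ` exchanges
`CO(2,2)` and `so(2,2)`. -/
theorem cayley_conj {N X : Matrix (Fin 4) (Fin 4) ℝ} {τ : ℝ} (h : N * (1 - X) = τ • (1 + X)) :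
    (1 - X)ᵀ * (Nᵀ * eta * N - τ ^ 2 • eta) * (1 - X)
      = (2 * τ ^ 2) • (Xᵀ * eta + eta * X) := by
  have h' : (1 - X)ᵀ * Nᵀ = τ • (1 + X)ᵀ := by
    rw [← Matrix.transpose_mul, h, Matrix.transpose_smul]
  calc (1 - X)ᵀ * (Nᵀ * eta * N - τ ^ 2 • eta) * (1 - X)
      = ((1 - X)ᵀ * Nᵀ) * eta * (N * (1 - X)) - τ ^ 2 • ((1 - X)ᵀ * eta * (1 - X)) := by
        simp only [Matrix.mul_sub, Matrix.sub_mul, Matrix.mul_assoc, Matrix.mul_smul,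
          Matrix.smul_mul, smul_sub]
        abel
    _ = τ ^ 2 • ((1 + X)ᵀ * eta * (1 + X)) - τ ^ 2 • ((1 - X)ᵀ * eta * (1 - X)) := by
        rw [h, h', Matrix.mul_smul, Matrix.smul_mul, Matrix.smul_mul, smul_smul, sq]
    _ = _ := by
        simp only [Matrix.transpose_add, Matrix.transpose_sub, Matrix.transpose_one,
          Matrix.add_mul, Matrix.mul_add, Matrix.sub_mul, Matrix.mul_sub, Matrix.one_mul,
          Matrix.mul_one]
        module

theorem cayley_add {N X : Matrix (Fin 4) (Fin 4) ℝ} {τ : ℝ} :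
    N * (1 - X) = τ • (1 + X) ↔ (N + τ • 1) * X = N - τ • 1 := by
  simp only [Matrix.add_mul, Matrix.mul_sub, Matrix.mul_one, Matrix.smul_mul, Matrix.one_mul,
    smul_add]
  constructor <;>
  · intro h
    rw [← sub_eq_zero] at h ⊢
    rw [← neg_eq_zero, ← h]
    abel

theorem cayley_det {N X : Matrix (Fin 4) (Fin 4) ℝ} {τ : ℝ} (hτ : τ ≠ 0)
    (h : N * (1 - X) = τ • (1 + X)) : (N + τ • 1).det ≠ 0 ∧ (1 - X).det ≠ 0 := by
  have h1 : (N + τ • 1) * (1 - X) = (2 * τ) • (1 : Matrix (Fin 4) (Fin 4) ℝ) := by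
    rw [Matrix.add_mul, h, Matrix.smul_mul, Matrix.one_mul]
    module
  have h2 : (N + τ • 1).det * (1 - X).det ≠ 0 := by
    rw [← Matrix.det_mul, h1, Matrix.det_smul, Matrix.det_one]
    positivity
  exact ⟨left_ne_zero_of_mul h2, right_ne_zero_of_mul h2⟩

theorem conj_eq_zero {Y Z : Matrix (Fin 4) (Fin 4) ℝ} (hY : Y.det ≠ 0) (h : Yᵀ * Z * Y = 0) :
    Z = 0 := by
  have hu : IsUnit Y.det := isUnit_iff_ne_zero.2 hY
  have hu' : IsUnit Yᵀ.det := by rwa [Matrix.det_transpose]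
  have h1 := congrArg (fun m => (Yᵀ)⁻¹ * m * Y⁻¹) h
  simp only [Matrix.mul_zero, Matrix.zero_mul] at h1
  rwa [Matrix.mul_assoc Yᵀ, ← Matrix.mul_assoc, Matrix.nonsing_inv_mul _ hu', Matrix.one_mul,
    Matrix.mul_assoc, Matrix.mul_nonsing_inv _ hu, Matrix.mul_one] at h1

section Entries

variable {E : Type*} [NormedAddCommGroup E] [NormedSpace ℝ E] {x : E}
  {A B : E → Matrix (Fin 4) (Fin 4) ℝ}

theorem contDiffAt_mul_apply (hA : ∀ i j, ContDiffAt ℝ ∞ (fun y => A y i j) x)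
    (hB : ∀ i j, ContDiffAt ℝ ∞ (fun y => B y i j) x) (i j : Fin 4) :
    ContDiffAt ℝ ∞ (fun y => (A y * B y) i j) x := by
  simp only [Matrix.mul_apply]
  exact ContDiffAt.sum fun k _ => (hA i k).mul (hB k j)

end Entries

/-- The factor `τ` of the Cayley coordinates of `b`, around `b₀`. -/
def cayleyScale (b₀ b : Matrix (Fin 4) (Fin 4) ℝ) : ℝ := √(scale (b₀⁻¹ * b))

/-- The Cayley transform `(N + τ)⁻¹ (N - τ)` of `N = b₀⁻¹ b`. -/
def cayleyMat (b₀ b : Matrix (Fin 4) (Fin 4) ℝ) : Matrix (Fin 4) (Fin 4) ℝ :=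
  (b₀⁻¹ * b + cayleyScale b₀ b • 1)⁻¹ * (b₀⁻¹ * b - cayleyScale b₀ b • 1)

/-- The element of `CO(2,2)` with given Cayley coordinates around `b₀`. -/
def cayleyInv (b₀ X : Matrix (Fin 4) (Fin 4) ℝ) (τ : ℝ) : Matrix (Fin 4) (Fin 4) ℝ :=
  b₀ * (τ • (1 + X) * (1 - X)⁻¹)

/-- The neighbourhood of `b₀` on which the Cayley coordinates are defined. -/
def cayleyNbhd (b₀ : Matrix (Fin 4) (Fin 4) ℝ) : Set (Matrix (Fin 4) (Fin 4) ℝ) :=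
  {b | 0 < scale (b₀⁻¹ * b) ∧ (b₀⁻¹ * b + cayleyScale b₀ b • 1).det ≠ 0}

theorem self_mem_cayleyNbhd {b₀ : Matrix (Fin 4) (Fin 4) ℝ} (h₀ : IsCO b₀) :
    b₀ ∈ cayleyNbhd b₀ := by
  have h1 : scale (b₀⁻¹ * b₀) = 1 := by
    rw [h₀.inv_mul]
    exact scale_eq (by simp)
  refine ⟨by rw [h1]; exact one_pos, ?_⟩
  rw [cayleyScale, h1, Real.sqrt_one, h₀.inv_mul, one_smul, ← two_smul ℝ, Matrix.det_smul]
  simp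

theorem cayleyMat_spec {b₀ b : Matrix (Fin 4) (Fin 4) ℝ} (h₀ : IsCO b₀) (hb : IsCO b)
    (h : b ∈ cayleyNbhd b₀) :
    0 < cayleyScale b₀ b ∧ (1 - cayleyMat b₀ b).det ≠ 0 ∧
    (cayleyMat b₀ b)ᵀ * eta + eta * cayleyMat b₀ b = 0 ∧
    cayleyInv b₀ (cayleyMat b₀ b) (cayleyScale b₀ b) = b := by
  obtain ⟨h1, h2⟩ := h
  set τ := cayleyScale b₀ b with hτ
  have hτ0 : 0 < τ := Real.sqrt_pos.2 h1
  have hR : (b₀⁻¹ * b) * (1 - cayleyMat b₀ b) = τ • (1 + cayleyMat b₀ b) := by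
    rw [cayley_add, cayleyMat, ← hτ, ← Matrix.mul_assoc,
      Matrix.mul_nonsing_inv _ (isUnit_iff_ne_zero.2 h2), Matrix.one_mul]
  have hd := (cayley_det hτ0.ne' hR).2
  refine ⟨hτ0, hd, ?_, ?_⟩
  · have h3 := cayley_conj hR
    have h4 : τ ^ 2 = scale (b₀⁻¹ * b) := Real.sq_sqrt h1.le
    rw [(h₀.inv.mul hb).conj_eq, h4, sub_self, Matrix.mul_zero, Matrix.zero_mul, ← h4] at h3
    exact (smul_eq_zero.1 h3.symm).resolve_left (by positivity)
  · rw [cayleyInv, ← hR, Matrix.mul_assoc (b₀⁻¹ * b),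
      Matrix.mul_nonsing_inv _ (isUnit_iff_ne_zero.2 hd), Matrix.mul_one, ← Matrix.mul_assoc,
      h₀.mul_inv, Matrix.one_mul]

theorem cayleyInv_spec {b₀ X : Matrix (Fin 4) (Fin 4) ℝ} {τ : ℝ} (h₀ : IsCO b₀) (hτ : 0 < τ)
    (hd : (1 - X).det ≠ 0) (hX : Xᵀ * eta + eta * X = 0) :
    IsCO (cayleyInv b₀ X τ) ∧ cayleyInv b₀ X τ ∈ cayleyNbhd b₀ ∧
    cayleyScale b₀ (cayleyInv b₀ X τ) = τ ∧ cayleyMat b₀ (cayleyInv b₀ X τ) = X := by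
  set N := τ • (1 + X) * (1 - X)⁻¹ with hN
  have hR : N * (1 - X) = τ • (1 + X) := by
    rw [hN, Matrix.mul_assoc, Matrix.nonsing_inv_mul _ (isUnit_iff_ne_zero.2 hd), Matrix.mul_one]
  have h1 : Nᵀ * eta * N = τ ^ 2 • eta := by
    have := cayley_conj hR
    rw [hX, smul_zero] at this
    exact sub_eq_zero.1 (conj_eq_zero hd this)
  have hNco : IsCO N := ⟨τ ^ 2, by positivity, h1⟩
  have h2 : b₀⁻¹ * cayleyInv b₀ X τ = N := by
    rw [cayleyInv, ← Matrix.mul_assoc, h₀.inv_mul, Matrix.one_mul]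
  have h3 : cayleyScale b₀ (cayleyInv b₀ X τ) = τ := by
    rw [cayleyScale, h2, scale_eq h1, Real.sqrt_sq hτ.le]
  have hd' := (cayley_det hτ.ne' hR).1
  refine ⟨h₀.mul hNco, ⟨?_, ?_⟩, h3, ?_⟩
  · rw [h2, scale_eq h1]
    positivity
  · rwa [h2, h3]
  · rw [cayleyMat, h2, h3, ← cayley_add.1 hR, ← Matrix.mul_assoc,
      Matrix.nonsing_inv_mul _ (isUnit_iff_ne_zero.2 hd'), Matrix.one_mul]

theorem finrank_cayleyCoord :
    Module.finrank ℝ (EuclideanSpace ℝ (Fin 11)) = Module.finrank ℝ CayleyCoord := by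
  simp

/-- The identification of the space of Cayley coordinates with `ℝ¹¹`. -/
def cayleyEquiv : EuclideanSpace ℝ (Fin 11) ≃L[ℝ] CayleyCoord :=
  ContinuousLinearEquiv.ofFinrankEq finrank_cayleyCoord

theorem contDiff_scale_mul (b₀ : Matrix (Fin 4) (Fin 4) ℝ) :
    ContDiff ℝ ∞ fun y : Amb => scale (b₀⁻¹ * Matrix.of y.2) := by
  simp only [scale, Matrix.mul_apply, Matrix.transpose_apply, Matrix.of_apply]
  fun_prop

theorem contDiffAt_cayleyScale {b₀ : Matrix (Fin 4) (Fin 4) ℝ} {y : Amb}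
    (h : 0 < scale (b₀⁻¹ * Matrix.of y.2)) :
    ContDiffAt ℝ ∞ (fun y : Amb => cayleyScale b₀ (Matrix.of y.2)) y :=
  (contDiff_scale_mul b₀).contDiffAt.sqrt h.ne'

theorem contDiffAt_shift {b₀ : Matrix (Fin 4) (Fin 4) ℝ} {y : Amb} (ε : ℝ)
    (h : 0 < scale (b₀⁻¹ * Matrix.of y.2)) (i j : Fin 4) :
    ContDiffAt ℝ ∞ (fun y : Amb => (b₀⁻¹ * Matrix.of y.2
      + (ε * cayleyScale b₀ (Matrix.of y.2)) • 1) i j) y := by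
  simp only [Matrix.add_apply, Matrix.mul_apply, Matrix.smul_apply, Matrix.of_apply, smul_eq_mul]
  refine ContDiffAt.add (ContDiff.contDiffAt (by fun_prop)) ?_
  exact (contDiffAt_const.mul (contDiffAt_cayleyScale h)).mul contDiffAt_const

theorem isOpen_cayleyNbhd (b₀ : Matrix (Fin 4) (Fin 4) ℝ) :
    IsOpen {y : Amb | Matrix.of y.2 ∈ cayleyNbhd b₀} := by
  rw [isOpen_iff_mem_nhds]
  rintro y ⟨h1, h2⟩
  have c1 := (contDiff_scale_mul b₀).continuous.continuousAt (x := y)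
  have c2 := (contDiffAt_det (contDiffAt_shift 1 h1)).continuousAt
  simp only [one_mul] at c2
  filter_upwards [c1.eventually (lt_mem_nhds h1), c2.eventually_ne h2] with z h3 h4 using ⟨h3, h4⟩

theorem contDiffAt_cayleyMat {b₀ : Matrix (Fin 4) (Fin 4) ℝ} {y : Amb}
    (h : Matrix.of y.2 ∈ cayleyNbhd b₀) (i j : Fin 4) :
    ContDiffAt ℝ ∞ (fun y : Amb => cayleyMat b₀ (Matrix.of y.2) i j) y := by
  have c2 := contDiffAt_shift 1 h.1
  have c3 := contDiffAt_shift (-1) h.1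
  simp only [one_mul, neg_mul, neg_smul, ← sub_eq_add_neg] at c2 c3
  exact contDiffAt_mul_apply (contDiffAt_inv_apply c2 h.2) c3 i j

theorem contDiff_one_add_skewMat (ε : ℝ) (i j : Fin 4) :
    ContDiff ℝ ∞ fun w : CayleyCoord => (1 + ε • skewMat w.2.1) i j := by
  simp only [Matrix.add_apply, Matrix.smul_apply, smul_eq_mul]
  refine contDiff_const.add (contDiff_const.mul ?_)
  have : ∀ k, ContDiff ℝ ∞ fun w : CayleyCoord => w.2.1 k := fun k => by fun_prop
  simp only [skewMat_apply]
  fin_cases i <;> fin_cases j <;> simp <;> fun_prop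

theorem contDiff_one_sub_skewMat (i j : Fin 4) :
    ContDiff ℝ ∞ fun w : CayleyCoord => (1 - skewMat w.2.1) i j := by
  simpa [sub_eq_add_neg] using contDiff_one_add_skewMat (-1) i j

theorem contDiffAt_cayleyInv (b₀ : Matrix (Fin 4) (Fin 4) ℝ) {w : CayleyCoord}
    (hd : (1 - skewMat w.2.1).det ≠ 0) (i j : Fin 4) :
    ContDiffAt ℝ ∞ (fun w : CayleyCoord => cayleyInv b₀ (skewMat w.2.1) w.2.2 i j) w := by
  refine contDiffAt_mul_apply (A := fun _ => b₀) (fun _ _ => contDiffAt_const) (contDiffAt_mul_apply (fun k l => ?_)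
    (contDiffAt_inv_apply (fun k l => (contDiff_one_sub_skewMat k l).contDiffAt) hd)) i j
  simp only [Matrix.smul_apply, smul_eq_mul]
  refine ContDiffAt.mul (ContDiff.contDiffAt (by fun_prop)) ?_
  simpa using (contDiff_one_add_skewMat 1 k l).contDiffAt

/-- `V × CO(2,2)` is a submanifold of `ℝ⁴ × ℝ^(4×4)`: the Cayley transform parametrizes a
neighbourhood of each `b₀ ∈ CO(2,2)`. -/
def modelParam (V : TopologicalSpace.Opens R4) :
    LocalParam (modelSet V) (EuclideanSpace ℝ (Fin 11)) where
  nbhd x := {y | y.1 ∈ V ∧ Matrix.of y.2 ∈ cayleyNbhd (Matrix.of x.1.2)}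
  coord x y := cayleyEquiv.symm (y.1, skewCoord (cayleyMat (Matrix.of x.1.2) (Matrix.of y.2)),
    cayleyScale (Matrix.of x.1.2) (Matrix.of y.2))
  dom x := cayleyEquiv ⁻¹' {w | w.1 ∈ V ∧ 0 < w.2.2 ∧ (1 - skewMat w.2.1).det ≠ 0}
  param x w := ((cayleyEquiv w).1, cayleyInv (Matrix.of x.1.2) (skewMat (cayleyEquiv w).2.1)
    (cayleyEquiv w).2.2)
  isOpen_nbhd x := (V.isOpen.preimage continuous_fst).inter (isOpen_cayleyNbhd _)
  isOpen_dom x := by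
    refine IsOpen.preimage cayleyEquiv.continuous ?_
    refine (V.isOpen.preimage continuous_fst).inter (IsOpen.inter
      (isOpen_lt continuous_const (continuous_snd.comp continuous_snd))
      (isOpen_ne_fun ?_ continuous_const))
    refine ContDiff.continuous (𝕜 := ℝ) (n := ∞) (contDiff_iff_contDiffAt.2 fun w => ?_)
    exact contDiffAt_det fun i j => (contDiff_one_sub_skewMat i j).contDiffAt
  mem_nbhd x := ⟨x.2.1, self_mem_cayleyNbhd x.2.2⟩
  contDiffOn_coord x := by
    rintro y ⟨-, hy⟩
    refine ContDiffAt.contDiffWithinAt ?_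
    refine cayleyEquiv.symm.contDiff.contDiffAt.comp y ?_
    refine contDiffAt_fst.prodMk (ContDiffAt.prodMk (contDiffAt_pi.2 fun i => ?_)
      (contDiffAt_cayleyScale hy.1))
    fin_cases i <;> exact contDiffAt_cayleyMat hy _ _
  contDiffOn_param x := by
    rintro w ⟨-, -, hw⟩
    refine ContDiffAt.contDiffWithinAt ?_
    refine ContDiffAt.prodMk (contDiff_fst.comp cayleyEquiv.contDiff).contDiffAt ?_
    refine contDiffAt_pi.2 fun i => contDiffAt_pi.2 fun j => ?_
    exact (contDiffAt_cayleyInv _ hw i j).comp w cayleyEquiv.contDiff.contDiffAt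
  coord_mem x y hy h := by
    have := cayleyMat_spec x.2.2 hy.2 h.2
    simp only [mem_preimage, ContinuousLinearEquiv.apply_symm_apply]
    exact ⟨hy.1, this.1, by rw [skewMat_skewCoord this.2.2.1]; exact this.2.1⟩
  param_coord x y hy h := by
    have := cayleyMat_spec x.2.2 hy.2 h.2
    simp only [ContinuousLinearEquiv.apply_symm_apply]
    rw [skewMat_skewCoord this.2.2.1, this.2.2.2]
    rfl
  param_mem x w hw := ⟨hw.1, (cayleyInv_spec x.2.2 hw.2.1 hw.2.2 (skewMat_skew _)).1⟩
  param_mem_nbhd x w hw := ⟨hw.1, (cayleyInv_spec x.2.2 hw.2.1 hw.2.2 (skewMat_skew _)).2.1⟩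
  coord_param x w hw := by
    have := cayleyInv_spec x.2.2 hw.2.1 hw.2.2 (skewMat_skew _)
    rw [ContinuousLinearEquiv.symm_apply_eq]
    refine Prod.ext rfl (Prod.ext ?_ this.2.2.1)
    exact (congrArg skewCoord this.2.2.2).trans (skewCoord_skewMat _)

/-- The 11-dimensional manifold `V × CO(2,2)`. -/
def Model (V : TopologicalSpace.Opens R4) : Type := modelSet V

namespace Model

variable {V : TopologicalSpace.Opens R4}

instance : TopologicalSpace (Model V) := inferInstanceAs (TopologicalSpace (modelSet V))

instance : ChartedSpace (EuclideanSpace ℝ (Fin 11)) (Model V) := (modelParam V).chartedSpace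

instance : IsManifold (𝓡 11) ∞ (Model V) := (modelParam V).isManifold

/-- The inclusion in `ℝ⁴ × ℝ^(4×4)`. -/
def val (x : Model V) : Amb := Subtype.val x

theorem isSmoothEmb_val : IsSmoothEmb (𝓡 11) (val (V := V)) where
  contMDiff := (modelParam V).contMDiff_val
  injective_mfderiv := (modelParam V).injective_dmap_val
  isEmbedding := IsEmbedding.subtypeVal

end Model

/-! ### Matrix-valued functions and the Maurer–Cartan form -/

section MatrixFunctions

variable {E H : Type*} [NormedAddCommGroup E] [NormedSpace ℝ E] [TopologicalSpace H]
  {I : ModelWithCorners ℝ E H} {P : Type*} [TopologicalSpace P] [ChartedSpace H P]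

/-- Smoothness of a matrix-valued function. -/
def MatSmooth (I : ModelWithCorners ℝ E H) (A : P → Matrix (Fin 4) (Fin 4) ℝ) : Prop :=
  ∀ i j, ContMDiff I 𝓘(ℝ, ℝ) ∞ fun p => A p i j

/-- The differential of a matrix-valued function. -/
def dMat (I : ModelWithCorners ℝ E H) (A : P → Matrix (Fin 4) (Fin 4) ℝ) (p : P)
    (v : TangentSpace I p) : Matrix (Fin 4) (Fin 4) ℝ :=
  Matrix.of fun i j => dmap I (fun p => A p i j) p v

variable {A B : P → Matrix (Fin 4) (Fin 4) ℝ}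

theorem matSmooth_iff : MatSmooth I A ↔
    ContMDiff I 𝓘(ℝ, Fin 4 → Fin 4 → ℝ) ∞ fun p i j => A p i j := by
  simp only [contMDiff_pi_space]
  rfl

theorem matSmooth_const (C : Matrix (Fin 4) (Fin 4) ℝ) : MatSmooth I fun _ : P => C :=
  fun _ _ => contMDiff_const

theorem MatSmooth.mul (hA : MatSmooth I A) (hB : MatSmooth I B) :
    MatSmooth I fun p => A p * B p := by
  intro i j
  simp only [Matrix.mul_apply]
  exact contMDiff_finsetSum fun k _ => (hA i k).mul (hB k j)

theorem MatSmooth.transpose (hA : MatSmooth I A) : MatSmooth I fun p => (A p)ᵀ :=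
  fun i j => hA j i

theorem MatSmooth.inv (hA : MatSmooth I A) (h : ∀ p, (A p).det ≠ 0) :
    MatSmooth I fun p => (A p)⁻¹ := by
  intro i j p
  exact ContDiffAt.comp_contMDiffAt (g := fun m : Fin 4 → Fin 4 → ℝ => (Matrix.of m)⁻¹ i j)
    (contDiffAt_inv_apply (A := fun m : Fin 4 → Fin 4 → ℝ => Matrix.of m)
      (fun k l => ContDiff.contDiffAt (by simp only [Matrix.of_apply]; fun_prop)) (h p) i j)
    (matSmooth_iff.1 hA p)

theorem MatSmooth.scale (hA : MatSmooth I A) :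
    ContMDiff I 𝓘(ℝ, ℝ) ∞ fun p => scale (A p) :=
  (hA.transpose.mul (matSmooth_const eta)).mul hA 0 1

theorem dMat_const (C : Matrix (Fin 4) (Fin 4) ℝ) (p : P) (v : TangentSpace I p) :
    dMat I (fun _ => C) p v = 0 := by
  ext i j
  exact dmap_const (C i j) p v

theorem dMat_mul (hA : MatSmooth I A) (hB : MatSmooth I B) (p : P) (v : TangentSpace I p) :
    dMat I (fun p => A p * B p) p v = dMat I A p v * B p + A p * dMat I B p v := by
  ext i j
  simp only [dMat, Matrix.of_apply, Matrix.mul_apply, Matrix.add_apply]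
  rw [dmap_sum Finset.univ (f := fun k p => A p i k * B p k j)
    fun k _ => ((hA i k).mul (hB k j) p).mdiff, ← Finset.sum_add_distrib]
  refine Finset.sum_congr rfl fun k _ => ?_
  rw [dmap_mul (hA i k p).mdiff (hB k j p).mdiff]
  ring

theorem dMat_transpose (p : P) (v : TangentSpace I p) :
    dMat I (fun p => (A p)ᵀ) p v = (dMat I A p v)ᵀ := rfl

theorem dMat_inv (hA : MatSmooth I A) (h : ∀ p, (A p).det ≠ 0) (p : P) (v : TangentSpace I p) :
    dMat I (fun p => (A p)⁻¹) p v = -((A p)⁻¹ * dMat I A p v * (A p)⁻¹) := by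
  have hu := fun p => isUnit_iff_ne_zero.2 (h p)
  have h1 := dMat_mul (hA.inv h) hA p v
  simp only [fun p => Matrix.nonsing_inv_mul _ (hu p)] at h1
  rw [dMat_const] at h1
  have h2 := congrArg (· * (A p)⁻¹) h1
  simp only [Matrix.zero_mul, Matrix.add_mul] at h2
  rw [Matrix.mul_assoc, Matrix.mul_nonsing_inv _ (hu p), Matrix.mul_one] at h2
  rw [eq_neg_iff_add_eq_zero, ← h2]

/-- The Maurer–Cartan form `b⁻¹ db` of an invertible matrix-valued function `b`. -/
def mcForm (I : ModelWithCorners ℝ E H) (b : P → Matrix (Fin 4) (Fin 4) ℝ) (i j : Fin 4) :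
    OneForm I P :=
  fun p => ∑ k, (b p)⁻¹ i k • (dmap I (fun p => b p k j) p : TangentSpace I p →L[ℝ] ℝ)

variable {b : P → Matrix (Fin 4) (Fin 4) ℝ}

theorem mcForm_sum (i j : Fin 4) (p : P) (v : TangentSpace I p) :
    mcForm I b i j p v = ∑ k, (b p)⁻¹ i k * dmap I (fun p => b p k j) p v :=
  clm_sum_apply (F := E) _ (fun k => (b p)⁻¹ i k • dmap I (fun p => b p k j) p) v

theorem mcForm_apply (i j : Fin 4) (p : P) (v : TangentSpace I p) :
    mcForm I b i j p v = ((b p)⁻¹ * dMat I b p v) i j :=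
  mcForm_sum i j p v

/-- The Maurer–Cartan form of a `CO(2,2)`-valued function takes values in `co(2,2)`. -/
theorem mcForm_conformal (hb : MatSmooth I b) (hco : ∀ p, IsCO (b p)) (p : P)
    (v : TangentSpace I p) :
    ((b p)⁻¹ * dMat I b p v)ᵀ * eta + eta * ((b p)⁻¹ * dMat I b p v)
      = ((scale (b p))⁻¹ * dmap I (fun p => scale (b p)) p v) • eta := by
  have h1 : dMat I (fun p => (b p)ᵀ * eta * b p) p v
      = dmap I (fun p => scale (b p)) p v • eta := by
    simp only [fun p => (hco p).conj_eq]
    ext i j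
    have h2 := dmap_mul (f := fun p => scale (b p)) (g := fun _ => eta i j)
      (hb.scale p).mdiff mdifferentiableAt_const v
    rw [dmap_const, mul_zero, zero_add] at h2
    exact h2.trans (mul_comm _ _)
  rw [dMat_mul (hb.transpose.mul (matSmooth_const eta)) hb,
    dMat_mul hb.transpose (matSmooth_const eta), dMat_const, Matrix.mul_zero, add_zero,
    dMat_transpose] at h1
  have h3 : (b p)ᵀ * eta = scale (b p) • (eta * (b p)⁻¹) := by
    rw [← Matrix.smul_mul, ← (hco p).conj_eq, Matrix.mul_assoc _ (b p), (hco p).mul_inv,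
      Matrix.mul_one]
  have h4 : eta * b p = scale (b p) • (((b p)⁻¹)ᵀ * eta) := by
    have := congrArg Matrix.transpose h3
    simpa [Matrix.transpose_mul, eta_transpose] using this
  rw [h3, Matrix.mul_assoc, h4, Matrix.smul_mul, Matrix.mul_smul, ← smul_add] at h1
  rw [mul_smul, ← h1, smul_smul, inv_mul_cancel₀ (hco p).scale_pos.ne', one_smul,
    Matrix.transpose_mul, Matrix.mul_assoc, Matrix.mul_assoc]

theorem mcForm_isSmooth [I.Boundaryless] [IsManifold I ∞ P] (hb : MatSmooth I b)
    (hd : ∀ p, (b p).det ≠ 0) (i j : Fin 4) : (mcForm I b i j).IsSmooth :=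
  isSmooth_of_eq_sum (f := fun k p => (b p)⁻¹ i k) (g := fun k p => b p k j)
    (fun k => hb.inv hd i k) (fun k => hb k j) (mcForm_sum i j)

theorem mcForm_d [I.Boundaryless] [IsManifold I ∞ P] (hb : MatSmooth I b)
    (hd : ∀ p, (b p).det ≠ 0) (i j : Fin 4) (p : P) (u v : TangentSpace I p) :
    (mcForm I b i j).d p u v
      + ∑ k, (mcForm I b i k).wedge (mcForm I b k j) p u v = 0 := by
  rw [d_eq_sum (f := fun k p => (b p)⁻¹ i k) (g := fun k p => b p k j)
    (fun k => hb.inv hd i k) (fun k => hb k j) (mcForm_sum i j)]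
  have h1 : ∀ u v : TangentSpace I p, ∑ k, dmap I (fun p => (b p)⁻¹ i k) p u *
      dmap I (fun p => b p k j) p v
      = -∑ k, mcForm I b i k p u * mcForm I b k j p v := by
    intro u v
    have h2 : ∑ k, dmap I (fun p => (b p)⁻¹ i k) p u * dmap I (fun p => b p k j) p v
        = (dMat I (fun p => (b p)⁻¹) p u * dMat I b p v) i j := rfl
    rw [h2, dMat_inv hb hd]
    simp only [mcForm_apply]
    rw [← Matrix.mul_apply, ← Matrix.neg_apply]
    simp only [Matrix.neg_mul, Matrix.mul_assoc]
  simp only [OneForm.wedge, Finset.sum_sub_distrib]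
  rw [h1 u v, h1 v u]
  have h3 : ∑ k, mcForm I b i k p v * mcForm I b k j p u
      = ∑ k, mcForm I b i k p v * mcForm I b k j p u := rfl
  ring

/-- The exterior derivative of the forms `θ = b⁻¹ L dq`. -/
theorem solder_d [I.Boundaryless] [IsManifold I ∞ P] (hb : MatSmooth I b)
    (hd : ∀ p, (b p).det ≠ 0) (L : Matrix (Fin 4) (Fin 4) ℝ) {q : P → R4}
    (hq : ContMDiff I 𝓘(ℝ, R4) ∞ q) {θ : Fin 4 → OneForm I P}
    (hθ : ∀ i p v, θ i p v = (((b p)⁻¹ * L) *ᵥ dmap I q p v) i) (i : Fin 4) (p : P)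
    (u v : TangentSpace I p) :
    (θ i).IsSmooth ∧ (θ i).d p u v + ∑ j, (mcForm I b i j).wedge (θ j) p u v = 0 := by
  have hqk : ∀ k, ContMDiff I 𝓘(ℝ, ℝ) ∞ fun x => q x k := contMDiff_pi_space.1 hq
  have hB : MatSmooth I fun p => (b p)⁻¹ * L := (hb.inv hd).mul (matSmooth_const L)
  have hsum : ∀ p v, θ i p v = ∑ k, ((b p)⁻¹ * L) i k * dmap I (fun x => q x k) p v := by
    intro p v
    simp only [fun k => dmap_apply (hq p).mdiff k v]
    exact hθ i p v
  refine ⟨isSmooth_of_eq_sum (hB i) hqk hsum, ?_⟩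
  rw [d_eq_sum (hB i) hqk hsum]
  have h1 : ∀ u v : TangentSpace I p, ∑ k, dmap I (fun p => ((b p)⁻¹ * L) i k) p u *
      dmap I (fun x => q x k) p v = -∑ j, mcForm I b i j p u * θ j p v := by
    intro u v
    have h2 : ∑ k, dmap I (fun p => ((b p)⁻¹ * L) i k) p u * dmap I (fun x => q x k) p v
        = (dMat I (fun p => (b p)⁻¹ * L) p u *ᵥ dmap I q p v) i := by
      simp only [fun k => dmap_apply (hq p).mdiff k v]
      rfl
    rw [h2, dMat_mul (hb.inv hd) (matSmooth_const L), dMat_const, Matrix.mul_zero, add_zero,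
      dMat_inv hb hd]
    simp only [mcForm_apply, hθ]
    change _ = -(((b p)⁻¹ * dMat I b p u) *ᵥ (((b p)⁻¹ * L) *ᵥ dmap I q p v)) i
    rw [Matrix.mulVec_mulVec, Matrix.neg_mul, Matrix.neg_mulVec]
    simp only [Matrix.mul_assoc]
    rfl
  simp only [OneForm.wedge, Finset.sum_sub_distrib]
  rw [h1 u v, h1 v u]
  ring

theorem gamma_apply (Ω : Fin 6 → OneForm I P) (α : OneForm I P) (i j : Fin 4) (p : P)
    (v : TangentSpace I p) : gamma Ω α i j p v
      = (skewMat (fun μ => Ω μ p v) + (α p v / 2) • 1) i j := by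
  have h1 : gamma Ω α i j p v = ∑ k, eta i k * gammaLow Ω α k j p v :=
    clm_sum_apply (F := E) _ (fun k => eta i k • gammaLow Ω α k j p) v
  have h2 : ∀ k, gammaLow Ω α k j p v = (!![0, Ω 0 p v, Ω 1 p v, Ω 3 p v;
      -Ω 0 p v, 0, Ω 2 p v, Ω 4 p v;
      -Ω 1 p v, -Ω 2 p v, 0, Ω 5 p v;
      -Ω 3 p v, -Ω 4 p v, -Ω 5 p v, 0] : Matrix (Fin 4) (Fin 4) ℝ) k j
      + 1 / 2 * eta k j * α p v := by
    intro k
    fin_cases k <;> fin_cases j <;> rfl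
  rw [h1]
  simp only [h2, mul_add, Finset.sum_add_distrib, Matrix.add_apply]
  refine congrArg₂ (· + ·) rfl ?_
  have h3 := congrFun (congrFun eta_mul_eta i) j
  rw [Matrix.smul_apply, smul_eq_mul, ← h3, Matrix.mul_apply, Finset.mul_sum]
  exact Finset.sum_congr rfl fun k _ => by ring

/-- The matrix of the forms `Γ^i_j`. -/
def gammaMat (Ω : Fin 6 → OneForm I P) (α : OneForm I P) (p : P) (v : TangentSpace I p) :
    Matrix (Fin 4) (Fin 4) ℝ := Matrix.of fun i j => gamma Ω α i j p v

theorem gammaMat_eq (Ω : Fin 6 → OneForm I P) (α : OneForm I P) (p : P) (v : TangentSpace I p) :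
    gammaMat Ω α p v = skewMat (fun μ => Ω μ p v) + (α p v / 2) • 1 := by
  ext i j
  exact gamma_apply Ω α i j p v

theorem gammaMat_conformal (Ω : Fin 6 → OneForm I P) (α : OneForm I P) (p : P)
    (v : TangentSpace I p) :
    (gammaMat Ω α p v)ᵀ * eta + eta * gammaMat Ω α p v = α p v • eta := by
  rw [gammaMat_eq, Matrix.transpose_add, Matrix.add_mul, Matrix.mul_add, add_add_add_comm,
    skewMat_skew, Matrix.transpose_smul, Matrix.transpose_one, Matrix.smul_mul, Matrix.one_mul,
    Matrix.mul_smul, Matrix.mul_one, zero_add, ← add_smul, add_halves]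

/-- The components `Ω_μ` of a `co(2,2)`-valued form. -/
def skewPart (Θ : Fin 4 → Fin 4 → OneForm I P) : Fin 6 → OneForm I P :=
  ![fun p => (1 / 2 : ℝ) • (Θ 1 1 p - Θ 0 0 p), Θ 1 2, Θ 0 2, Θ 1 3, Θ 0 3,
    fun p => (1 / 2 : ℝ) • (Θ 3 3 p - Θ 2 2 p)]

/-- The trace component `A` of a `co(2,2)`-valued form. -/
def tracePart (Θ : Fin 4 → Fin 4 → OneForm I P) : OneForm I P := fun p => Θ 0 0 p + Θ 1 1 p

theorem gamma_skewPart {Θ : Fin 4 → Fin 4 → OneForm I P} {p : P} {v : TangentSpace I p} {k : ℝ}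
    (h : (Matrix.of fun i j => Θ i j p v)ᵀ * eta + eta * (Matrix.of fun i j => Θ i j p v)
      = k • eta) (i j : Fin 4) :
    gamma (skewPart Θ) (tracePart Θ) i j p v = Θ i j p v ∧ tracePart Θ p v = k := by
  have h' : ∀ i j, Θ (dualIdx j) i p v + Θ (dualIdx i) j p v = k * eta i j := fun i j => by
    have := congrFun (congrFun h i) j
    rw [Matrix.add_apply, mul_eta_apply, eta_mul_apply] at this
    exact this
  have h00 := h' 0 0
  have h11 := h' 1 1
  have h22 := h' 2 2
  have h33 := h' 3 3
  have h01 := h' 0 1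
  have h02 := h' 0 2
  have h03 := h' 0 3
  have h12 := h' 1 2
  have h13 := h' 1 3
  have h23 := h' 2 3
  simp [dualIdx, eta] at h00 h11 h22 h33 h01 h02 h03 h12 h13 h23
  have e0 : skewPart Θ 0 p v = 1 / 2 * (Θ 1 1 p v - Θ 0 0 p v) := rfl
  have e1 : skewPart Θ 1 p v = Θ 1 2 p v := rfl
  have e2 : skewPart Θ 2 p v = Θ 0 2 p v := rfl
  have e3 : skewPart Θ 3 p v = Θ 1 3 p v := rfl
  have e4 : skewPart Θ 4 p v = Θ 0 3 p v := rfl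
  have e5 : skewPart Θ 5 p v = 1 / 2 * (Θ 3 3 p v - Θ 2 2 p v) := rfl
  have eA : tracePart Θ p v = Θ 0 0 p v + Θ 1 1 p v := rfl
  refine ⟨?_, eA.trans h01⟩
  rw [gamma_apply, Matrix.add_apply, skewMat_apply, e0, e1, e2, e3, e4, e5, eA]
  fin_cases i <;> fin_cases j <;> simp <;> linarith

end MatrixFunctions

/-! ### Manifolds that are locally equivalent to the flat model -/

section FlatManifold

variable {M : Type*} [TopologicalSpace M] [ChartedSpace (EuclideanSpace ℝ (Fin 6)) M]
  [IsManifold (𝓡 6) ∞ M] {𝓜 : ParaCR (𝓡 6) M 2 3} {Φ : M → Flat}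

theorem lam_eq (p v : Flat) : lam p v = nullCov p.1 ⬝ᵥ v.2 := by
  simp [lam, nullCov, dotProduct, Fin.sum_univ_four]

theorem mem_flatPlus {p v : Flat} : v ∈ flatPlus p ↔ v.2 = 0 := by
  constructor
  · rintro ⟨h0, h1, h2, h3⟩
    have h0' : v.2 0 = 0 := by simpa [lam, h1, h2, h3] using h0
    ext i
    fin_cases i <;> assumption
  · intro h
    refine ⟨?_, ?_, ?_, ?_⟩ <;> simp [lam_eq, h]

theorem mem_flatMinus {p v : Flat} : v ∈ flatMinus p ↔ nullCov p.1 ⬝ᵥ v.2 = 0 ∧ v.1 = 0 := by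
  rw [← lam_eq, Prod.ext_iff]
  rfl

namespace IsParaCREmbedding

variable (hΦ : IsParaCREmbedding 𝓜 flatParaCR Φ)

include hΦ

theorem dmap_bijective (m : M) : Function.Bijective (dmap (𝓡 6) Φ m) := hΦ.bijective_mfderiv m

theorem mdiff (m : M) : MDifferentiableAt (𝓡 6) 𝓘(ℝ, Flat) Φ m := (hΦ.contMDiff m).mdiff

theorem mem_plus_iff {m : M} {v : TangentSpace (𝓡 6) m} :
    v ∈ 𝓜.plus m ↔ (dmap (𝓡 6) Φ m v).2 = 0 := by
  rw [← mem_flatPlus (p := Φ m)]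
  have h : (𝓜.plus m).map (mfderiv (𝓡 6) 𝓘(ℝ, Flat) Φ m).toLinearMap = flatPlus (Φ m) :=
    hΦ.map_plus m
  constructor
  · intro hv
    exact h.le (Submodule.mem_map_of_mem hv)
  · intro hv
    obtain ⟨w, hw, e⟩ := h.ge hv
    rwa [← (hΦ.dmap_bijective m).1 e]

theorem mem_minus_iff {m : M} {v : TangentSpace (𝓡 6) m} : v ∈ 𝓜.minus m ↔
    nullCov (Φ m).1 ⬝ᵥ (dmap (𝓡 6) Φ m v).2 = 0 ∧ (dmap (𝓡 6) Φ m v).1 = 0 := by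
  rw [← mem_flatMinus]
  have h : (𝓜.minus m).map (mfderiv (𝓡 6) 𝓘(ℝ, Flat) Φ m).toLinearMap = flatMinus (Φ m) :=
    hΦ.map_minus m
  constructor
  · intro hv
    exact h.le (Submodule.mem_map_of_mem hv)
  · intro hv
    obtain ⟨w, hw, e⟩ := h.ge hv
    rwa [← (hΦ.dmap_bijective m).1 e]

theorem contMDiff_params : ContMDiff (𝓡 6) 𝓘(ℝ, R4) ∞ (params Φ) :=
  contDiff_snd.comp_contMDiff hΦ.contMDiff

theorem dmap_params (m : M) (v : TangentSpace (𝓡 6) m) :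
    dmap (𝓡 6) (params Φ) m v = (dmap (𝓡 6) Φ m v).2 := dmap_snd (hΦ.mdiff m) v

theorem isOpen_range_params : IsOpen (range (params Φ)) := by
  have : range (params Φ) = Prod.snd '' range Φ := by
    rw [← range_comp]
    rfl
  rw [this]
  exact isOpenMap_snd _ hΦ.isOpenEmbedding.isOpen_range

theorem isLeafProjection : IsLeafProjection 𝓜 (params Φ) where
  contMDiff := hΦ.contMDiff_params
  surjective_mfderiv m w := by
    obtain ⟨v, hv⟩ := (hΦ.dmap_bijective m).2 (0, w)
    exact ⟨v, by rw [hΦ.dmap_params, hv]⟩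
  isOpen_range := hΦ.isOpen_range_params
  ker_mfderiv m := by
    ext v
    rw [hΦ.mem_plus_iff, ← hΦ.dmap_params]
    rfl

/-- `H⁺ ⊕ H⁻` is the kernel of `λ`. -/
theorem mem_sup_iff {m : M} {v : TangentSpace (𝓡 6) m} : v ∈ 𝓜.plus m ⊔ 𝓜.minus m ↔
    nullCov (Φ m).1 ⬝ᵥ dmap (𝓡 6) (params Φ) m v = 0 := by
  rw [Submodule.mem_sup]
  constructor
  · rintro ⟨u, hu, w, hw, rfl⟩
    rw [map_add, hΦ.dmap_params, hΦ.dmap_params, hΦ.mem_plus_iff.1 hu, zero_add]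
    exact (hΦ.mem_minus_iff.1 hw).1
  · intro h
    obtain ⟨u, hu⟩ := (hΦ.dmap_bijective m).2 ((dmap (𝓡 6) Φ m v).1, 0)
    refine ⟨u, hΦ.mem_plus_iff.2 (by rw [hu]), v - u, hΦ.mem_minus_iff.2 ?_, add_sub_cancel u v⟩
    rw [map_sub, hu, Prod.snd_sub, Prod.fst_sub, sub_self]
    refine ⟨?_, rfl⟩
    rwa [sub_zero, ← hΦ.dmap_params]

/-- The points of a fibre of `M` over `ℝ⁴` form an open set of the `(x, y)`-plane. -/
theorem exists_isOpen_fibre {s : R4} (hs : s ∈ range (params Φ)) : ∃ U : Set (ℝ × ℝ), IsOpen U ∧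
    U.Nonempty ∧ ∀ w ∈ U, ∃ m, Φ m = (w, s) := by
  refine ⟨{w | (w, s) ∈ range Φ}, hΦ.isOpenEmbedding.isOpen_range.preimage (by fun_prop), ?_,
    fun w hw => hw⟩
  obtain ⟨m, rfl⟩ := hs
  exact ⟨(Φ m).1, m, rfl⟩

end IsParaCREmbedding

end FlatManifold

/-! ### The embeddings in the correspondence space -/

section Correspondence

variable {M : Type*} [TopologicalSpace M] [ChartedSpace (EuclideanSpace ℝ (Fin 6)) M]
  [IsManifold (𝓡 6) ∞ M] {𝓜 : ParaCR (𝓡 6) M 2 3} {Φ : M → Flat}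

theorem IsDiffeoOn.contDiffAt {X : Type*} [NormedAddCommGroup X] [NormedSpace ℝ X] {f : X → X}
    {O : Set X} (hf : IsDiffeoOn f O) {x : X} (hx : x ∈ O) : ContDiffAt ℝ ∞ f x :=
  hf.2.1.contDiffAt (hf.1.mem_nhds hx)

theorem IsDiffeoOn.hasFDerivAt {X : Type*} [NormedAddCommGroup X] [NormedSpace ℝ X] {f : X → X}
    {O : Set X} (hf : IsDiffeoOn f O) {x : X} (hx : x ∈ O) : HasFDerivAt f (fderiv ℝ f x) x :=
  ((hf.contDiffAt hx).differentiableAt (by simp)).hasFDerivAt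

/-- The derivative of a diffeomorphism as an isomorphism. -/
theorem IsDiffeoOn.exists_equiv {X : Type*} [NormedAddCommGroup X] [NormedSpace ℝ X]
    [FiniteDimensional ℝ X] {f : X → X} {O : Set X} (hf : IsDiffeoOn f O) {x : X} (hx : x ∈ O) :
    ∃ e : X ≃L[ℝ] X, HasFDerivAt f (e : X →L[ℝ] X) x := by
  refine ⟨(LinearEquiv.ofBijective (fderiv ℝ f x).toLinearMap
    (hf.2.2.2 x hx)).toContinuousLinearEquiv, ?_⟩
  exact hf.hasFDerivAt hx

theorem IsDiffeoOn.isOpenEmbedding {X : Type*} [NormedAddCommGroup X] [NormedSpace ℝ X]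
    [FiniteDimensional ℝ X] {f : X → X} {O : Set X} (hf : IsDiffeoOn f O) :
    IsOpenEmbedding (O.domRestrict f) := by
  have : CompleteSpace X := FiniteDimensional.complete ℝ X
  refine IsOpenEmbedding.of_continuous_injective_isOpenMap hf.2.1.continuousOn.domRestrict
    (injOn_iff_injective.1 hf.2.2.1) ?_
  rw [isOpenMap_iff_nhds_le]
  rintro ⟨x, hx⟩
  obtain ⟨e, he⟩ := hf.exists_equiv hx
  have h1 := ((hf.contDiffAt hx).hasStrictFDerivAt' he (by simp)).map_nhds_eq_of_equiv
  change 𝓝 (f x) ≤ _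
  rw [← h1, ← hf.1.isOpenEmbedding_subtypeVal.map_nhds_eq ⟨x, hx⟩, Filter.map_map]
  rfl

theorem contDiff_solution : ContDiff ℝ ∞ fun p : Flat => solution p.2 p.1 := by
  unfold solution
  fun_prop

theorem contDiff_corr : ContDiff ℝ ∞ corr := by
  unfold corr
  exact ContDiff.prodMk (ContDiff.prodMk (by fun_prop)
    (ContDiff.prodMk (by fun_prop) contDiff_solution)) contDiff_snd

theorem isEmbedding_corr : IsEmbedding corr := by
  have h : Function.LeftInverse (fun z : (ℝ × ℝ × ℝ) × R4 => ((z.1.1, z.1.2.1), z.2)) corr :=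
    fun p => rfl
  exact h.isEmbedding (by fun_prop) contDiff_corr.continuous

/-- The differential of `(x, y, a) ↦ a₀ + a₁ x + a₂ y + a₃ x y` is `λ` modulo `dx`, `dy`. -/
theorem hasFDerivAt_solution (p : Flat) : HasFDerivAt (fun p : Flat => solution p.2 p.1)
    (LinearMap.toContinuousLinearMap (lam p) + (p.2 1 + p.2 3 * p.1.2) • dx
      + (p.2 2 + p.2 3 * p.1.1) • dy) p := by
  have ha : ∀ i, HasFDerivAt (fun q : Flat => q.2 i) (da i) p := fun i => (da i).hasFDerivAt
  have hx : HasFDerivAt (fun q : Flat => q.1.1) dx p := dx.hasFDerivAt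
  have hy : HasFDerivAt (fun q : Flat => q.1.2) dy p := dy.hasFDerivAt
  have h := (((ha 0).add ((ha 1).mul hx)).add ((ha 2).mul hy)).add ((ha 3).mul (hx.mul hy))
  refine h.congr_fderiv ?_
  ext v <;> simp [lam, da, dx, dy]

theorem corr_fst_eq_zero {p v : Flat} {l : Flat →L[ℝ] ℝ × ℝ × ℝ}
    (hl : HasFDerivAt (fun p => (corr p).1) l p) :
    l v = 0 ↔ nullCov p.1 ⬝ᵥ v.2 = 0 ∧ v.1 = 0 := by
  have h1 : HasFDerivAt (fun p => (corr p).1) (dx.prod (dy.prod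
      (LinearMap.toContinuousLinearMap (lam p) + (p.2 1 + p.2 3 * p.1.2) • dx
      + (p.2 2 + p.2 3 * p.1.1) • dy))) p :=
    dx.hasFDerivAt.prodMk (dy.hasFDerivAt.prodMk (hasFDerivAt_solution p))
  rw [hl.unique h1, ← lam_eq]
  have h2 : ∀ v : Flat, dx v = v.1.1 := fun _ => rfl
  have h3 : ∀ v : Flat, dy v = v.1.2 := fun _ => rfl
  simp only [ContinuousLinearMap.prod_apply, Prod.mk_eq_zero, _root_.add_apply,
    _root_.smul_apply, h2, h3, Prod.ext_iff (x := v.1), Prod.fst_zero, Prod.snd_zero,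
    LinearMap.coe_toContinuousLinearMap', smul_eq_mul]
  constructor
  · rintro ⟨hx, hy, h⟩
    rw [hx, hy] at h
    exact ⟨by linarith, hx, hy⟩
  · rintro ⟨h, hx, hy⟩
    rw [hx, hy, h]
    simp

/-- Point transformations and changes of the parameters preserve the para-CR structure that is
induced from the splitting of the correspondence space. -/
theorem IsParaCREmbedding.isCorrespondence (hΦ : IsParaCREmbedding 𝓜 flatParaCR Φ)
    {f : ℝ × ℝ × ℝ → ℝ × ℝ × ℝ} {O : Set (ℝ × ℝ × ℝ)} {β : R4 → R4} {O' : Set R4}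
    (hf : IsDiffeoOn f O) (hO : ∀ m, surf Φ m ∈ O) (hβ : IsDiffeoOn β O')
    (hO' : ∀ m, params Φ m ∈ O') :
    IsCorrespondence 𝓜 (fun m => (f (surf Φ m), β (params Φ m))) := by
  have hsurf : ContMDiff (𝓡 6) 𝓘(ℝ, ℝ × ℝ × ℝ) ∞ (surf Φ) :=
    (contDiff_fst.comp contDiff_corr).comp_contMDiff hΦ.contMDiff
  have hsmooth : ContMDiff (𝓡 6) 𝓘(ℝ, (ℝ × ℝ × ℝ) × R4) ∞
      (fun m => (f (surf Φ m), β (params Φ m))) := fun m =>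
    ((hf.contDiffAt (hO m)).comp_contMDiffAt (hsurf m)).prodMk_space
      ((hβ.contDiffAt (hO' m)).comp_contMDiffAt (hΦ.contMDiff_params m))
  have hplus : ∀ m v, v ∈ 𝓜.plus m ↔
      (dmap (𝓡 6) (fun m => (f (surf Φ m), β (params Φ m))) m v).2 = 0 := by
    intro m v
    rw [← dmap_snd (hsmooth m).mdiff, dmap_comp (hβ.hasFDerivAt (hO' m))
      (hΦ.contMDiff_params m).mdiff, map_eq_zero_iff _ (hβ.2.2.2 _ (hO' m)).1, hΦ.dmap_params,
      hΦ.mem_plus_iff]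
  have hminus : ∀ m v, v ∈ 𝓜.minus m ↔
      (dmap (𝓡 6) (fun m => (f (surf Φ m), β (params Φ m))) m v).1 = 0 := by
    intro m v
    have hc := ((contDiff_fst.comp contDiff_corr).differentiable (n := ∞) (by simp)
      (Φ m)).hasFDerivAt
    rw [← dmap_fst (hsmooth m).mdiff, dmap_comp (hf.hasFDerivAt (hO m))
      (hsurf m).mdiff, map_eq_zero_iff _ (hf.2.2.2 _ (hO m)).1, hΦ.mem_minus_iff,
      ← corr_fst_eq_zero hc]
    exact (congrArg (· = 0) (dmap_comp hc (hΦ.mdiff m) v)).to_iff.symm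
  refine ⟨⟨hsmooth, fun m => ?_, ?_⟩, hplus, hminus⟩
  · rw [injective_iff_map_eq_zero]
    intro v hv
    refine (Submodule.disjoint_def.1 (𝓜.disjoint m)) v ?_ ?_
    · rw [hplus, hv, Prod.snd_zero]
    · rw [hminus, hv, Prod.fst_zero]
  · have h1 : IsEmbedding fun m => ((⟨surf Φ m, hO m⟩, ⟨params Φ m, hO' m⟩) : O × O') :=
      IsEmbedding.of_comp ((hsurf.continuous.subtype_mk _).prodMk
        (hΦ.contMDiff_params.continuous.subtype_mk _))
        (continuous_subtype_val.prodMap continuous_subtype_val)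
        (isEmbedding_corr.comp hΦ.isOpenEmbedding.isEmbedding)
    exact (hf.isOpenEmbedding.isEmbedding.prodMap hβ.isOpenEmbedding.isEmbedding).comp h1

end Correspondence

/-! ### The solution space -/

section Solutions

theorem affine_of_deriv_deriv {g : ℝ → ℝ} (hg : ContDiff ℝ 2 g) (h : ∀ x, deriv (deriv g) x = 0)
    (x : ℝ) : g x = g 0 + (g 1 - g 0) * x := by
  have h1 : Differentiable ℝ (deriv g) :=
    ((contDiff_succ_iff_deriv (n := 1)).1 hg).2.2.differentiable one_ne_zero
  have hd : ∀ x, deriv g x = deriv g 0 := fun x => is_const_of_deriv_eq_zero h1 h x 0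
  have hg' : Differentiable ℝ g := hg.differentiable two_ne_zero
  have h2 : ∀ x, g x - deriv g 0 * x = g 0 := by
    intro x
    have := is_const_of_deriv_eq_zero (f := fun x => g x - deriv g 0 * x)
      (hg'.sub (differentiable_id.const_mul _)) (fun x => by
        have := ((hg' x).hasDerivAt.sub ((hasDerivAt_id x).const_mul (deriv g 0))).deriv
        refine this.trans ?_
        rw [hd x, mul_one, sub_self]) x 0
    simpa using this
  have := h2 1
  have := h2 x
  linear_combination h2 x - x * h2 1

theorem bijOn_solution : BijOn solution univ solutionSpace := by
  refine ⟨fun a _ => ⟨by unfold solution; fun_prop, fun x y => ?_⟩, fun a _ b _ h => ?_, ?_⟩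
  · have h1 : ∀ a b : ℝ, deriv (deriv fun t : ℝ => a + b * t) = 0 := by
      intro a b
      have : deriv (fun t : ℝ => a + b * t) = fun _ => b := by
        funext t
        simp
      rw [this]
      funext t
      simp
    have h2 : (fun t => solution a (t, y)) = fun t => (a 0 + a 2 * y) + (a 1 + a 3 * y) * t := by
      funext t
      simp only [solution]
      ring
    have h3 : (fun t => solution a (x, t)) = fun t => (a 0 + a 1 * x) + (a 2 + a 3 * x) * t := by
      funext t
      simp only [solution]
      ring
    rw [h2, h3, h1, h1]
    exact ⟨rfl, rfl⟩
  · have h00 := congrFun h (0, 0)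
    have h10 := congrFun h (1, 0)
    have h01 := congrFun h (0, 1)
    have h11 := congrFun h (1, 1)
    simp [solution] at h00 h10 h01 h11
    have e1 : a 1 = b 1 := by linarith
    have e2 : a 2 = b 2 := by linarith
    have e3 : a 3 = b 3 := by linarith
    ext i
    fin_cases i <;> assumption
  · rintro z ⟨hz, h⟩
    have hx : ∀ x y, z (x, y) = z (0, y) + (z (1, y) - z (0, y)) * x := fun x y =>
      affine_of_deriv_deriv (g := fun t => z (t, y)) (hz.comp (by fun_prop)) (fun t => (h t y).1) x
    have hy : ∀ x y, z (x, y) = z (x, 0) + (z (x, 1) - z (x, 0)) * y := fun x y =>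
      affine_of_deriv_deriv (g := fun t => z (x, t)) (hz.comp (by fun_prop)) (fun t => (h x t).2) y
    refine ⟨![z (0, 0), z (1, 0) - z (0, 0), z (0, 1) - z (0, 0),
      z (1, 1) - z (1, 0) - z (0, 1) + z (0, 0)], mem_univ _, ?_⟩
    funext ⟨x, y⟩
    rw [hx x y, hy 0 y, hy 1 y]
    simp [solution]
    ring

end Solutions

/-! ### Null directions of conformal frames -/

section NullDirections

/-- The affine coordinates `(x, y)` of the direction of the covector `(t₀, t₁, t₂, t₃)`. -/
def aff (t : R4) : ℝ × ℝ := (t 1 / t 0, t 2 / t 0)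

theorem aff_smul_nullCov {c : ℝ} (hc : c ≠ 0) (w : ℝ × ℝ) : aff (c • nullCov w) = w := by
  ext <;> simp [aff, nullCov, hc]

theorem eq_smul_nullCov_aff {t : R4} (h0 : t 0 ≠ 0) (h : t ⬝ᵥ (g0mat *ᵥ t) = 0) :
    t = t 0 • nullCov (aff t) := by
  have h' : t 0 * t 3 = t 1 * t 2 := by
    simp [g0mat, Matrix.mulVec, dotProduct, Fin.sum_univ_four] at h
    linarith
  ext i
  fin_cases i <;> simp [nullCov, aff] <;> field_simp
  linarith

/-- A covector whose kernel contains that of `(1, x, y, xy)` is a multiple of it. -/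
theorem eq_smul_nullCov {t : R4} {w : ℝ × ℝ} (h : ∀ y, nullCov w ⬝ᵥ y = 0 → t ⬝ᵥ y = 0) :
    t = t 0 • nullCov w := by
  ext k
  have h1 := h (Pi.single k 1 - nullCov w k • Pi.single 0 1) (by
    simp [dotProduct_sub, dotProduct_smul, nullCov])
  simp [dotProduct_sub, dotProduct_smul] at h1
  rw [Pi.smul_apply, smul_eq_mul]
  linarith

theorem contDiffAt_aff {t : R4} (h0 : t 0 ≠ 0) : ContDiffAt ℝ ∞ aff t := by
  unfold aff
  have h : ∀ i, ContDiffAt ℝ ∞ (fun t : R4 => t i) t := fun i => by fun_prop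
  exact ((h 1).div (h 0) h0).prodMk ((h 2).div (h 0) h0)

theorem fderiv_aff_eq_zero {t : R4} (h0 : t 0 ≠ 0) (δ : R4) :
    fderiv ℝ aff t δ = 0 ↔ t 0 * δ 1 = t 1 * δ 0 ∧ t 0 * δ 2 = t 2 * δ 0 := by
  have hp : ∀ i, HasFDerivAt (fun t : R4 => t i) (ContinuousLinearMap.proj i : R4 →L[ℝ] ℝ) t :=
    fun i => (ContinuousLinearMap.proj i : R4 →L[ℝ] ℝ).hasFDerivAt
  -- differentiate `t₀ (t_k / t₀) = t_k`
  have hq : ∀ k, ∀ l : R4 →L[ℝ] ℝ, HasFDerivAt (fun t : R4 => t k / t 0) l t →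
      (l δ = 0 ↔ t 0 * δ k = t k * δ 0) := by
    intro k l hl
    have h1 := (hp 0).mul hl
    have h2 : HasFDerivAt (fun t : R4 => t 0 * (t k / t 0))
        (ContinuousLinearMap.proj k : R4 →L[ℝ] ℝ) t := by
      refine (hp k).congr_of_eventuallyEq ?_
      filter_upwards [(hp 0).continuousAt.eventually_ne h0] with s hs
      field_simp
    have h3 := congrArg (fun f : R4 →L[ℝ] ℝ => f δ) (h1.unique h2)
    have h4 : t 0 * l δ + t k / t 0 * δ 0 = δ k := by simpa using h3
    have h5 : t 0 * t 0 * l δ = t 0 * δ k - t k * δ 0 := by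
      rw [← h4]
      field_simp
      ring
    rw [← sub_eq_zero (a := t 0 * δ k), ← h5]
    simp [h0]
  have h : HasFDerivAt aff (fderiv ℝ aff t) t :=
    ((contDiffAt_aff h0).differentiableAt (by simp)).hasFDerivAt
  have e : ∀ v : ℝ × ℝ, v = 0 ↔ v.1 = 0 ∧ v.2 = 0 := fun v => Prod.ext_iff
  rw [e, ← hq 1 _ h.fst, ← hq 2 _ h.snd]
  rfl

variable {b : Matrix (Fin 4) (Fin 4) ℝ} {ε : ℝ}

theorem frame_conj_transpose (hb : IsCO b) (hε : ε = 1 ∨ ε = -1) :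
    (b⁻¹ * modelMat ε) * g0mat * (b⁻¹ * modelMat ε)ᵀ = (ε * scale b⁻¹) • eta := by
  calc (b⁻¹ * modelMat ε) * g0mat * (b⁻¹ * modelMat ε)ᵀ
      = b⁻¹ * (modelMat ε * g0mat * (modelMat ε)ᵀ) * (b⁻¹)ᵀ := by
        simp only [Matrix.transpose_mul, Matrix.mul_assoc]
    _ = _ := by
      rw [modelMat_conj' hε, Matrix.mul_smul, Matrix.smul_mul, hb.inv.conj_transpose, smul_smul]

theorem frame_conj (hb : IsCO b) (hε : ε = 1 ∨ ε = -1) :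
    (b⁻¹ * modelMat ε)ᵀ * eta * (b⁻¹ * modelMat ε) = ((scale b)⁻¹ * ε) • g0mat := by
  have h1 : scale b⁻¹ = (scale b)⁻¹ := by
    refine scale_eq ?_
    have h2 : (b⁻¹)ᵀ * (bᵀ * eta * b) * b⁻¹ = eta := by
      have h3 : (b⁻¹)ᵀ * bᵀ = 1 := by rw [← Matrix.transpose_mul, hb.mul_inv, Matrix.transpose_one]
      rw [Matrix.mul_assoc bᵀ, ← Matrix.mul_assoc _ bᵀ, h3, Matrix.one_mul, Matrix.mul_assoc,
        hb.mul_inv, Matrix.mul_one]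
    rw [hb.conj_eq, Matrix.mul_smul, Matrix.smul_mul] at h2
    rw [← h2, smul_smul, inv_mul_cancel₀ hb.scale_pos.ne', one_smul, h2]
  calc (b⁻¹ * modelMat ε)ᵀ * eta * (b⁻¹ * modelMat ε)
      = (modelMat ε)ᵀ * ((b⁻¹)ᵀ * eta * b⁻¹) * modelMat ε := by
        simp only [Matrix.transpose_mul, Matrix.mul_assoc]
    _ = _ := by
      rw [hb.inv.conj_eq, h1, Matrix.mul_smul, Matrix.smul_mul, modelMat_conj hε, smul_smul]

theorem mul_conj_apply (B g : Matrix (Fin 4) (Fin 4) ℝ) (i j : Fin 4) :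
    (B * g * Bᵀ) i j = B i ⬝ᵥ (g *ᵥ B j) := by
  rw [Matrix.mul_assoc]
  rfl

theorem frame_dot (hb : IsCO b) (hε : ε = 1 ∨ ε = -1) (i j : Fin 4) :
    (b⁻¹ * modelMat ε) i ⬝ᵥ (g0mat *ᵥ (b⁻¹ * modelMat ε) j) = ε * scale b⁻¹ * eta i j := by
  rw [← mul_conj_apply, frame_conj_transpose hb hε]
  rfl

/-- In a conformal frame with the null covector `θ⁴`, the direction of `θ⁴` is constant to first
order iff the components `Θ⁴₁` and `Θ⁴₂` of the connection form vanish. -/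
theorem fderiv_aff_frame (hb : IsCO b) (hε : ε = 1 ∨ ε = -1)
    (h0 : (b⁻¹ * modelMat ε) 3 0 ≠ 0) {Θ : Fin 4 → ℝ} (h2 : Θ 2 = 0) :
    fderiv ℝ aff ((b⁻¹ * modelMat ε) 3) (-(Θ ᵥ* (b⁻¹ * modelMat ε))) = 0
      ↔ Θ 0 = 0 ∧ Θ 1 = 0 := by
  set B := b⁻¹ * modelMat ε with hB
  have hd := frame_dot hb hε
  rw [← hB] at hd
  have hε0 : ε ≠ 0 := by rcases hε with rfl | rfl <;> norm_num
  have hs : scale b⁻¹ ≠ 0 := hb.inv.scale_pos.ne'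
  have hv : Θ ᵥ* B = Θ 0 • B 0 + Θ 1 • B 1 + Θ 3 • B 3 := by
    ext k
    simp [Matrix.vecMul, dotProduct, Fin.sum_univ_four, h2]
  rw [fderiv_aff_eq_zero h0, hv]
  set δ := -(Θ 0 • B 0 + Θ 1 • B 1 + Θ 3 • B 3) with hδ
  constructor
  · rintro ⟨h1, h2⟩
    -- `δ` is orthogonal to the null covector `B 3`, and proportional to it in three components
    have h3 : δ ⬝ᵥ (g0mat *ᵥ B 3) = 0 := by
      simp only [hδ, neg_dotProduct, add_dotProduct, smul_dotProduct, hd]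
      simp [eta]
    have h4 : B 3 ⬝ᵥ (g0mat *ᵥ B 3) = 0 := by
      rw [hd]
      simp [eta]
    have h5 : B 3 0 * δ 3 = B 3 3 * δ 0 := by
      simp [g0mat, Matrix.mulVec, dotProduct, Fin.sum_univ_four] at h3 h4
      have : B 3 0 * (B 3 0 * δ 3) = B 3 0 * (B 3 3 * δ 0) := by
        linear_combination B 3 0 * h3 - δ 0 * h4 + B 3 2 * h1 + B 3 1 * h2
      exact mul_left_cancel₀ h0 this
    have h6 : B 3 0 • δ = δ 0 • B 3 := by
      ext k
      fin_cases k
      · simp [mul_comm]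
      · simpa [mul_comm] using h1
      · simpa [mul_comm] using h2
      · simpa [mul_comm] using h5
    have h7 := fun j => congrArg (· ⬝ᵥ (g0mat *ᵥ B j)) h6
    simp only [hδ, smul_dotProduct, neg_dotProduct, add_dotProduct, hd] at h7
    have h70 := h7 0
    have h71 := h7 1
    simp [eta, h0, hε0, hs] at h70 h71
    exact ⟨h71, h70⟩
  · rintro ⟨e0, e1⟩
    simp only [hδ, e0, e1, zero_smul, zero_add, Pi.neg_apply, Pi.smul_apply, smul_eq_mul]
    constructor <;> ring

end NullDirections

/-! ### Coframes on an 11-dimensional manifold -/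

section Coframe

variable {P : Type*} [TopologicalSpace P] [ChartedSpace (EuclideanSpace ℝ (Fin 11)) P]

/-- The values of a coframe at `p` can be prescribed. -/
theorem exists_coframe_eq {θ : Fin 4 → OneForm (𝓡 11) P} {Ω : Fin 6 → OneForm (𝓡 11) P}
    {A : OneForm (𝓡 11) P} {p : P}
    (h : ∀ v, (∀ i, θ i p v = 0) → (∀ μ, Ω μ p v = 0) → A p v = 0 → v = 0)
    (a : Fin 4 → ℝ) (w : Fin 6 → ℝ) (c : ℝ) :
    ∃ v, (∀ i, θ i p v = a i) ∧ (∀ μ, Ω μ p v = w μ) ∧ A p v = c := by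
  let f : EuclideanSpace ℝ (Fin 11) →ₗ[ℝ] (Fin 4 → ℝ) × (Fin 6 → ℝ) × ℝ :=
    (LinearMap.pi fun i => (θ i p : EuclideanSpace ℝ (Fin 11) →L[ℝ] ℝ).toLinearMap).prod
      ((LinearMap.pi fun μ => (Ω μ p : EuclideanSpace ℝ (Fin 11) →L[ℝ] ℝ).toLinearMap).prod
        (A p : EuclideanSpace ℝ (Fin 11) →L[ℝ] ℝ).toLinearMap)
  have hi : Function.Injective f := by
    rw [injective_iff_map_eq_zero]
    intro v hv
    have h1 := congrArg Prod.fst hv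
    have h2 := congrArg (fun x => x.2.1) hv
    have h3 := congrArg (fun x => x.2.2) hv
    exact h v (fun i => congrFun h1 i) (fun i => congrFun h2 i) h3
  have hs := (LinearMap.injective_iff_surjective_of_finrank_eq_finrank (f := f) (by simp)).1 hi
  obtain ⟨v, hv⟩ := hs (a, w, c)
  have h1 := congrArg Prod.fst hv
  have h2 := congrArg (fun x => x.2.1) hv
  have h3 := congrArg (fun x => x.2.2) hv
  exact ⟨v, fun i => congrFun h1 i, fun i => congrFun h2 i, h3⟩

end Coframe

/-! ### Conformal frames and the distributions of a para-CR structure -/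

section AdaptedFrames

variable {M : Type*} [TopologicalSpace M] [ChartedSpace (EuclideanSpace ℝ (Fin 6)) M]
  [IsManifold (𝓡 6) ∞ M] {𝓜 : ParaCR (𝓡 6) M 2 3} {Φ : M → Flat}
  {P : Type*} [TopologicalSpace P] [ChartedSpace (EuclideanSpace ℝ (Fin 11)) P]

theorem dMat_mfderiv {E H : Type*} [NormedAddCommGroup E] [NormedSpace ℝ E] [TopologicalSpace H]
    {I : ModelWithCorners ℝ E H} {N : Type*} [TopologicalSpace N] [ChartedSpace H N]
    {A : P → Matrix (Fin 4) (Fin 4) ℝ} (hA : MatSmooth (𝓡 11) A) {f : N → P} {x : N}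
    (hf : MDifferentiableAt I (𝓡 11) f x) (v : TangentSpace I x) :
    dMat I (fun x => A (f x)) x v = dMat (𝓡 11) A (f x) (mfderiv I (𝓡 11) f x v) := by
  ext i j
  exact dmap_mfderiv (hA i j (f x)).mdiff hf v

theorem mcForm_three_two {b : P → Matrix (Fin 4) (Fin 4) ℝ} (hb : MatSmooth (𝓡 11) b)
    (hco : ∀ p, IsCO (b p)) (p : P) (v : TangentSpace (𝓡 11) p) :
    ((b p)⁻¹ * dMat (𝓡 11) b p v) 3 2 = 0 := by
  have h := congrFun (congrFun (mcForm_conformal hb hco p v) 2) 2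
  rw [Matrix.add_apply, mul_eta_apply, eta_mul_apply, Matrix.transpose_apply] at h
  simpa [dualIdx, eta] using h

/-- The null covector `θ⁴`, as a covector on `ℝ⁴`, of the conformal frame `b⁻¹ L`. -/
def nullRow (ε : ℝ) (b : P → Matrix (Fin 4) (Fin 4) ℝ) (p : P) : R4 := ((b p)⁻¹ * modelMat ε) 3

/-- The point of the flat model that belongs to the null direction `θ⁴` over `q p`. -/
def nullPoint (ε : ℝ) (q : P → R4) (b : P → Matrix (Fin 4) (Fin 4) ℝ) (p : P) : Flat :=
  (aff (nullRow ε b p), q p)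

variable {q : P → R4} {b : P → Matrix (Fin 4) (Fin 4) ℝ} {ε : ℝ}

theorem contMDiff_nullRow (hb : MatSmooth (𝓡 11) b) (hco : ∀ p, IsCO (b p)) :
    ContMDiff (𝓡 11) 𝓘(ℝ, R4) ∞ (nullRow ε b) :=
  contMDiff_pi_space.2 fun k =>
    ((hb.inv fun p => (hco p).det_ne_zero).mul (matSmooth_const (modelMat ε))) 3 k

theorem dmap_nullRow (hb : MatSmooth (𝓡 11) b) (hco : ∀ p, IsCO (b p)) (p : P)
    (v : TangentSpace (𝓡 11) p) : dmap (𝓡 11) (nullRow ε b) p v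
      = -(((b p)⁻¹ * dMat (𝓡 11) b p v) 3 ᵥ* ((b p)⁻¹ * modelMat ε)) := by
  have hd := fun p => (hco p).det_ne_zero
  have h := dMat_mul (hb.inv hd) (matSmooth_const (modelMat ε)) p v
  rw [dMat_const, Matrix.mul_zero, add_zero, dMat_inv hb hd, Matrix.neg_mul, Matrix.mul_assoc] at h
  ext k
  rw [← dmap_apply (contMDiff_nullRow hb hco p).mdiff k v]
  exact congrFun (congrFun h 3) k

omit [TopologicalSpace P] [ChartedSpace (EuclideanSpace ℝ (Fin 11)) P] in
theorem nullRow_null (hco : ∀ p, IsCO (b p)) (hε : ε = 1 ∨ ε = -1) (p : P) :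
    nullRow ε b p ⬝ᵥ (g0mat *ᵥ nullRow ε b p) = 0 := by
  refine (frame_dot (hco p) hε 3 3).trans ?_
  simp [eta]

theorem contMDiffAt_nullPoint (hq : ContMDiff (𝓡 11) 𝓘(ℝ, R4) ∞ q) (hb : MatSmooth (𝓡 11) b)
    (hco : ∀ p, IsCO (b p)) {p : P} (h0 : nullRow ε b p 0 ≠ 0) :
    ContMDiffAt (𝓡 11) 𝓘(ℝ, Flat) ∞ (nullPoint ε q b) p :=
  ((contDiffAt_aff h0).comp_contMDiffAt (contMDiff_nullRow hb hco p)).prodMk_space (hq p)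

variable (hΦ : IsParaCREmbedding 𝓜 flatParaCR Φ) {ρ : P → M} {p : P}

include hΦ

theorem adapted_plus_of_nullPoint (hq : ContMDiff (𝓡 11) 𝓘(ℝ, R4) ∞ q)
    (hb : MatSmooth (𝓡 11) b) (hco : ∀ p, IsCO (b p)) (h0 : nullRow ε b p 0 ≠ 0)
    (hρ : MDifferentiableAt (𝓡 11) (𝓡 6) ρ p) (h : (fun p => Φ (ρ p)) =ᶠ[𝓝 p] nullPoint ε q b)
    (v : TangentSpace (𝓡 11) p) :
    mfderiv (𝓡 11) (𝓡 6) ρ p v ∈ 𝓜.plus (ρ p) ↔ dmap (𝓡 11) q p v = 0 := by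
  rw [hΦ.mem_plus_iff, ← dmap_mfderiv (hΦ.mdiff _) hρ v, dmap_congr h,
    ← dmap_snd (contMDiffAt_nullPoint hq hb hco h0).mdiff]
  rfl

theorem adapted_minus_of_nullPoint (hq : ContMDiff (𝓡 11) 𝓘(ℝ, R4) ∞ q)
    (hb : MatSmooth (𝓡 11) b) (hco : ∀ p, IsCO (b p)) (hε : ε = 1 ∨ ε = -1)
    (h0 : nullRow ε b p 0 ≠ 0)
    (hρ : MDifferentiableAt (𝓡 11) (𝓡 6) ρ p) (h : (fun p => Φ (ρ p)) =ᶠ[𝓝 p] nullPoint ε q b)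
    (v : TangentSpace (𝓡 11) p) :
    mfderiv (𝓡 11) (𝓡 6) ρ p v ∈ 𝓜.minus (ρ p) ↔ nullRow ε b p ⬝ᵥ dmap (𝓡 11) q p v = 0 ∧
      mcForm (𝓡 11) b 3 0 p v = 0 ∧ mcForm (𝓡 11) b 3 1 p v = 0 := by
  have hs := (contMDiffAt_nullPoint hq hb hco h0).mdiff
  have hp : Φ (ρ p) = nullPoint ε q b p := h.self_of_nhds
  rw [hΦ.mem_minus_iff, ← dmap_mfderiv (hΦ.mdiff _) hρ v, dmap_congr h, ← dmap_snd hs,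
    ← dmap_fst hs, hp, mcForm_apply, mcForm_apply]
  refine and_congr ?_ ?_
  · conv_rhs => rw [eq_smul_nullCov_aff h0 (nullRow_null hco hε p), smul_dotProduct, smul_eq_mul]
    exact (mul_eq_zero_iff_left h0).symm
  · rw [← fderiv_aff_frame (hco p) hε h0 (mcForm_three_two hb hco p v), ← dmap_nullRow hb hco]
    exact (congrArg (· = 0) (dmap_comp (((contDiffAt_aff h0).differentiableAt
      (by simp)).hasFDerivAt) (contMDiff_nullRow hb hco p).mdiff v)).to_iff

end AdaptedFrames

/-! ### The bundle `V × CO(2,2)` -/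

namespace Model

variable {V : TopologicalSpace.Opens R4}

/-- The projection to `V`. -/
def base (x : Model V) : R4 := x.val.1

/-- The component in `CO(2,2)`. -/
def mat (x : Model V) : Matrix (Fin 4) (Fin 4) ℝ := Matrix.of x.val.2

theorem base_mem (x : Model V) : x.base ∈ V := x.2.1

theorem isCO_mat (x : Model V) : IsCO x.mat := x.2.2

theorem contMDiff_base : ContMDiff (𝓡 11) 𝓘(ℝ, R4) ∞ (base (V := V)) :=
  contDiff_fst.comp_contMDiff isSmoothEmb_val.contMDiff

theorem matSmooth_mat : MatSmooth (𝓡 11) (mat (V := V)) :=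
  matSmooth_iff.2 (contDiff_snd.comp_contMDiff isSmoothEmb_val.contMDiff)

theorem eq_zero_of_dmap {x : Model V} {v : TangentSpace (𝓡 11) x}
    (h1 : dmap (𝓡 11) base x v = 0) (h2 : dMat (𝓡 11) mat x v = 0) : v = 0 := by
  refine (injective_iff_map_eq_zero _).1 (isSmoothEmb_val.injective_mfderiv x) v ?_
  have hd := (isSmoothEmb_val.contMDiff x).mdiff
  refine Prod.ext ((dmap_fst hd v).symm.trans h1) ?_
  rw [← dmap_snd hd]
  have hd2 : ContMDiff (𝓡 11) 𝓘(ℝ, Fin 4 → Fin 4 → ℝ) ∞ fun x : Model V => x.val.2 :=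
    contDiff_snd.comp_contMDiff isSmoothEmb_val.contMDiff
  ext i j
  have h3 := congrFun (congrFun h2 i) j
  rw [← dmap_apply (hd2 x).mdiff, ← dmap_apply ((contMDiff_pi_space.1 hd2 i) x).mdiff]
  exact h3

/-- The point `(s, b)`. -/
def mk (s : R4) (hs : s ∈ V) (b : CO22) : Model V := ⟨(s, coEntries b), hs, isCO_coMat b⟩

/-- The right action of `CO(2,2)`. -/
def act (x : Model V) (b : CO22) : Model V :=
  ⟨(x.base, fun i j => (x.mat * coMat b) i j), x.base_mem, x.isCO_mat.mul (isCO_coMat b)⟩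

theorem base_act (x : Model V) (b : CO22) : (x.act b).base = x.base := rfl

theorem mat_act (x : Model V) (b : CO22) : (x.act b).mat = x.mat * coMat b := rfl

theorem ext {x y : Model V} (h1 : x.base = y.base) (h2 : x.mat = y.mat) : x = y :=
  Subtype.ext (Prod.ext h1 h2)

/-- A map to `V × CO(2,2)` is smooth if its components are. -/
theorem contMDiff_of {E H : Type*} [NormedAddCommGroup E] [NormedSpace ℝ E] [TopologicalSpace H]
    {I : ModelWithCorners ℝ E H} {N : Type*} [TopologicalSpace N] [ChartedSpace H N]
    {f : N → Model V} (h1 : ContMDiff I 𝓘(ℝ, R4) ∞ fun x => (f x).base)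
    (h2 : MatSmooth I fun x => (f x).mat) : ContMDiff I (𝓡 11) ∞ f := by
  have h : ContMDiff I 𝓘(ℝ, Amb) ∞ fun x => (f x).val := h1.prodMk_space (matSmooth_iff.1 h2)
  intro x
  exact contMDiffAt_of_immersion (isSmoothEmb_val.contMDiff _) (isSmoothEmb_val.injective_mfderiv _)
    (isSmoothEmb_val.isEmbedding.continuous_iff.2 h.continuous).continuousAt (h x)

theorem contMDiff_act (b : CO22) : ContMDiff (𝓡 11) (𝓡 11) ∞ fun x : Model V => x.act b :=
  contMDiff_of contMDiff_base (matSmooth_mat.mul (matSmooth_const (coMat b)))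

/-- The solder form `b⁻¹ L ds`. -/
def θ (i : Fin 4) : OneForm (𝓡 11) (Model V) := fun x =>
  (ContinuousLinearMap.proj i : R4 →L[ℝ] ℝ).comp ((LinearMap.toContinuousLinearMap
    (Matrix.mulVecLin (x.mat⁻¹ * modelMat 1))).comp (dmap (𝓡 11) base x))

theorem θ_apply (i : Fin 4) (x : Model V) (v : TangentSpace (𝓡 11) x) :
    θ i x v = ((x.mat⁻¹ * modelMat 1) *ᵥ dmap (𝓡 11) base x v) i := rfl

/-- The components `Ω_μ` of the Maurer–Cartan form `b⁻¹ db`. -/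
def Ω : Fin 6 → OneForm (𝓡 11) (Model V) := skewPart (mcForm (𝓡 11) mat)

/-- The trace component `A` of the Maurer–Cartan form `b⁻¹ db`. -/
def A : OneForm (𝓡 11) (Model V) := tracePart (mcForm (𝓡 11) mat)

theorem of_mcForm (x : Model V) (v : TangentSpace (𝓡 11) x) :
    Matrix.of (fun i j => mcForm (𝓡 11) mat i j x v) = x.mat⁻¹ * dMat (𝓡 11) mat x v := by
  ext i j
  exact mcForm_apply i j x v

theorem gamma_eq (i j : Fin 4) (x : Model V) (v : TangentSpace (𝓡 11) x) :
    gamma Ω A i j x v = mcForm (𝓡 11) mat i j x v := by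
  have h := mcForm_conformal matSmooth_mat isCO_mat x v
  rw [← of_mcForm] at h
  exact (gamma_skewPart h i j).1

theorem gamma_eq' (i j : Fin 4) : gamma Ω A i j = mcForm (𝓡 11) (mat (V := V)) i j := by
  funext x
  ext v
  exact gamma_eq i j x v

theorem mcForm_isSmooth' (i j : Fin 4) : (mcForm (𝓡 11) (mat (V := V)) i j).IsSmooth :=
  mcForm_isSmooth matSmooth_mat (fun x => x.isCO_mat.det_ne_zero) i j

theorem smooth_Ω (μ : Fin 6) : (Ω (V := V) μ).IsSmooth := by
  have h : ∀ i j, OneForm.IsSmooth (P := Model V) (I := 𝓡 11)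
      (fun x => (1 / 2 : ℝ) • (mcForm (𝓡 11) mat i i x - mcForm (𝓡 11) mat j j x)) := fun i j =>
    OneForm.IsSmooth.congr_sum (β := ![mcForm (𝓡 11) mat i i, mcForm (𝓡 11) mat j j])
      ![1 / 2, -1 / 2] (fun k => by fin_cases k <;> exact mcForm_isSmooth' _ _) (fun x v => by
        rw [Fin.sum_univ_two]
        change 1 / 2 * (mcForm (𝓡 11) mat i i x v - mcForm (𝓡 11) mat j j x v)
          = 1 / 2 * mcForm (𝓡 11) mat i i x v + -1 / 2 * mcForm (𝓡 11) mat j j x v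
        ring)
  fin_cases μ
  exacts [h 1 0, mcForm_isSmooth' _ _, mcForm_isSmooth' _ _, mcForm_isSmooth' _ _,
    mcForm_isSmooth' _ _, h 3 2]

theorem smooth_A : (A (V := V)).IsSmooth :=
  OneForm.IsSmooth.congr_sum (β := ![mcForm (𝓡 11) mat 0 0, mcForm (𝓡 11) mat 1 1])
    ![1, 1] (fun k => by fin_cases k <;> exact mcForm_isSmooth' _ _) (fun x v => by
      rw [Fin.sum_univ_two]
      change mcForm (𝓡 11) mat 0 0 x v + mcForm (𝓡 11) mat 1 1 x v
          = 1 * mcForm (𝓡 11) mat 0 0 x v + 1 * mcForm (𝓡 11) mat 1 1 x v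
      ring)

theorem det_frame_ne_zero (x : Model V) : (x.mat⁻¹ * modelMat 1).det ≠ 0 := by
  rw [Matrix.det_mul]
  refine mul_ne_zero x.isCO_mat.inv.det_ne_zero ?_
  have := congrArg Matrix.det (modelMat_mul_transpose (ε := 1) (Or.inl rfl))
  rw [Matrix.det_mul, Matrix.det_one] at this
  exact left_ne_zero_of_mul (this.trans_ne one_ne_zero)

theorem θ_vertical (x : Model V) (v : TangentSpace (𝓡 11) x) :
    (∀ i, θ i x v = 0) ↔ dmap (𝓡 11) base x v = 0 := by
  constructor
  · intro h
    exact Matrix.eq_zero_of_mulVec_eq_zero (det_frame_ne_zero x) (funext h)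
  · intro h i
    rw [θ_apply, h, Matrix.mulVec_zero]
    rfl

theorem coframe (x : Model V) (v : TangentSpace (𝓡 11) x) (h1 : ∀ i, θ i x v = 0)
    (h2 : ∀ μ, Ω μ x v = 0) (h3 : A x v = 0) : v = 0 := by
  refine eq_zero_of_dmap ((θ_vertical x v).1 h1) ?_
  have h4 : x.mat⁻¹ * dMat (𝓡 11) mat x v = 0 := by
    rw [← of_mcForm]
    ext i j
    rw [Matrix.of_apply, ← gamma_eq, gamma_apply, funext h2, h3, zero_div, zero_smul, add_zero]
    change skewMat 0 i j = 0
    rw [skewMat_apply]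
    fin_cases i <;> fin_cases j <;> simp
  rw [← Matrix.one_mul (dMat _ _ _ _), ← x.isCO_mat.mul_inv, Matrix.mul_assoc, h4, Matrix.mul_zero]

end Model

/-! ### Existence of the Cartan bundle -/

section Existence

variable {M : Type*} [TopologicalSpace M] [ChartedSpace (EuclideanSpace ℝ (Fin 6)) M]
  [IsManifold (𝓡 6) ∞ M] {𝓜 : ParaCR (𝓡 6) M 2 3} {Φ : M → Flat}

/-- The null covector `(1, x, y, xy)` is the last row of a conformal frame. -/
theorem exists_frame (w : ℝ × ℝ) : ∃ b : CO22, ((coMat b)⁻¹ * modelMat 1) 3 = nullCov w := by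
  let B : Matrix (Fin 4) (Fin 4) ℝ :=
    !![0, 1, 0, w.2; 0, 0, -1, -w.1; 0, 0, 0, 1; 1, w.1, w.2, w.1 * w.2]
  have h1 : B * g0mat * Bᵀ = eta := by
    ext i j
    fin_cases i <;> fin_cases j <;>
      simp [B, g0mat, eta, Matrix.mul_apply, Fin.sum_univ_four, Matrix.transpose_apply]
    ring
  have h2 : IsCO (B * (modelMat 1)ᵀ) := by
    refine isCO_of_conj_transpose one_pos ?_
    have h3 : (modelMat 1)ᵀ * eta * modelMat 1 = g0mat := by
      simpa using modelMat_conj (ε := 1) (Or.inl rfl)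
    calc (B * (modelMat 1)ᵀ) * eta * (B * (modelMat 1)ᵀ)ᵀ
        = B * ((modelMat 1)ᵀ * eta * modelMat 1) * Bᵀ := by
          simp only [Matrix.transpose_mul, Matrix.transpose_transpose, Matrix.mul_assoc]
      _ = _ := by rw [h3, h1, one_smul]
  refine ⟨h2.toCO⁻¹, ?_⟩
  rw [← coMat_inv, inv_inv, h2.coMat_toCO, Matrix.mul_assoc, modelMat_transpose_mul (Or.inl rfl),
    Matrix.mul_one]
  ext k
  fin_cases k <;> rfl

variable (hΦ : IsParaCREmbedding 𝓜 flatParaCR Φ)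

include hΦ in
/-- If the null covector `θ⁴` of a frame annihilates the image of `H⁺ ⊕ H⁻` at `m`, then its
direction is the one of `m`. -/
theorem nullRow_eq_of_annihilates {P : Type*} [TopologicalSpace P]
    [ChartedSpace (EuclideanSpace ℝ (Fin 11)) P] {q : P → R4} {r : R4} {p : P} {m : M}
    (hs : Function.Surjective (dmap (𝓡 11) q p)) (hr : r ≠ 0)
    (h : ∀ v, ∀ w ∈ 𝓜.plus m ⊔ 𝓜.minus m, dmap (𝓡 11) q p v = dmap (𝓡 6) (params Φ) m w →
      r ⬝ᵥ dmap (𝓡 11) q p v = 0) :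
    r 0 ≠ 0 ∧ aff r = (Φ m).1 ∧ r = r 0 • nullCov (Φ m).1 := by
  have h1 : r = r 0 • nullCov (Φ m).1 := by
    refine eq_smul_nullCov fun y hy => ?_
    obtain ⟨v, rfl⟩ := hs y
    obtain ⟨w, hw⟩ := hΦ.isLeafProjection.surjective_mfderiv m (dmap (𝓡 11) q p v)
    exact h v w (hΦ.mem_sup_iff.2 (by rw [hw]; exact hy)) hw.symm
  have h0 : r 0 ≠ 0 := by
    intro h0
    rw [h0, zero_smul] at h1
    exact hr h1
  exact ⟨h0, by rw [h1, aff_smul_nullCov h0], h1⟩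

/-- A continuous map to `M` is smooth if its composition with `Φ` is. -/
theorem IsParaCREmbedding.contMDiffAt_of_comp (hΦ : IsParaCREmbedding 𝓜 flatParaCR Φ)
    {P : Type*} [TopologicalSpace P]
    [ChartedSpace (EuclideanSpace ℝ (Fin 11)) P] {ρ : P → M} {p : P}
    (h : ContMDiffAt (𝓡 11) 𝓘(ℝ, Flat) ∞ (fun p => Φ (ρ p)) p) :
    ContMDiffAt (𝓡 11) (𝓡 6) ∞ ρ p :=
  contMDiffAt_of_immersion (hΦ.contMDiff _) (hΦ.dmap_bijective _).1
    (hΦ.isOpenEmbedding.isInducing.continuousAt_iff.2 h.continuousAt) h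

/-- The open set of the parameters of the points of `M`. -/
def paramOpens : TopologicalSpace.Opens R4 := ⟨range (params Φ), hΦ.isOpen_range_params⟩

namespace Model

/-- The set of the frames whose null covector `θ⁴` belongs to a point of `M`. -/
def dom (V : TopologicalSpace.Opens R4) (Φ : M → Flat) : Set (Model V) :=
  {x | nullRow 1 mat x 0 ≠ 0 ∧ nullPoint 1 base mat x ∈ range Φ}

/-- The point of `M` that belongs to the null covector `θ⁴` of a frame. -/
def rho [Nonempty M] (V : TopologicalSpace.Opens R4) (Φ : M → Flat) (x : Model V) : M :=
  Function.invFun Φ (nullPoint 1 base mat x)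

variable {V : TopologicalSpace.Opens R4}

theorem nullRow_ne_zero (x : Model V) : nullRow 1 mat x ≠ 0 := by
  intro h
  exact det_frame_ne_zero x (Matrix.det_eq_zero_of_row_eq_zero 3 (congrFun h))

theorem isOpen_dom (hΦ : IsParaCREmbedding 𝓜 flatParaCR Φ) : IsOpen (dom V Φ) := by
  rw [isOpen_iff_mem_nhds]
  rintro x ⟨h0, hx⟩
  have c1 : ContinuousAt (fun x : Model V => nullRow 1 mat x 0) x :=
    (continuous_apply (0 : Fin 4)).continuousAt.comp
      (contMDiff_nullRow matSmooth_mat isCO_mat).continuous.continuousAt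
  have c2 := (contMDiffAt_nullPoint contMDiff_base matSmooth_mat isCO_mat h0).continuousAt
  filter_upwards [c1.eventually_ne h0,
    c2.eventually (hΦ.isOpenEmbedding.isOpen_range.mem_nhds hx)] with y h1 h2 using ⟨h1, h2⟩

omit [TopologicalSpace M] [ChartedSpace (EuclideanSpace ℝ (Fin 6)) M] [IsManifold (𝓡 6) ∞ M] in
theorem rho_spec [Nonempty M] {x : Model V} (hx : x ∈ dom V Φ) :
    Φ (rho V Φ x) = nullPoint 1 base mat x := Function.invFun_eq hx.2

theorem contMDiffAt_rho [Nonempty M] (hΦ : IsParaCREmbedding 𝓜 flatParaCR Φ) {x : Model V}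
    (hx : x ∈ dom V Φ) : ContMDiffAt (𝓡 11) (𝓡 6) ∞ (rho V Φ) x := by
  refine hΦ.contMDiffAt_of_comp ?_
  refine (contMDiffAt_nullPoint contMDiff_base matSmooth_mat isCO_mat hx.1).congr_of_eventuallyEq ?_
  filter_upwards [(isOpen_dom hΦ).mem_nhds hx] with y hy using rho_spec hy

theorem eventuallyEq_nullPoint [Nonempty M] (hΦ : IsParaCREmbedding 𝓜 flatParaCR Φ) {x : Model V}
    (hx : x ∈ dom V Φ) : (fun x => Φ (rho V Φ x)) =ᶠ[𝓝 x] nullPoint 1 base mat := by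
  filter_upwards [(isOpen_dom hΦ).mem_nhds hx] with y hy using rho_spec hy

theorem surjective_dmap_base (x : Model V) : Function.Surjective (dmap (𝓡 11) base x) := by
  intro y
  obtain ⟨v, hv, -⟩ := exists_coframe_eq (coframe x) ((x.mat⁻¹ * modelMat 1) *ᵥ y) 0 0
  refine ⟨v, ?_⟩
  have h1 : (x.mat⁻¹ * modelMat 1) *ᵥ (dmap (𝓡 11) base x v - y) = 0 := by
    rw [Matrix.mulVec_sub, sub_eq_zero]
    exact funext hv
  exact sub_eq_zero.1 (Matrix.eq_zero_of_mulVec_eq_zero (det_frame_ne_zero x) h1)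

theorem Ω_one (x : Model V) (v : TangentSpace (𝓡 11) x) :
    mcForm (𝓡 11) mat 3 0 x v = -Ω 1 x v := by
  rw [← gamma_eq, gamma_apply, Matrix.add_apply, skewMat_apply]
  simp

theorem Ω_two (x : Model V) (v : TangentSpace (𝓡 11) x) :
    mcForm (𝓡 11) mat 3 1 x v = -Ω 2 x v := by
  rw [← gamma_eq, gamma_apply, Matrix.add_apply, skewMat_apply]
  simp

theorem gamma_vertical (x : Model V) (b : ℝ → CO22) (hb0 : b 0 = 1)
    (hb : ContDiff ℝ ∞ fun τ => coEntries (b τ)) (i j : Fin 4) :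
    gamma Ω A i j (x.act (b 0)) (mfderiv 𝓘(ℝ, ℝ) (𝓡 11) (fun τ => x.act (b τ)) 0 (1 : ℝ))
      = deriv (fun τ => coMat (b τ) i j) 0 := by
  have hbs : MatSmooth 𝓘(ℝ, ℝ) fun τ => coMat (b τ) := matSmooth_iff.2 hb.contMDiff
  have hs : ContMDiff 𝓘(ℝ, ℝ) (𝓡 11) ∞ fun τ => x.act (b τ) :=
    contMDiff_of contMDiff_const ((matSmooth_const x.mat).mul hbs)
  have h1 := dMat_mfderiv matSmooth_mat (hs 0).mdiff (1 : ℝ)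
  have h2 := dMat_mul (matSmooth_const x.mat) hbs (0 : ℝ) (1 : ℝ)
  have h0 : dMat 𝓘(ℝ, ℝ) (fun _ : ℝ => x.mat) (0 : ℝ) (1 : ℝ) = 0 := dMat_const _ _ _
  rw [h0, Matrix.zero_mul, zero_add] at h2
  have h3 : dMat (𝓡 11) mat (x.act (b 0))
      (mfderiv 𝓘(ℝ, ℝ) (𝓡 11) (fun τ => x.act (b τ)) 0 (1 : ℝ))
      = x.mat * dMat 𝓘(ℝ, ℝ) (fun τ => coMat (b τ)) (0 : ℝ) (1 : ℝ) := h1.symm.trans h2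
  rw [gamma_eq, mcForm_apply, h3, mat_act, hb0, coMat_one, Matrix.mul_one, ← Matrix.mul_assoc,
    x.isCO_mat.inv_mul, Matrix.one_mul]
  exact congrArg (fun f : ℝ →L[ℝ] ℝ => f 1) (mfderiv_eq_fderiv (f := fun τ => coMat (b τ) i j))

/-- The Cartan bundle `S × CO(2,2)` with the Maurer–Cartan form of `ℝ⁴ ⋊ CO(2,2)`; its points
are the frames of `ℝ⁴` that are conformal for `g₀`. -/
def cartanBundle [Nonempty M] (hΦ : IsParaCREmbedding 𝓜 flatParaCR Φ) :
    CartanBundle 𝓜 (params Φ) (Model (paramOpens hΦ)) where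
  q := base
  act := act
  contMDiff_q := contMDiff_base
  range_q := by
    refine Subset.antisymm (range_subset_iff.2 fun x => x.base_mem) fun s hs => ?_
    exact ⟨mk s hs 1, rfl⟩
  act_one x := Model.ext rfl (by rw [mat_act, coMat_one, Matrix.mul_one])
  act_mul x b b' := Model.ext rfl (by simp only [mat_act, coMat_mul, Matrix.mul_assoc])
  q_act := base_act
  local_triv s hs := by
    refine ⟨range (params Φ), hΦ.isOpen_range_params, hs, subset_rfl, fun x => x.isCO_mat.toCO,
      fun x _ b => coMat_injective rfl, ⟨fun x hx => ⟨hx, mem_univ _⟩, fun x _ y _ h => ?_, ?_⟩,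
      isSmoothEmb_val.contMDiff.contMDiffOn, fun x _ => isSmoothEmb_val.injective_mfderiv x,
      isSmoothEmb_val.isEmbedding.comp IsEmbedding.subtypeVal⟩
    · exact Model.ext (Prod.ext_iff.1 h).1 (congrArg coMat (Prod.ext_iff.1 h).2)
    · rintro ⟨s, b⟩ ⟨hs, -⟩
      exact ⟨mk s hs b, hs, Prod.ext rfl (coMat_injective rfl)⟩
  θ := θ
  Ω := Ω
  A := A
  smooth_θ i p := (solder_d matSmooth_mat (fun x => x.isCO_mat.det_ne_zero) (modelMat 1)
    contMDiff_base θ_apply i p 0 0).1 p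
  smooth_Ω := smooth_Ω
  smooth_A := smooth_A
  coframe := coframe
  dθ_eq i x u v := by
    simp only [gamma_eq']
    exact (solder_d matSmooth_mat (fun x => x.isCO_mat.det_ne_zero) (modelMat 1)
      contMDiff_base θ_apply i x u v).2
  dΓ_eq i j x u v := by
    simp only [gamma_eq']
    exact mcForm_d matSmooth_mat (fun x => x.isCO_mat.det_ne_zero) i j x u v
  θ_vertical := θ_vertical
  θ_act b x v i := by
    have h := dmap_mfderiv (f := fun x => act x b) (contMDiff_base (x.act b)).mdiff (contMDiff_act b x).mdiff v
    rw [θ_apply, ← h]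
    change (((x.mat * coMat b)⁻¹ * modelMat 1) *ᵥ dmap (𝓡 11) base x v) i
      = (coMat b⁻¹ *ᵥ ((x.mat⁻¹ * modelMat 1) *ᵥ dmap (𝓡 11) base x v)) i
    rw [Matrix.mul_inv_rev, Matrix.mulVec_mulVec, coMat_inv, Matrix.mul_assoc]
  Γ_act b x v i j := by
    have h1 := dMat_mfderiv (f := fun x => act x b) matSmooth_mat (contMDiff_act b x).mdiff v
    have h2 := dMat_mul matSmooth_mat (matSmooth_const (coMat b)) x v
    rw [dMat_const, Matrix.mul_zero, add_zero] at h2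
    have h3 : (x.act b).mat⁻¹ * dMat (𝓡 11) mat (x.act b)
        (mfderiv (𝓡 11) (𝓡 11) (fun x => act x b) x v)
        = coMat b⁻¹ * (x.mat⁻¹ * dMat (𝓡 11) mat x v) * coMat b := by
      refine (congrArg ((x.act b).mat⁻¹ * ·) (h1.symm.trans h2)).trans ?_
      rw [mat_act, Matrix.mul_inv_rev, coMat_inv]
      simp only [Matrix.mul_assoc]
    simp only [gamma_eq']
    rw [of_mcForm]
    exact (mcForm_apply _ _ _ _).trans (congrFun (congrFun h3 i) j)
  Γ_vertical := gamma_vertical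
  dom := dom _ Φ
  ρ := rho _ Φ
  isOpen_dom := isOpen_dom hΦ
  contMDiffOn_ρ x hx := (contMDiffAt_rho hΦ hx).contMDiffWithinAt
  image_dom := by
    refine eq_univ_of_forall fun m => ?_
    obtain ⟨b, hb⟩ := exists_frame (Φ m).1
    let x : Model (paramOpens hΦ) := mk (params Φ m) (mem_range_self m) b
    have h1 : nullRow 1 mat x = nullCov (Φ m).1 := hb
    have h2 : nullPoint 1 base mat x = Φ m := by
      refine Prod.ext ?_ rfl
      change aff (nullRow 1 mat x) = _
      rw [h1, ← one_smul ℝ (nullCov _), aff_smul_nullCov one_ne_zero]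
    have hx : x ∈ dom _ Φ := ⟨by rw [h1]; simp [nullCov], by rw [h2]; exact mem_range_self m⟩
    exact ⟨x, hx, hΦ.isOpenEmbedding.injective ((rho_spec hx).trans h2)⟩
  π_ρ x hx := congrArg Prod.snd (rho_spec hx)
  adapted_plus x hx v := by
    rw [θ_vertical]
    exact adapted_plus_of_nullPoint hΦ contMDiff_base matSmooth_mat isCO_mat hx.1
      (contMDiffAt_rho hΦ hx).mdiff (eventuallyEq_nullPoint hΦ hx) v
  adapted_minus x hx v := by
    rw [adapted_minus_of_nullPoint hΦ contMDiff_base matSmooth_mat isCO_mat (Or.inl rfl) hx.1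
      (contMDiffAt_rho hΦ hx).mdiff (eventuallyEq_nullPoint hΦ hx) v, Ω_one, Ω_two, neg_eq_zero,
      neg_eq_zero]
    rfl
  dom_maximal x m hm h := by
    obtain ⟨h0, h1, -⟩ := nullRow_eq_of_annihilates hΦ (surjective_dmap_base x) (nullRow_ne_zero x) h
    have h2 : nullPoint 1 base mat x = Φ m := Prod.ext h1 hm.symm
    have hx : x ∈ dom _ Φ := ⟨h0, by rw [h2]; exact mem_range_self m⟩
    exact ⟨hx, hΦ.isOpenEmbedding.injective ((rho_spec hx).trans h2)⟩

end Model

end Existence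

/-! ### The conformal frames of a Cartan bundle -/

namespace CartanBundle

variable {M : Type*} [TopologicalSpace M] [ChartedSpace (EuclideanSpace ℝ (Fin 6)) M]
  [IsManifold (𝓡 6) ∞ M] {𝓜 : ParaCR (𝓡 6) M 2 3} {π : M → R4}
  {P : Type*} [TopologicalSpace P] [ChartedSpace (EuclideanSpace ℝ (Fin 11)) P]
  [IsManifold (𝓡 11) ∞ P] (𝓒 : CartanBundle 𝓜 π P)

theorem exists_dual (p : P) (k : Fin 4) : ∃ v, (∀ i, 𝓒.θ i p v = if i = k then 1 else 0) ∧
    (∀ μ, 𝓒.Ω μ p v = 0) ∧ 𝓒.A p v = 0 :=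
  exists_coframe_eq (𝓒.coframe p) (fun i => if i = k then 1 else 0) 0 0

/-- The tangent vectors dual to `θ¹, …, θ⁴` in the coframe. -/
def dual (p : P) (k : Fin 4) : TangentSpace (𝓡 11) p := (𝓒.exists_dual p k).choose

theorem θ_dual (p : P) (k i : Fin 4) : 𝓒.θ i p (𝓒.dual p k) = if i = k then 1 else 0 :=
  (𝓒.exists_dual p k).choose_spec.1 i

theorem Ω_dual (p : P) (k : Fin 4) (μ : Fin 6) : 𝓒.Ω μ p (𝓒.dual p k) = 0 :=
  (𝓒.exists_dual p k).choose_spec.2.1 μ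

/-- The frame of `ℝ⁴` at `q p` that is dual to the forms `θ` at `p`, as a matrix with the vectors of
the frame as columns. -/
def frameMat (p : P) : Matrix (Fin 4) (Fin 4) ℝ :=
  Matrix.of fun l k => dmap (𝓡 11) 𝓒.q p (𝓒.dual p k) l

theorem frameMat_mulVec (p : P) (v : TangentSpace (𝓡 11) p) :
    𝓒.frameMat p *ᵥ (fun i => 𝓒.θ i p v) = dmap (𝓡 11) 𝓒.q p v := by
  have h1 : ∀ i, 𝓒.θ i p (v - ∑ k, 𝓒.θ k p v • 𝓒.dual p k) = 0 := by
    intro i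
    rw [map_sub, map_sum]
    simp [map_smul, θ_dual]
  have h2 := (𝓒.θ_vertical p _).1 h1
  rw [map_sub, map_sum, sub_eq_zero] at h2
  rw [h2]
  ext l
  simp [map_smul, Matrix.mulVec, dotProduct, frameMat, mul_comm, Finset.sum_apply]

theorem exists_θ_eq (p : P) (a : Fin 4 → ℝ) : ∃ v, (fun i => 𝓒.θ i p v) = a := by
  obtain ⟨v, hv, -⟩ := exists_coframe_eq (𝓒.coframe p) a 0 0
  exact ⟨v, funext hv⟩

theorem det_frameMat (p : P) : (𝓒.frameMat p).det ≠ 0 := by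
  intro h
  obtain ⟨a, ha, h0⟩ := Matrix.exists_mulVec_eq_zero_iff.2 h
  obtain ⟨v, rfl⟩ := 𝓒.exists_θ_eq p a
  rw [frameMat_mulVec] at h0
  exact ha (funext ((𝓒.θ_vertical p v).2 h0))

theorem inv_mul_frameMat (p : P) : (𝓒.frameMat p)⁻¹ * 𝓒.frameMat p = 1 :=
  Matrix.nonsing_inv_mul _ (isUnit_iff_ne_zero.2 (𝓒.det_frameMat p))

theorem frameMat_mul_inv (p : P) : 𝓒.frameMat p * (𝓒.frameMat p)⁻¹ = 1 :=
  Matrix.mul_nonsing_inv _ (isUnit_iff_ne_zero.2 (𝓒.det_frameMat p))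

theorem θ_eq_inv_mulVec (p : P) (v : TangentSpace (𝓡 11) p) :
    (fun i => 𝓒.θ i p v) = (𝓒.frameMat p)⁻¹ *ᵥ dmap (𝓡 11) 𝓒.q p v := by
  rw [← frameMat_mulVec, Matrix.mulVec_mulVec, inv_mul_frameMat, Matrix.one_mulVec]

theorem surjective_dmap_q (p : P) : Function.Surjective (dmap (𝓡 11) 𝓒.q p) := by
  intro y
  obtain ⟨v, hv⟩ := 𝓒.exists_θ_eq p ((𝓒.frameMat p)⁻¹ *ᵥ y)
  refine ⟨v, ?_⟩
  rw [← frameMat_mulVec, hv, Matrix.mulVec_mulVec, frameMat_mul_inv, Matrix.one_mulVec]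

theorem matSmooth_inv_frameMat : MatSmooth (𝓡 11) fun p => (𝓒.frameMat p)⁻¹ := by
  intro i
  refine contMDiff_pi_space.1 (contMDiff_of_isSmooth (B := fun p k => (𝓒.frameMat p)⁻¹ i k)
    (𝓒.smooth_θ i) 𝓒.contMDiff_q 𝓒.surjective_dmap_q fun p v => ?_)
  exact congrFun (𝓒.θ_eq_inv_mulVec p v) i

theorem matSmooth_frameMat : MatSmooth (𝓡 11) 𝓒.frameMat := by
  have h := 𝓒.matSmooth_inv_frameMat.inv fun p => by
    have := congrArg Matrix.det (𝓒.inv_mul_frameMat p)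
    rw [Matrix.det_mul, Matrix.det_one] at this
    exact left_ne_zero_of_mul (this.trans_ne one_ne_zero)
  simp only [fun p => Matrix.nonsing_inv_nonsing_inv (𝓒.frameMat p)
    (isUnit_iff_ne_zero.2 (𝓒.det_frameMat p))] at h
  exact h

theorem mdiff_act (p : P) (b : CO22) :
    MDifferentiableAt (𝓡 11) (𝓡 11) (fun p => 𝓒.act p b) p := by
  -- otherwise the derivative is zero, in contradiction to the equivariance of `θ`
  by_contra hn
  have h := fun v i => 𝓒.θ_act b p v i
  rw [mfderiv_zero_of_not_mdifferentiableAt hn] at h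
  obtain ⟨v, hv⟩ := 𝓒.exists_θ_eq p (coMat b *ᵥ Pi.single 0 1)
  have h1 : coMat b⁻¹ *ᵥ (fun i => 𝓒.θ i p v) = 0 := by
    ext i
    refine (h v i).symm.trans ?_
    exact map_zero _
  rw [hv, Matrix.mulVec_mulVec, ← coMat_mul, inv_mul_cancel, coMat_one, Matrix.one_mulVec] at h1
  simpa using congrFun h1 0

theorem dmap_q_act (p : P) (b : CO22) (v : TangentSpace (𝓡 11) p) :
    dmap (𝓡 11) 𝓒.q (𝓒.act p b) (mfderiv (𝓡 11) (𝓡 11) (fun p => 𝓒.act p b) p v)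
      = dmap (𝓡 11) 𝓒.q p v := by
  rw [← dmap_mfderiv (f := fun p => 𝓒.act p b) (𝓒.contMDiff_q _).mdiff (𝓒.mdiff_act p b)]
  simp only [𝓒.q_act]

/-- The frame of `p b` is the frame of `p`, transformed by `b`. -/
theorem frameMat_act (p : P) (b : CO22) : 𝓒.frameMat (𝓒.act p b) = 𝓒.frameMat p * coMat b := by
  have h : 𝓒.frameMat (𝓒.act p b) * coMat b⁻¹ = 𝓒.frameMat p := by
    refine Matrix.ext_of_mulVec_single fun k => ?_
    obtain ⟨v, hv⟩ := 𝓒.exists_θ_eq p (Pi.single k 1)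
    rw [← hv, 𝓒.frameMat_mulVec p v, ← 𝓒.dmap_q_act p b v, ← 𝓒.frameMat_mulVec (𝓒.act p b),
      ← Matrix.mulVec_mulVec]
    congr 1
    ext i
    exact (𝓒.θ_act b p v i).symm
  rw [← h, Matrix.mul_assoc, ← coMat_mul, inv_mul_cancel, coMat_one, Matrix.mul_one]

theorem q_mem_range (p : P) : 𝓒.q p ∈ range π := 𝓒.range_q ▸ mem_range_self p

/-- The group acts transitively on the fibres. -/
theorem exists_act_eq {p p' : P} (h : 𝓒.q p = 𝓒.q p') : ∃ b, 𝓒.act p b = p' := by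
  obtain ⟨W, -, hW, -, t, ht, hb, -⟩ := 𝓒.local_triv _ (𝓒.q_mem_range p)
  refine ⟨(t p)⁻¹ * t p', hb.injOn ?_ ?_ ?_⟩
  · change 𝓒.q _ ∈ W
    rwa [𝓒.q_act]
  · change 𝓒.q p' ∈ W
    rwa [← h]
  · refine Prod.ext ((𝓒.q_act p _).trans h) ?_
    change t (𝓒.act p _) = t p'
    rw [ht p hW, mul_inv_cancel_left]

/-- `ρ` is a submersion: the forms `θ¹, …, θ⁴, Ω₂, Ω₃` vanish on the kernel of its differential. -/
theorem surjective_mfderiv_ρ {p : P} (hp : p ∈ 𝓒.dom) :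
    Function.Surjective (mfderiv (𝓡 11) (𝓡 6) 𝓒.ρ p) := by
  let f' : EuclideanSpace ℝ (Fin 11) →L[ℝ] EuclideanSpace ℝ (Fin 6) :=
    mfderiv (𝓡 11) (𝓡 6) 𝓒.ρ p
  let f : EuclideanSpace ℝ (Fin 11) →ₗ[ℝ] EuclideanSpace ℝ (Fin 6) := f'.toLinearMap
  let g : EuclideanSpace ℝ (Fin 11) →ₗ[ℝ] (Fin 5 → ℝ) := LinearMap.pi fun i =>
    ((![𝓒.Ω 0, 𝓒.Ω 3, 𝓒.Ω 4, 𝓒.Ω 5, 𝓒.A] : Fin 5 → OneForm (𝓡 11) P) i p :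
      EuclideanSpace ℝ (Fin 11) →L[ℝ] ℝ).toLinearMap
  have hinj : Function.Injective (g.domRestrict f.ker) := by
    rw [injective_iff_map_eq_zero]
    rintro ⟨v, hv⟩ hg
    have hv' : mfderiv (𝓡 11) (𝓡 6) 𝓒.ρ p v = 0 := hv
    have h1 := (𝓒.adapted_plus p hp v).1 (by rw [hv']; exact zero_mem _)
    have h2 := (𝓒.adapted_minus p hp v).1 (by rw [hv']; exact zero_mem _)
    refine Subtype.ext (𝓒.coframe p v h1 (fun μ => ?_) (congrFun hg 4))
    fin_cases μ
    exacts [congrFun hg 0, h2.2.1, h2.2.2, congrFun hg 1, congrFun hg 2, congrFun hg 3]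
  have h1 : Module.finrank ℝ f.ker ≤ 5 := by
    simpa using LinearMap.finrank_le_finrank_of_injective hinj
  have h2 := LinearMap.finrank_range_add_finrank_ker f
  have h3 : Module.finrank ℝ (EuclideanSpace ℝ (Fin 11)) = 11 := by simp
  have h4 : Module.finrank ℝ (EuclideanSpace ℝ (Fin 6)) = 6 := by simp
  have h5 := Submodule.finrank_le f.range
  have h6 : f.range = ⊤ := Submodule.eq_top_of_finrank_eq (by omega)
  exact LinearMap.range_eq_top.1 h6

end CartanBundle

/-! ### The conformal class of a Cartan bundle -/

namespace CartanBundle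

variable {M : Type*} [TopologicalSpace M] [ChartedSpace (EuclideanSpace ℝ (Fin 6)) M]
  [IsManifold (𝓡 6) ∞ M] {𝓜 : ParaCR (𝓡 6) M 2 3} {Φ : M → Flat}
  {P : Type*} [TopologicalSpace P] [ChartedSpace (EuclideanSpace ℝ (Fin 11)) P]
  [IsManifold (𝓡 11) ∞ P] (𝓒 : CartanBundle 𝓜 (params Φ) P)

/-- The covector `θ⁴` on `ℝ⁴`. -/
def row (p : P) : R4 := (𝓒.frameMat p)⁻¹ 3

theorem θ_three (p : P) (v : TangentSpace (𝓡 11) p) :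
    𝓒.θ 3 p v = 𝓒.row p ⬝ᵥ dmap (𝓡 11) 𝓒.q p v :=
  congrFun (𝓒.θ_eq_inv_mulVec p v) 3

theorem row_ne_zero (p : P) : 𝓒.row p ≠ 0 := by
  intro h
  have := congrArg Matrix.det (𝓒.inv_mul_frameMat p)
  rw [Matrix.det_mul, Matrix.det_eq_zero_of_row_eq_zero 3 (congrFun h), zero_mul,
    Matrix.det_one] at this
  exact zero_ne_one this

theorem mdiff_ρ {p : P} (hp : p ∈ 𝓒.dom) : MDifferentiableAt (𝓡 11) (𝓡 6) 𝓒.ρ p :=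
  (𝓒.contMDiffOn_ρ.contMDiffAt (𝓒.isOpen_dom.mem_nhds hp)).mdiff

variable (hΦ : IsParaCREmbedding 𝓜 flatParaCR Φ)

include hΦ

theorem row_of_mem_dom {p : P} (hp : p ∈ 𝓒.dom) :
    𝓒.row p 0 ≠ 0 ∧ aff (𝓒.row p) = (Φ (𝓒.ρ p)).1 ∧
    𝓒.row p = 𝓒.row p 0 • nullCov (Φ (𝓒.ρ p)).1 := by
  refine nullRow_eq_of_annihilates hΦ (𝓒.surjective_dmap_q p) (𝓒.row_ne_zero p) fun v w hw h => ?_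
  rw [← θ_three]
  have hq : dmap (𝓡 11) 𝓒.q p v
      = dmap (𝓡 6) (params Φ) (𝓒.ρ p) (mfderiv (𝓡 11) (𝓡 6) 𝓒.ρ p v) := by
    rw [← dmap_mfderiv (hΦ.contMDiff_params _).mdiff (𝓒.mdiff_ρ hp)]
    refine congrArg (fun f : TangentSpace (𝓡 11) p →L[ℝ] R4 => f v) (dmap_congr ?_)
    filter_upwards [𝓒.isOpen_dom.mem_nhds hp] with x hx using (𝓒.π_ρ x hx).symm
  have hv : mfderiv (𝓡 11) (𝓡 6) 𝓒.ρ p v ∈ 𝓜.plus (𝓒.ρ p) ⊔ 𝓜.minus (𝓒.ρ p) := by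
    rw [hΦ.mem_sup_iff, ← hq, h]
    exact hΦ.mem_sup_iff.1 hw
  obtain ⟨u₁, h₁, u₂, h₂, hu⟩ := Submodule.mem_sup.1 hv
  obtain ⟨v₂, rfl⟩ := 𝓒.surjective_mfderiv_ρ hp u₂
  have h3 : mfderiv (𝓡 11) (𝓡 6) 𝓒.ρ p (v - v₂) = u₁ := by
    rw [map_sub, ← hu, add_sub_cancel_right]
  have h4 := (𝓒.adapted_plus p hp _).1 (h3 ▸ h₁) 3
  have h5 := ((𝓒.adapted_minus p hp _).1 h₂).1
  rwa [map_sub, h5, sub_zero] at h4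

end CartanBundle

/-! ### A Cartan bundle consists of conformal frames of the flat metric -/

namespace CartanBundle

variable {M : Type*} [TopologicalSpace M] [ChartedSpace (EuclideanSpace ℝ (Fin 6)) M]
  [IsManifold (𝓡 6) ∞ M] {𝓜 : ParaCR (𝓡 6) M 2 3} {Φ : M → Flat}
  {P : Type*} [TopologicalSpace P] [ChartedSpace (EuclideanSpace ℝ (Fin 11)) P]
  [IsManifold (𝓡 11) ∞ P] (𝓒 : CartanBundle 𝓜 (params Φ) P)

/-- The inverse metric `η^{ij} e_i e_j` on `ℝ⁴` that is defined by the frame of a point. -/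
def frameForm (p : P) : Matrix (Fin 4) (Fin 4) ℝ := 𝓒.frameMat p * eta * (𝓒.frameMat p)ᵀ

theorem frameForm_act (p : P) (b : CO22) :
    𝓒.frameForm (𝓒.act p b) = scale (coMat b) • 𝓒.frameForm p := by
  rw [frameForm, frameMat_act, Matrix.transpose_mul]
  calc 𝓒.frameMat p * coMat b * eta * ((coMat b)ᵀ * (𝓒.frameMat p)ᵀ)
      = 𝓒.frameMat p * (coMat b * eta * (coMat b)ᵀ) * (𝓒.frameMat p)ᵀ := by
        simp only [Matrix.mul_assoc]
    _ = _ := by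
        rw [(isCO_coMat b).conj_transpose, Matrix.mul_smul, Matrix.smul_mul, frameForm]

theorem row_null (p : P) : 𝓒.row p ⬝ᵥ (𝓒.frameForm p *ᵥ 𝓒.row p) = 0 := by
  rw [row, ← mul_conj_apply, frameForm]
  have h : (𝓒.frameMat p)⁻¹ * (𝓒.frameMat p * eta * (𝓒.frameMat p)ᵀ) * ((𝓒.frameMat p)⁻¹)ᵀ
      = eta := by
    have h1 : (𝓒.frameMat p)ᵀ * ((𝓒.frameMat p)⁻¹)ᵀ = 1 := by
      rw [← Matrix.transpose_mul, inv_mul_frameMat, Matrix.transpose_one]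
    calc _ = ((𝓒.frameMat p)⁻¹ * 𝓒.frameMat p) * eta
          * ((𝓒.frameMat p)ᵀ * ((𝓒.frameMat p)⁻¹)ᵀ) := by simp only [Matrix.mul_assoc]
      _ = eta := by rw [h1, inv_mul_frameMat, Matrix.one_mul, Matrix.mul_one]
  rw [h]
  simp [eta]

theorem frameForm_transpose (p : P) : (𝓒.frameForm p)ᵀ = 𝓒.frameForm p := by
  rw [frameForm, Matrix.transpose_mul, Matrix.transpose_mul, Matrix.transpose_transpose,
    eta_transpose, Matrix.mul_assoc]

/-- Every point of `M` over `q p` is the image of a point of the fibre of `p`. -/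
theorem exists_act_mem_dom {p : P} {m : M} (h : params Φ m = 𝓒.q p) :
    ∃ b, 𝓒.act p b ∈ 𝓒.dom ∧ 𝓒.ρ (𝓒.act p b) = m := by
  obtain ⟨p', hp', rfl⟩ : m ∈ 𝓒.ρ '' 𝓒.dom := 𝓒.image_dom ▸ mem_univ m
  obtain ⟨b, rfl⟩ := 𝓒.exists_act_eq (h.symm.trans (𝓒.π_ρ p' hp'))
  exact ⟨b, hp', rfl⟩

section Embedding

variable (hΦ : IsParaCREmbedding 𝓜 flatParaCR Φ)

include hΦ

/-- The covectors `(1, x, y, xy)` of the points of a fibre are null for the inverse metric of a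
frame, which is therefore a multiple of `g₀`. -/
theorem frameForm_eq (p : P) : 𝓒.frameForm p = 𝓒.frameForm p 0 3 • g0mat := by
  obtain ⟨U, hU, hne, hm⟩ := hΦ.exists_isOpen_fibre (𝓒.q_mem_range p)
  refine eq_smul_g0mat (𝓒.frameForm_transpose p) hU hne fun w hw => ?_
  obtain ⟨m, hm⟩ := hm w hw
  obtain ⟨b, hb, hρ⟩ := 𝓒.exists_act_mem_dom (p := p) (m := m) (by rw [params, hm])
  obtain ⟨h0, -, h1⟩ := 𝓒.row_of_mem_dom hΦ hb
  have h2 := 𝓒.row_null (𝓒.act p b)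
  rw [h1, hρ, hm, frameForm_act] at h2
  have hs := (isCO_coMat b).scale_pos.ne'
  simpa [Matrix.mulVec_smul, Matrix.smul_mulVec, h0, hs] using h2

theorem frameForm_ne_zero (p : P) : 𝓒.frameForm p 0 3 ≠ 0 := by
  intro h
  have h1 := 𝓒.frameForm_eq hΦ p
  rw [h, zero_smul] at h1
  have h2 := congrArg Matrix.det h1
  have h3 := congrArg Matrix.det eta_mul_eta
  rw [Matrix.det_mul, Matrix.det_one] at h3
  rw [frameForm, Matrix.det_mul, Matrix.det_mul, Matrix.det_transpose, Matrix.det_zero] at h2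
  exact mul_ne_zero (mul_ne_zero (𝓒.det_frameMat p) (left_ne_zero_of_mul (h3.trans_ne one_ne_zero)))
    (𝓒.det_frameMat p) h2

omit hΦ in
theorem continuous_frameForm : Continuous fun p => 𝓒.frameForm p 0 3 :=
  (((𝓒.matSmooth_frameMat.mul (matSmooth_const eta)).mul
    𝓒.matSmooth_frameMat.transpose) 0 3).continuous

/-- The factor between the metric of a frame and `g₀` has a constant sign, as the action of
`CO(2,2)` preserves the sign and `M` is connected. -/
theorem exists_sign [ConnectedSpace M] :
    ∃ ε : ℝ, (ε = 1 ∨ ε = -1) ∧ ∀ p, 0 < 𝓒.frameForm p 0 3 * ε := by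
  have hq := isOpenMap_of_surjective_dmap 𝓒.contMDiff_q 𝓒.surjective_dmap_q
  have hc := 𝓒.continuous_frameForm
  have hpre : IsPreconnected (range (params Φ)) :=
    isPreconnected_range (hΦ.contMDiff_params).continuous
  have key : ¬ ∃ p p', 𝓒.frameForm p 0 3 < 0 ∧ 0 < 𝓒.frameForm p' 0 3 := by
    rintro ⟨p, p', hp, hp'⟩
    obtain ⟨s, -, ⟨p₁, h₁, rfl⟩, p₂, h₂, h⟩ :=
      hpre _ _ (hq _ (isOpen_lt hc continuous_const)) (hq _ (isOpen_lt continuous_const hc))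
        (by
          rw [← 𝓒.range_q]
          rintro _ ⟨x, rfl⟩
          rcases lt_or_gt_of_ne (𝓒.frameForm_ne_zero hΦ x) with h | h
          exacts [Or.inl ⟨x, h, rfl⟩, Or.inr ⟨x, h, rfl⟩])
        ⟨_, 𝓒.q_mem_range p, p, hp, rfl⟩ ⟨_, 𝓒.q_mem_range p', p', hp', rfl⟩
    obtain ⟨b, rfl⟩ := 𝓒.exists_act_eq h
    have h1 : 𝓒.frameForm (𝓒.act p₂ b) 0 3 < 0 := h₁
    rw [frameForm_act] at h1
    exact absurd h1 (not_lt.2 (mul_pos (isCO_coMat b).scale_pos h₂).le)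
  by_cases h : ∃ p, 𝓒.frameForm p 0 3 < 0
  · obtain ⟨p, hp⟩ := h
    refine ⟨-1, Or.inr rfl, fun p' => ?_⟩
    have := lt_of_le_of_ne (not_lt.1 fun h => key ⟨p, p', hp, h⟩) (𝓒.frameForm_ne_zero hΦ p')
    linarith
  · refine ⟨1, Or.inl rfl, fun p' => ?_⟩
    rw [mul_one]
    exact lt_of_le_of_ne (not_lt.1 fun h' => h ⟨p', h'⟩) (𝓒.frameForm_ne_zero hΦ p').symm

end Embedding

/-- `b : P → CO(2,2)` exhibits the points of a Cartan bundle as frames of `ℝ⁴` that are conformal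
for `ε g₀`, with the forms `(θ, Γ)` equal to `(b⁻¹ L dq, b⁻¹ db)`, where `L = modelMat ε`. -/
structure IsFrameMap (ε : ℝ) (b : P → Matrix (Fin 4) (Fin 4) ℝ) : Prop where
  sign : ε = 1 ∨ ε = -1
  smooth : MatSmooth (𝓡 11) b
  co : ∀ p, IsCO (b p)
  act : ∀ p g, b (𝓒.act p g) = b p * coMat g
  θ_eq : ∀ p v, (fun i => 𝓒.θ i p v) = ((b p)⁻¹ * modelMat ε) *ᵥ dmap (𝓡 11) 𝓒.q p v
  Γ_eq : ∀ p v, gammaMat 𝓒.Ω 𝓒.A p v = (b p)⁻¹ * dMat (𝓡 11) b p v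

section Torsion

variable {𝓒} {ε : ℝ} {b : P → Matrix (Fin 4) (Fin 4) ℝ} (hε : ε = 1 ∨ ε = -1)
  (hb : MatSmooth (𝓡 11) b) (hco : ∀ p, IsCO (b p)) (hact : ∀ p g, b (𝓒.act p g) = b p * coMat g)
  (hθ : ∀ p v, (fun i => 𝓒.θ i p v) = ((b p)⁻¹ * modelMat ε) *ᵥ dmap (𝓡 11) 𝓒.q p v)

variable (𝓒) in
/-- The difference of `Γ` and the Maurer–Cartan form `b⁻¹ db`. -/
def defect (b : P → Matrix (Fin 4) (Fin 4) ℝ) (p : P) (v : TangentSpace (𝓡 11) p) :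
    Matrix (Fin 4) (Fin 4) ℝ := gammaMat 𝓒.Ω 𝓒.A p v - (b p)⁻¹ * dMat (𝓡 11) b p v

variable (𝓒) in
/-- The trace part of `defect`. -/
def defectTrace (b : P → Matrix (Fin 4) (Fin 4) ℝ) (p : P) : TangentSpace (𝓡 11) p →L[ℝ] ℝ :=
  𝓒.A p - (scale (b p))⁻¹ • dmap (𝓡 11) (fun p => scale (b p)) p

include hb hco in
theorem defect_conformal (p : P) (v : TangentSpace (𝓡 11) p) :
    (𝓒.defect b p v)ᵀ * eta + eta * 𝓒.defect b p v = 𝓒.defectTrace b p v • eta := by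
  have h1 := gammaMat_conformal 𝓒.Ω 𝓒.A p v
  have h2 := mcForm_conformal hb hco p v
  have h3 : 𝓒.defectTrace b p v
      = 𝓒.A p v - (scale (b p))⁻¹ * dmap (𝓡 11) (fun p => scale (b p)) p v := rfl
  rw [h3, sub_smul, ← h1, ← h2, defect, Matrix.transpose_sub, Matrix.sub_mul, Matrix.mul_sub]
  abel

include hb hco hθ in
theorem defect_wedge (p : P) (u v : TangentSpace (𝓡 11) p) (i : Fin 4) :
    ∑ j, (𝓒.defect b p u i j * 𝓒.θ j p v - 𝓒.defect b p v i j * 𝓒.θ j p u) = 0 := by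
  have h1 := 𝓒.dθ_eq i p u v
  have h2 := (solder_d hb (fun p => (hco p).det_ne_zero) (modelMat ε) 𝓒.contMDiff_q
    (fun i p v => congrFun (hθ p v) i) i p u v).2
  have h3 := h1.trans h2.symm
  rw [add_right_inj, ← sub_eq_zero, ← Finset.sum_sub_distrib] at h3
  rw [← h3]
  refine Finset.sum_congr rfl fun j _ => ?_
  have e : ∀ w, 𝓒.defect b p w i j = gamma 𝓒.Ω 𝓒.A i j p w - mcForm (𝓡 11) b i j p w := by
    intro w
    rw [mcForm_apply]
    rfl
  rw [e, e, OneForm.wedge, OneForm.wedge]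
  ring

include hb hco hθ in
/-- The difference of `Γ` and `b⁻¹ db` is determined by its trace. -/
theorem defectTrace_dual (p : P) (i j l : Fin 4) :
    2 * 𝓒.defect b p (𝓒.dual p l) (dualIdx i) j = 𝓒.defectTrace b p (𝓒.dual p l) * eta i j
      + 𝓒.defectTrace b p (𝓒.dual p j) * eta l i - 𝓒.defectTrace b p (𝓒.dual p i) * eta j l :=
  (torsionFree_form (V := TangentSpace (𝓡 11) p) (θ := fun v j => 𝓒.θ j p v)
    (𝓒.θ_dual p) (𝓒.defect_wedge hb hco hθ p) (defect_conformal hb hco p)).2 i j l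

end Torsion

end CartanBundle

/-! ### The connection of a Cartan bundle is flat -/

namespace CartanBundle

variable {M : Type*} [TopologicalSpace M] [ChartedSpace (EuclideanSpace ℝ (Fin 6)) M]
  [IsManifold (𝓡 6) ∞ M] {𝓜 : ParaCR (𝓡 6) M 2 3} {Φ : M → Flat}
  {P : Type*} [TopologicalSpace P] [ChartedSpace (EuclideanSpace ℝ (Fin 11)) P]
  [IsManifold (𝓡 11) ∞ P] {𝓒 : CartanBundle 𝓜 (params Φ) P}
  {ε : ℝ} {b : P → Matrix (Fin 4) (Fin 4) ℝ}

section

variable (hθ : ∀ p v, (fun i => 𝓒.θ i p v) = ((b p)⁻¹ * modelMat ε) *ᵥ dmap (𝓡 11) 𝓒.q p v)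

include hθ

theorem inv_frameMat_eq (p : P) : (𝓒.frameMat p)⁻¹ = (b p)⁻¹ * modelMat ε := by
  refine Matrix.ext_of_mulVec_single fun k => ?_
  obtain ⟨v, hv⟩ := 𝓒.surjective_dmap_q p (Pi.single k 1)
  rw [← hv, ← θ_eq_inv_mulVec, hθ]

theorem nullRow_eq_row (p : P) : nullRow ε b p = 𝓒.row p := by
  rw [nullRow, row, inv_frameMat_eq hθ]

theorem comp_ρ_eq_nullPoint (hΦ : IsParaCREmbedding 𝓜 flatParaCR Φ) {p : P} (hp : p ∈ 𝓒.dom) :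
    Φ (𝓒.ρ p) = nullPoint ε 𝓒.q b p := by
  refine Prod.ext ?_ (𝓒.π_ρ p hp)
  rw [nullPoint, nullRow_eq_row hθ, (𝓒.row_of_mem_dom hΦ hp).2.1]

end

section

variable (hε : ε = 1 ∨ ε = -1) (hb : MatSmooth (𝓡 11) b) (hco : ∀ p, IsCO (b p))
  (hact : ∀ p g, b (𝓒.act p g) = b p * coMat g)
  (hθ : ∀ p v, (fun i => 𝓒.θ i p v) = ((b p)⁻¹ * modelMat ε) *ᵥ dmap (𝓡 11) 𝓒.q p v)

include hε hb hco hθ in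
/-- The forms `θ⁴, Ω₂, Ω₃` define `H⁻`, as do the forms `θ⁴` and `(b⁻¹ db)⁴₁, (b⁻¹ db)⁴₂`; hence
one component of the trace of `Γ - b⁻¹ db` vanishes. -/
theorem defectTrace_dual_two (hΦ : IsParaCREmbedding 𝓜 flatParaCR Φ) {p : P} (hp : p ∈ 𝓒.dom) :
    𝓒.defectTrace b p (𝓒.dual p 2) = 0 := by
  have h1 : mfderiv (𝓡 11) (𝓡 6) 𝓒.ρ p (𝓒.dual p 0) ∈ 𝓜.minus (𝓒.ρ p) :=
    (𝓒.adapted_minus p hp _).2 ⟨(𝓒.θ_dual p 0 3).trans (by simp), 𝓒.Ω_dual p 0 1, 𝓒.Ω_dual p 0 2⟩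
  have h0 : nullRow ε b p 0 ≠ 0 := by
    rw [nullRow_eq_row hθ]
    exact (𝓒.row_of_mem_dom hΦ hp).1
  have h2 : (fun p => Φ (𝓒.ρ p)) =ᶠ[𝓝 p] nullPoint ε 𝓒.q b := by
    filter_upwards [𝓒.isOpen_dom.mem_nhds hp] with x hx using comp_ρ_eq_nullPoint hθ hΦ hx
  have h3 := ((adapted_minus_of_nullPoint hΦ 𝓒.contMDiff_q hb hco hε h0 (𝓒.mdiff_ρ hp) h2 _).1
    h1).2.2
  have h4 : gamma 𝓒.Ω 𝓒.A 3 1 p (𝓒.dual p 0) = 0 := by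
    rw [gamma_apply, Matrix.add_apply, skewMat_apply]
    simp [Ω_dual]
  have h5 : 𝓒.defect b p (𝓒.dual p 0) 3 1 = 0 := by
    rw [mcForm_apply] at h3
    exact (congrArg₂ (· - ·) h4 h3).trans (sub_zero 0)
  have h6 := defectTrace_dual hb hco hθ p 2 1 0
  have h7 : dualIdx 2 = 3 := rfl
  rw [h7, h5] at h6
  simpa [eta] using h6

include hb hco in
theorem trace_defect (p : P) (v : TangentSpace (𝓡 11) p) :
    (𝓒.defect b p v).trace = 2 * 𝓒.defectTrace b p v := by
  have h := congrArg (fun X => (eta * X).trace) (defect_conformal (𝓒 := 𝓒) hb hco p v)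
  have h1 : (eta * (𝓒.defect b p v)ᵀ * eta).trace = (𝓒.defect b p v).trace := by
    rw [Matrix.mul_assoc, Matrix.trace_mul_comm, Matrix.mul_assoc, eta_mul_eta, Matrix.mul_one, Matrix.trace_transpose]
  simp only [Matrix.mul_add, Matrix.trace_add, ← Matrix.mul_assoc, eta_mul_eta, Matrix.one_mul,
    Matrix.mul_smul, Matrix.trace_smul, Matrix.trace_one, Fintype.card_fin, smul_eq_mul, h1] at h
  push_cast at h
  linarith

include hb hact in
theorem defect_act (p : P) (g : CO22) (v : TangentSpace (𝓡 11) p) :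
    𝓒.defect b (𝓒.act p g) (mfderiv (𝓡 11) (𝓡 11) (fun p => 𝓒.act p g) p v)
      = coMat g⁻¹ * 𝓒.defect b p v * coMat g := by
  have h1 := dMat_mfderiv (f := fun p => 𝓒.act p g) hb (𝓒.mdiff_act p g) v
  have h2 := dMat_mul hb (matSmooth_const (coMat g)) p v
  rw [dMat_const, Matrix.mul_zero, add_zero] at h2
  simp only [hact] at h1
  have h3 : gammaMat 𝓒.Ω 𝓒.A (𝓒.act p g) (mfderiv (𝓡 11) (𝓡 11) (fun p => 𝓒.act p g) p v)
      = coMat g⁻¹ * gammaMat 𝓒.Ω 𝓒.A p v * coMat g := by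
    ext i j
    exact 𝓒.Γ_act g p v i j
  rw [defect, h3, ← h1, h2, hact, Matrix.mul_inv_rev, ← coMat_inv, defect, Matrix.mul_sub,
    Matrix.sub_mul]
  simp only [Matrix.mul_assoc]

include hb hco hact in
theorem defectTrace_act (p : P) (g : CO22) (v : TangentSpace (𝓡 11) p) :
    𝓒.defectTrace b (𝓒.act p g) (mfderiv (𝓡 11) (𝓡 11) (fun p => 𝓒.act p g) p v)
      = 𝓒.defectTrace b p v := by
  have h := congrArg Matrix.trace (defect_act hb hact p g v)
  rw [Matrix.trace_mul_comm, ← Matrix.mul_assoc, ← coMat_mul, mul_inv_cancel, coMat_one,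
    Matrix.one_mul, trace_defect hb hco, trace_defect hb hco] at h
  linarith

include hb hco hθ in
theorem defect_eq_sum (p : P) (u : TangentSpace (𝓡 11) p) (i j : Fin 4) :
    𝓒.defect b p u i j = ∑ l, 𝓒.defect b p (𝓒.dual p j) i l * 𝓒.θ l p u :=
  (torsionFree_form (V := TangentSpace (𝓡 11) p) (θ := fun v j => 𝓒.θ j p v)
    (𝓒.θ_dual p) (𝓒.defect_wedge hb hco hθ p) (defect_conformal hb hco p)).1 i j u

variable (𝓒 b) in
/-- The covector on `ℝ⁴` that represents the semibasic form `defectTrace`. -/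
def traceCov (p : P) : R4 :=
  (fun l => 𝓒.defectTrace b p (𝓒.dual p l)) ᵥ* (𝓒.frameMat p)⁻¹

include hb hco hθ in
theorem defectTrace_eq (p : P) (v : TangentSpace (𝓡 11) p) :
    𝓒.defectTrace b p v = 𝓒.traceCov b p ⬝ᵥ dmap (𝓡 11) 𝓒.q p v := by
  have h1 : 𝓒.defectTrace b p (v - ∑ k, 𝓒.θ k p v • 𝓒.dual p k) = 0 := by
    have h2 : ∀ i, 𝓒.θ i p (v - ∑ k, 𝓒.θ k p v • 𝓒.dual p k) = 0 := by
      intro i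
      rw [map_sub, map_sum]
      simp [map_smul, θ_dual]
    have h3 := trace_defect (𝓒 := 𝓒) hb hco p (v - ∑ k, 𝓒.θ k p v • 𝓒.dual p k)
    have h4 : 𝓒.defect b p (v - ∑ k, 𝓒.θ k p v • 𝓒.dual p k) = 0 := by
      ext i j
      rw [defect_eq_sum hb hco hθ]
      exact Finset.sum_eq_zero fun l _ => by rw [h2, mul_zero]
    rw [h4, Matrix.trace_zero] at h3
    linarith
  rw [map_sub, map_sum, sub_eq_zero] at h1
  rw [h1, traceCov, ← Matrix.dotProduct_mulVec, ← θ_eq_inv_mulVec]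
  simp [map_smul, dotProduct, mul_comm]

include hb hco hθ hact in
theorem traceCov_act (p : P) (g : CO22) : 𝓒.traceCov b (𝓒.act p g) = 𝓒.traceCov b p := by
  refine dotProduct_eq _ _ fun y => ?_
  obtain ⟨v, rfl⟩ := 𝓒.surjective_dmap_q p y
  rw [← defectTrace_eq hb hco hθ, ← defectTrace_act hb hco hact p g v, ← 𝓒.dmap_q_act p g v,
    ← defectTrace_eq hb hco hθ]

theorem traceCov_vecMul_frameMat (p : P) (l : Fin 4) :
    (𝓒.traceCov b p ᵥ* 𝓒.frameMat p) l = 𝓒.defectTrace b p (𝓒.dual p l) := by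
  rw [traceCov, Matrix.vecMul_vecMul, inv_mul_frameMat, Matrix.vecMul_one]

/-- The third vector of a frame is a multiple of the null vector that is dual to `θ⁴`. -/
theorem frameMat_two (hΦ : IsParaCREmbedding 𝓜 flatParaCR Φ) (p : P) (i : Fin 4) :
    𝓒.frameMat p i 2 = 𝓒.frameForm p 0 3 * (g0mat *ᵥ 𝓒.row p) i := by
  have h1 : 𝓒.frameMat p * eta = 𝓒.frameForm p 0 3 • (g0mat * ((𝓒.frameMat p)⁻¹)ᵀ) := by
    rw [← Matrix.smul_mul, ← 𝓒.frameForm_eq hΦ, frameForm, Matrix.mul_assoc,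
      ← Matrix.transpose_mul, inv_mul_frameMat, Matrix.transpose_one, Matrix.mul_one]
  have h2 := congrFun (congrFun h1 i) 3
  rw [mul_eta_apply] at h2
  exact h2

include hε hb hco hact hθ in
theorem traceCov_eq_zero (hΦ : IsParaCREmbedding 𝓜 flatParaCR Φ) (p : P) :
    𝓒.traceCov b p = 0 := by
  obtain ⟨U, hU, hne, hm⟩ := hΦ.exists_isOpen_fibre (𝓒.q_mem_range p)
  refine covector_eq_zero hU hne fun w hw => ?_
  obtain ⟨m, hm⟩ := hm w hw
  obtain ⟨g, hg, hρ⟩ := 𝓒.exists_act_mem_dom (p := p) (m := m) (by rw [params, hm])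
  obtain ⟨h0, -, h1⟩ := 𝓒.row_of_mem_dom hΦ hg
  have h2 := (traceCov_vecMul_frameMat (b := b) _ _).trans
    (defectTrace_dual_two hε hb hco hθ hΦ hg)
  rw [Matrix.vecMul, traceCov_act hb hco hact hθ] at h2
  have h3 : (fun i => 𝓒.frameMat (𝓒.act p g) i 2)
      = (𝓒.frameForm (𝓒.act p g) 0 3 * 𝓒.row (𝓒.act p g) 0) • (g0mat *ᵥ nullCov w) := by
    ext i
    rw [𝓒.frameMat_two hΦ, h1, hρ, hm, Matrix.mulVec_smul]
    simp [nullCov, mul_assoc]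
  rw [h3, dotProduct_smul, smul_eq_mul] at h2
  exact (mul_eq_zero.1 h2).resolve_left (mul_ne_zero (𝓒.frameForm_ne_zero hΦ _) h0)

include hε hb hco hact hθ in
/-- `Γ` is the Maurer–Cartan form: the trace of `Γ - b⁻¹ db` vanishes, and this torsion-free
`𝔠𝔬(2,2)`-valued form is determined by its trace. -/
theorem defect_eq_zero (hΦ : IsParaCREmbedding 𝓜 flatParaCR Φ) (p : P)
    (v : TangentSpace (𝓡 11) p) : 𝓒.defect b p v = 0 := by
  have h1 : ∀ l, 𝓒.defectTrace b p (𝓒.dual p l) = 0 := fun l => by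
    rw [defectTrace_eq hb hco hθ, traceCov_eq_zero hε hb hco hact hθ hΦ, zero_dotProduct]
  have h2 : ∀ l i j, 𝓒.defect b p (𝓒.dual p l) i j = 0 := fun l i j => by
    have h3 := defectTrace_dual hb hco hθ p (dualIdx i) j l
    rw [h1, h1, h1, dualIdx_dualIdx] at h3
    linarith
  ext i j
  rw [defect_eq_sum hb hco hθ]
  exact Finset.sum_eq_zero fun l _ => by rw [h2, zero_mul]

end

variable (𝓒) in
theorem exists_isFrameMap [ConnectedSpace M] (hΦ : IsParaCREmbedding 𝓜 flatParaCR Φ) :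
    ∃ ε b, 𝓒.IsFrameMap ε b := by
  obtain ⟨ε, hε, hpos⟩ := 𝓒.exists_sign hΦ
  have hd := modelMat_transpose_mul hε
  let b : P → Matrix (Fin 4) (Fin 4) ℝ := fun p => modelMat ε * 𝓒.frameMat p
  have hb : MatSmooth (𝓡 11) b := (matSmooth_const _).mul 𝓒.matSmooth_frameMat
  have hco : ∀ p, IsCO (b p) := fun p => by
    refine isCO_modelMat_mul (hpos p) hε ((𝓒.frameForm_eq hΦ p).trans ?_)
    have hs : ε * ε = 1 := by rcases hε with rfl | rfl <;> norm_num
    rw [mul_assoc, hs, mul_one]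
  have hact : ∀ p g, b (𝓒.act p g) = b p * coMat g := fun p g => by
    change modelMat ε * 𝓒.frameMat (𝓒.act p g) = modelMat ε * 𝓒.frameMat p * coMat g
    rw [frameMat_act, Matrix.mul_assoc]
  have hθ : ∀ p v, (fun i => 𝓒.θ i p v)
      = ((b p)⁻¹ * modelMat ε) *ᵥ dmap (𝓡 11) 𝓒.q p v := fun p v => by
    rw [θ_eq_inv_mulVec, Matrix.mul_inv_rev, Matrix.mul_assoc, Matrix.nonsing_inv_mul, Matrix.mul_one]
    have := congrArg Matrix.det hd
    rw [Matrix.det_mul, Matrix.det_one] at this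
    exact isUnit_iff_ne_zero.2 (right_ne_zero_of_mul (this.trans_ne one_ne_zero))
  exact ⟨ε, b, hε, hb, hco, hact, hθ, fun p v =>
    sub_eq_zero.1 (defect_eq_zero hε hb hco hact hθ hΦ p v)⟩

end CartanBundle

/-! ### The identification with the affine homothetic group -/

theorem tendsto_of_isInducing_domRestrict {X Y Z : Type*} [TopologicalSpace X]
    [TopologicalSpace Y] {U : Set X} (hU : IsOpen U) {f : X → Y}
    (hf : IsInducing (U.domRestrict f)) {x₀ : X} (h0 : x₀ ∈ U) {l : Filter Z} {y : Z → X}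
    (hy : ∀ᶠ z in l, y z ∈ U) (h : Tendsto (fun z => f (y z)) l (𝓝 (f x₀))) :
    Tendsto y l (𝓝 x₀) := by
  intro N hN
  rw [← map_nhds_subtype_coe_eq_nhds h0 (hU.mem_nhds h0)] at hN
  have h1 : Subtype.val ⁻¹' N ∈ 𝓝 (⟨x₀, h0⟩ : U) := hN
  rw [hf.nhds_eq_comap] at h1
  obtain ⟨O, hO, hON⟩ := h1
  refine mem_map.2 ?_
  filter_upwards [hy, mem_map.1 (h hO)] with z hz hz'
  exact @hON ⟨y z, hz⟩ hz'

namespace CartanBundle.IsFrameMap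

variable {M : Type*} [TopologicalSpace M] [ChartedSpace (EuclideanSpace ℝ (Fin 6)) M]
  [IsManifold (𝓡 6) ∞ M] {𝓜 : ParaCR (𝓡 6) M 2 3} {Φ : M → Flat}
  {P : Type*} [TopologicalSpace P] [ChartedSpace (EuclideanSpace ℝ (Fin 11)) P]
  [IsManifold (𝓡 11) ∞ P] {𝓒 : CartanBundle 𝓜 (params Φ) P}
  {ε : ℝ} {b : P → Matrix (Fin 4) (Fin 4) ℝ} (h : 𝓒.IsFrameMap ε b)

include h

theorem act_free {p : P} {g : CO22} (hg : b (𝓒.act p g) = b p) : g = 1 := by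
  rw [h.act] at hg
  refine coMat_injective ?_
  rw [coMat_one, ← Matrix.one_mul (coMat g), ← (h.co p).inv_mul, Matrix.mul_assoc, hg]

theorem point_ext {p p' : P} (h1 : 𝓒.q p = 𝓒.q p') (h2 : b p = b p') : p = p' := by
  obtain ⟨g, rfl⟩ := 𝓒.exists_act_eq h1
  rw [h.act_free h2.symm, 𝓒.act_one]

theorem exists_point {s : R4} (hs : s ∈ range (params Φ)) {B : Matrix (Fin 4) (Fin 4) ℝ}
    (hB : IsCO B) : ∃ p, 𝓒.q p = s ∧ b p = B := by
  rw [← 𝓒.range_q] at hs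
  obtain ⟨p, rfl⟩ := hs
  refine ⟨𝓒.act p ((h.co p).inv.mul hB).toCO, 𝓒.q_act _ _, ?_⟩
  rw [h.act, IsCO.coMat_toCO, ← Matrix.mul_assoc, (h.co p).mul_inv, Matrix.one_mul]

omit h in
variable (𝓒 b) in
/-- The map `P → ℝ⁴ × ℝ^(4×4)` with the components `q` and `b`. -/
def coords (p : P) : Amb := (𝓒.q p, fun i j => b p i j)

theorem contMDiff_coords : ContMDiff (𝓡 11) 𝓘(ℝ, Amb) ∞ (coords 𝓒 b) :=
  𝓒.contMDiff_q.prodMk_space (matSmooth_iff.1 h.smooth)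

theorem eq_zero_of_dmap {p : P} {v : TangentSpace (𝓡 11) p} (h1 : dmap (𝓡 11) 𝓒.q p v = 0)
    (h2 : dMat (𝓡 11) b p v = 0) : v = 0 := by
  have h3 : gammaMat 𝓒.Ω 𝓒.A p v = 0 := by rw [h.Γ_eq, h2, Matrix.mul_zero]
  have h4 : 𝓒.A p v = 0 := by
    refine smul_eta_inj (d := 0) ?_
    rw [← gammaMat_conformal 𝓒.Ω 𝓒.A p v, h3]
    simp
  refine 𝓒.coframe p v ((𝓒.θ_vertical p v).2 h1) (fun μ => ?_) h4
  have h5 : ∀ i j, skewMat (fun μ => 𝓒.Ω μ p v) i j = 0 := by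
    rw [gammaMat_eq, h4, zero_div, zero_smul, add_zero] at h3
    exact fun i j => congrFun (congrFun h3 i) j
  simp only [skewMat_apply] at h5
  fin_cases μ
  exacts [by simpa using h5 1 1, by simpa using h5 1 2, by simpa using h5 0 2,
    by simpa using h5 1 3, by simpa using h5 0 3, by simpa using h5 3 3]

theorem injective_dmap_coords (p : P) : Function.Injective (dmap (𝓡 11) (coords 𝓒 b) p) := by
  refine (injective_iff_map_eq_zero _).2 fun v hv => ?_
  have hd := (h.contMDiff_coords p).mdiff
  refine h.eq_zero_of_dmap ((dmap_fst hd v).trans (congrArg Prod.fst hv)) ?_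
  ext i j
  have hd2 := matSmooth_iff.1 h.smooth
  have h3 := congrFun (congrFun ((dmap_snd hd v).trans (congrArg Prod.snd hv)) i) j
  exact ((dmap_apply ((contMDiff_pi_space.1 hd2 i) p).mdiff j v).trans
    (congrFun (dmap_apply (hd2 p).mdiff i v) j)).trans h3

/-- In a local trivialization `(q, t)`, the frame map is `b(p) = b(p*) t(p)`, where `p* = p t(p)⁻¹`
is the point of the section `t = 1` over `q p`; so `(q, t)` is a continuous function of `(q, b)`. -/
theorem isEmbedding_coords : IsEmbedding (coords 𝓒 b) := by
  refine ⟨isInducing_iff_nhds.2 fun p => le_antisymm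
    h.contMDiff_coords.continuous.continuousAt.le_comap ?_, fun p p' hp => ?_⟩
  swap
  · exact h.point_ext (congrArg Prod.fst hp) (congrArg Prod.snd hp)
  obtain ⟨W, hWo, hW, -, t, ht, -, -, -, hemb⟩ := 𝓒.local_triv _ (𝓒.q_mem_range p)
  have hU : IsOpen (𝓒.q ⁻¹' W) := hWo.preimage 𝓒.contMDiff_q.continuous
  set l := comap (coords 𝓒 b) (𝓝 (coords 𝓒 b p)) with hl
  have hS : Tendsto (coords 𝓒 b) l (𝓝 (coords 𝓒 b p)) := tendsto_comap
  have hq : Tendsto 𝓒.q l (𝓝 (𝓒.q p)) := (continuous_fst.tendsto _).comp hS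
  have hb : ∀ i j, Tendsto (fun x => b x i j) l (𝓝 (b p i j)) := fun i j =>
    ((by fun_prop : Continuous fun x : Amb => x.2 i j).tendsto _).comp hS
  have hW' : ∀ᶠ x in l, 𝓒.q x ∈ W := hq (hWo.mem_nhds hW)
  have ht1 : ∀ x, 𝓒.q x ∈ W → t (𝓒.act x (t x)⁻¹) = 1 := fun x hx => by
    rw [ht x hx, mul_inv_cancel]
  -- the points of the section converge
  have h1 : Tendsto (fun x => 𝓒.act x (t x)⁻¹) l (𝓝 (𝓒.act p (t p)⁻¹)) := by
    refine tendsto_of_isInducing_domRestrict hU hemb.isInducing ?_ ?_ ?_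
    · change 𝓒.q _ ∈ W
      rwa [𝓒.q_act]
    · filter_upwards [hW'] with x hx
      change 𝓒.q _ ∈ W
      rwa [𝓒.q_act]
    · have h2 : Tendsto (fun x => (𝓒.q x, coEntries 1)) l (𝓝 (𝓒.q p, coEntries 1)) :=
        hq.prodMk_nhds tendsto_const_nhds
      rw [← ht1 p hW, ← 𝓒.q_act p (t p)⁻¹] at h2
      refine h2.congr' ?_
      filter_upwards [hW'] with x hx
      rw [ht1 p hW, ht1 x hx, 𝓒.q_act]
  have h2 : ∀ x, coMat (t x) = (b (𝓒.act x (t x)⁻¹))⁻¹ * b x := fun x => by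
    rw [h.act, Matrix.mul_inv_rev, Matrix.mul_assoc, (h.co x).inv_mul, Matrix.mul_one, coMat_inv,
      Matrix.nonsing_inv_nonsing_inv _ (isCO_coMat _).isUnit_det]
  have h3 : ∀ i j, Tendsto (fun x => coMat (t x) i j) l (𝓝 (coMat (t p) i j)) := fun i j => by
    simp only [h2, Matrix.mul_apply]
    refine tendsto_finsetSum _ fun k _ => Tendsto.mul ?_ (hb k j)
    exact ((h.smooth.inv fun p => (h.co p).det_ne_zero) i k).continuous.continuousAt.tendsto.comp h1
  have h4 : Tendsto (fun x => x) l (𝓝 p) := by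
    refine tendsto_of_isInducing_domRestrict hU hemb.isInducing hW hW' (hq.prodMk_nhds ?_)
    exact tendsto_pi_nhds.2 fun i => tendsto_pi_nhds.2 fun j => h3 i j
  exact h4

theorem isSmoothEmb_coords : IsSmoothEmb (𝓡 11) (coords 𝓒 b) :=
  ⟨h.contMDiff_coords, h.injective_dmap_coords, h.isEmbedding_coords⟩

end CartanBundle.IsFrameMap

theorem IsSmoothEmb.equiv_comp {E H : Type*} [NormedAddCommGroup E] [NormedSpace ℝ E]
    [TopologicalSpace H] {I : ModelWithCorners ℝ E H} {P : Type*} [TopologicalSpace P]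
    [ChartedSpace H P] {F F' : Type*} [NormedAddCommGroup F] [NormedSpace ℝ F]
    [NormedAddCommGroup F'] [NormedSpace ℝ F'] {f : P → F} (hf : IsSmoothEmb I f) (e : F ≃L[ℝ] F') :
    IsSmoothEmb I fun p => e (f p) where
  contMDiff := e.contDiff.comp_contMDiff hf.contMDiff
  injective_mfderiv p v w hvw := by
    have hd := (hf.contMDiff p).mdiff
    have h1 := fun v => dmap_clm (e : F →L[ℝ] F') hd v
    exact hf.injective_mfderiv p (e.injective (((h1 v).symm.trans hvw).trans (h1 w)))
  isEmbedding := e.toHomeomorph.isEmbedding.comp hf.isEmbedding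

/-- The linear isomorphism of `ℝ⁴` with the matrix `modelMat ε`. -/
def modelEquiv {ε : ℝ} (hε : ε = 1 ∨ ε = -1) : R4 ≃L[ℝ] R4 :=
  LinearEquiv.toContinuousLinearEquiv
    { Matrix.mulVecLin (modelMat ε) with
      invFun := fun v => (modelMat ε)ᵀ *ᵥ v
      left_inv := fun v => by
        change (modelMat ε)ᵀ *ᵥ (modelMat ε *ᵥ v) = v
        rw [Matrix.mulVec_mulVec, modelMat_transpose_mul hε, Matrix.one_mulVec]
      right_inv := fun v => by
        change modelMat ε *ᵥ ((modelMat ε)ᵀ *ᵥ v) = v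
        rw [Matrix.mulVec_mulVec, modelMat_mul_transpose hε, Matrix.one_mulVec] }

theorem modelEquiv_apply {ε : ℝ} (hε : ε = 1 ∨ ε = -1) (v : R4) :
    modelEquiv hε v = modelMat ε *ᵥ v := rfl

theorem modelEquiv_dotProduct {ε : ℝ} (hε : ε = 1 ∨ ε = -1) (u v : R4) :
    modelEquiv hε u ⬝ᵥ (eta *ᵥ modelEquiv hε v) = ε * g0 u v := by
  rw [modelEquiv_apply, modelEquiv_apply, g0_eq_dotProduct, ← smul_eq_mul, ← dotProduct_smul,
    ← Matrix.smul_mulVec, ← modelMat_conj hε, ← Matrix.mulVec_mulVec, ← Matrix.mulVec_mulVec,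
    Matrix.dotProduct_mulVec _ (modelMat ε)ᵀ, Matrix.vecMul_transpose]

namespace CartanBundle.IsFrameMap

variable {M : Type*} [TopologicalSpace M] [ChartedSpace (EuclideanSpace ℝ (Fin 6)) M]
  [IsManifold (𝓡 6) ∞ M] {𝓜 : ParaCR (𝓡 6) M 2 3} {Φ : M → Flat}
  {P : Type*} [TopologicalSpace P] [ChartedSpace (EuclideanSpace ℝ (Fin 11)) P]
  [IsManifold (𝓡 11) ∞ P] {𝓒 : CartanBundle 𝓜 (params Φ) P}
  {ε : ℝ} {b : P → Matrix (Fin 4) (Fin 4) ℝ} (h : 𝓒.IsFrameMap ε b)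

/-- The identification of `P` with the part of `ℝ⁴ ⋊ CO(2,2)` over `L (range π)`. -/
def toSim (p : P) : Sim := ⟨Multiplicative.ofAdd (modelEquiv h.sign (𝓒.q p)), (h.co p).toCO⟩

theorem isGroupModel : 𝓒.IsGroupModel (modelEquiv h.sign) h.toSim where
  emb := h.isSmoothEmb_coords.equiv_comp
    ((modelEquiv h.sign).prodCongr (ContinuousLinearEquiv.refl ℝ (Fin 4 → Fin 4 → ℝ)))
  range_eq := by
    ext x
    constructor
    · rintro ⟨p, rfl⟩
      exact ⟨𝓒.q p, 𝓒.q_mem_range p, rfl⟩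
    · rintro ⟨s, hs, hx⟩
      obtain ⟨p, hp, hb⟩ := h.exists_point hs (isCO_coMat x.right)
      refine ⟨p, SemidirectProduct.ext ?_ (coMat_injective hb)⟩
      change Multiplicative.ofAdd (modelEquiv h.sign (𝓒.q p)) = x.left
      rw [hp, hx]
      rfl
  left_eq p := rfl
  act_eq p g := by
    refine SemidirectProduct.ext ?_ (coMat_injective (h.act p g))
    change Multiplicative.ofAdd (modelEquiv h.sign (𝓒.q (𝓒.act p g))) = _
    rw [𝓒.q_act, SemidirectProduct.mul_left, SemidirectProduct.left_inr, map_one, mul_one]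
    rfl
  θ_eq p v i := by
    have h1 := congrFun (h.θ_eq p v) i
    refine h1.trans ?_
    rw [← Matrix.mulVec_mulVec, Matrix.mulVec, dotProduct]
    refine Finset.sum_congr rfl fun j _ => ?_
    rw [coMat_inv]
    refine congrArg₂ (· * ·) rfl ?_
    have hq := (𝓒.contMDiff_q p).mdiff
    have h2 := dmap_clm (((ContinuousLinearMap.proj j : R4 →L[ℝ] ℝ)).comp
      ((modelEquiv h.sign : R4 ≃L[ℝ] R4) : R4 →L[ℝ] R4)) hq v
    exact h2.symm
  Γ_eq p v i j := by
    have h1 := congrFun (congrFun (h.Γ_eq p v) i) j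
    refine h1.trans ?_
    rw [Matrix.mul_apply, coMat_inv]
    rfl

theorem bijective_toSim (hs : Function.Surjective (params Φ)) : Function.Bijective h.toSim := by
  constructor
  · intro p p' hp
    refine h.point_ext ((modelEquiv h.sign).injective ?_) ?_
    · exact congrArg (fun x : Sim => x.left.toAdd) hp
    · exact congrArg (fun x : Sim => coMat x.right) hp
  · rw [← range_eq_univ, h.isGroupModel.range_eq, hs.range_eq, image_univ,
      (modelEquiv h.sign).surjective.range_eq]
    simp

end CartanBundle.IsFrameMap

/-! ### Isomorphisms of Cartan bundles -/

theorem signMat_mul (δ ε : ℝ) : signMat δ * signMat ε = signMat (δ * ε) := by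
  rw [signMat, signMat, signMat, Matrix.diagonal_mul_diagonal]
  congr 1
  ext i
  fin_cases i <;> simp

theorem signMat_mul_apply (δ : ℝ) (X : Matrix (Fin 4) (Fin 4) ℝ) (i j : Fin 4) :
    (signMat δ * X) i j = signMat δ i i * X i j := by
  rw [signMat, Matrix.diagonal_mul, Matrix.diagonal_apply_eq]

theorem mul_signMat_apply (δ : ℝ) (X : Matrix (Fin 4) (Fin 4) ℝ) (i j : Fin 4) :
    (X * signMat δ) i j = X i j * signMat δ j j := by
  rw [signMat, Matrix.mul_diagonal, Matrix.diagonal_apply_eq]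

theorem eq_one_of_isCO_signMat {δ : ℝ} (hδ : δ = 1 ∨ δ = -1) (h : IsCO (signMat δ)) : δ = 1 := by
  have h1 := h.conj_eq
  rw [signMat_transpose, signMat_conj_eta hδ] at h1
  have h2 := h.scale_pos
  rw [← smul_eta_inj h1] at h2
  rcases hδ with rfl | rfl
  · rfl
  · norm_num at h2

theorem signMat_inv {δ : ℝ} (hδ : δ = 1 ∨ δ = -1) : (signMat δ)⁻¹ = signMat δ :=
  Matrix.inv_eq_left_inv (signMat_mul_self hδ)

/-- Conjugation of a frame by `J = diag(δ, 1, δ, 1)` multiplies the dual coframe by `J`. -/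
theorem inv_signMat_conj {δ ε ε' : ℝ} (hδ : δ = 1 ∨ δ = -1) (hε : δ * ε = ε')
    (B : Matrix (Fin 4) (Fin 4) ℝ) :
    (signMat δ * B * signMat δ)⁻¹ * modelMat ε' = signMat δ * (B⁻¹ * modelMat ε) := by
  rw [Matrix.mul_inv_rev, Matrix.mul_inv_rev, signMat_inv hδ, ← hε, ← signMat_mul_modelMat]
  simp only [Matrix.mul_assoc]
  rw [← Matrix.mul_assoc (signMat δ) (signMat δ), signMat_mul_self hδ, Matrix.one_mul]

namespace CartanBundle.IsFrameMap

variable {M : Type*} [TopologicalSpace M] [ChartedSpace (EuclideanSpace ℝ (Fin 6)) M]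
  [IsManifold (𝓡 6) ∞ M] {𝓜 : ParaCR (𝓡 6) M 2 3} {Φ : M → Flat}
  {P : Type*} [TopologicalSpace P] [ChartedSpace (EuclideanSpace ℝ (Fin 11)) P]
  [IsManifold (𝓡 11) ∞ P] {𝓒 : CartanBundle 𝓜 (params Φ) P}
  {P' : Type*} [TopologicalSpace P'] [ChartedSpace (EuclideanSpace ℝ (Fin 11)) P']
  [IsManifold (𝓡 11) ∞ P'] {𝓒' : CartanBundle 𝓜 (params Φ) P'}
  {ε ε' δ : ℝ} {b : P → Matrix (Fin 4) (Fin 4) ℝ} {b' : P' → Matrix (Fin 4) (Fin 4) ℝ}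
  (h : 𝓒.IsFrameMap ε b) (h' : 𝓒'.IsFrameMap ε' b')

include h in
theorem θ_eq' (p : P) (v : TangentSpace (𝓡 11) p) (i : Fin 4) :
    𝓒.θ i p v = (((b p)⁻¹ * modelMat ε) *ᵥ dmap (𝓡 11) 𝓒.q p v) i := congrFun (h.θ_eq p v) i

include h in
/-- The domain of `ρ` consists of the frames whose null covector `θ⁴` belongs to a point of `M`. -/
theorem mem_dom_iff (hΦ : IsParaCREmbedding 𝓜 flatParaCR Φ) {p : P} :
    p ∈ 𝓒.dom ↔ nullRow ε b p 0 ≠ 0 ∧ nullPoint ε 𝓒.q b p ∈ range Φ := by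
  constructor
  · intro hp
    rw [nullRow_eq_row h.θ_eq, ← comp_ρ_eq_nullPoint h.θ_eq hΦ hp]
    exact ⟨(𝓒.row_of_mem_dom hΦ hp).1, mem_range_self _⟩
  · rintro ⟨h0, m, hm⟩
    refine (𝓒.dom_maximal p m (congrArg Prod.snd hm) fun v w hw hvw => ?_).1
    have h1 := hΦ.mem_sup_iff.1 hw
    rw [hm, ← hvw] at h1
    refine (h.θ_eq' p v 3).trans ?_
    change nullRow ε b p ⬝ᵥ dmap (𝓡 11) 𝓒.q p v = 0
    rw [eq_smul_nullCov_aff h0 (nullRow_null h.co h.sign p), smul_dotProduct]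
    exact smul_eq_zero_of_right _ h1

include h h'

theorem exists_isoMap (hδ : δ = 1 ∨ δ = -1) (p : P) :
    ∃ p', 𝓒'.q p' = 𝓒.q p ∧ b' p' = signMat δ * b p * signMat δ :=
  h'.exists_point (𝓒.q_mem_range p) ((h.co p).signMat_conj hδ)

/-- The map of Cartan bundles with `b' = J b J`, where `J = diag(δ, 1, δ, 1)`. -/
def isoMap (hδ : δ = 1 ∨ δ = -1) (p : P) : P' := (h.exists_isoMap h' hδ p).choose

theorem q_isoMap (hδ : δ = 1 ∨ δ = -1) (p : P) : 𝓒'.q (h.isoMap h' hδ p) = 𝓒.q p :=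
  (h.exists_isoMap h' hδ p).choose_spec.1

theorem frame_isoMap (hδ : δ = 1 ∨ δ = -1) (p : P) :
    b' (h.isoMap h' hδ p) = signMat δ * b p * signMat δ :=
  (h.exists_isoMap h' hδ p).choose_spec.2

theorem isoMap_isoMap (hδ : δ = 1 ∨ δ = -1) (p : P) :
    h'.isoMap h hδ (h.isoMap h' hδ p) = p := by
  refine h.point_ext ((h'.q_isoMap h hδ _).trans (h.q_isoMap h' hδ p)) ?_
  rw [h'.frame_isoMap h hδ, h.frame_isoMap h' hδ]
  simp only [← Matrix.mul_assoc, signMat_mul_self hδ, Matrix.one_mul]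
  rw [Matrix.mul_assoc, signMat_mul_self hδ, Matrix.mul_one]

theorem contMDiff_isoMap (hδ : δ = 1 ∨ δ = -1) : ContMDiff (𝓡 11) (𝓡 11) ∞ (h.isoMap h' hδ) := by
  have hs : ContMDiff (𝓡 11) 𝓘(ℝ, Amb) ∞ fun p => coords 𝓒' b' (h.isoMap h' hδ p) := by
    have h1 : MatSmooth (𝓡 11) fun p => signMat δ * b p * signMat δ :=
      ((matSmooth_const _).mul h.smooth).mul (matSmooth_const _)
    have h2 := 𝓒.contMDiff_q.prodMk_space (matSmooth_iff.1 h1)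
    exact h2.congr fun p => Prod.ext (h.q_isoMap h' hδ p) (h.frame_isoMap h' hδ p)
  intro p
  exact contMDiffAt_of_immersion (h'.contMDiff_coords _) (h'.injective_dmap_coords _)
    (h'.isEmbedding_coords.continuous_iff.2 hs.continuous).continuousAt (hs p)

/-- The isomorphism of Cartan bundles with `b' = J b J`, where `J = diag(δ, 1, δ, 1)`. -/
def iso (hδ : δ = 1 ∨ δ = -1) : Diffeomorph (𝓡 11) (𝓡 11) P P' ∞ where
  toFun := h.isoMap h' hδ
  invFun := h'.isoMap h hδ
  left_inv := h.isoMap_isoMap h' hδ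
  right_inv := h'.isoMap_isoMap h hδ
  contMDiff_toFun := h.contMDiff_isoMap h' hδ
  contMDiff_invFun := h'.contMDiff_isoMap h hδ

theorem nullRow_isoMap (hδ : δ = 1 ∨ δ = -1) (hε : δ * ε = ε') (p : P) :
    nullRow ε' b' (h.isoMap h' hδ p) = nullRow ε b p := by
  rw [nullRow, h.frame_isoMap h' hδ, inv_signMat_conj hδ hε]
  ext k
  rw [signMat_mul_apply]
  simp [signMat, nullRow]

theorem nullPoint_isoMap (hδ : δ = 1 ∨ δ = -1) (hε : δ * ε = ε') (p : P) :
    nullPoint ε' 𝓒'.q b' (h.isoMap h' hδ p) = nullPoint ε 𝓒.q b p := by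
  rw [nullPoint, nullRow_isoMap h h' hδ hε, q_isoMap, nullPoint]

theorem isIso_iso (hΦ : IsParaCREmbedding 𝓜 flatParaCR Φ) (hδ : δ = 1 ∨ δ = -1)
    (hε : δ * ε = ε') : 𝓒.IsIso 𝓒' δ (h.iso h' hδ) where
  q_eq := h.q_isoMap h' hδ
  act_eq p g g' hg := by
    refine h'.point_ext ((h.q_isoMap h' hδ _).trans ?_) ?_
    · rw [𝓒.q_act, 𝓒'.q_act]
      exact (h.q_isoMap h' hδ p).symm
    · refine (h.frame_isoMap h' hδ _).trans ((h'.act _ _).trans ?_).symm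
      rw [h.act]
      refine (congrArg (· * coMat g') (h.frame_isoMap h' hδ p)).trans ?_
      have h1 : coMat g' = signMat δ * coMat g * signMat δ := by
        rw [← hg, Matrix.mul_assoc, signMat_mul_self hδ, Matrix.mul_one]
      change signMat δ * b p * signMat δ * coMat g' = _
      rw [h1]
      simp only [Matrix.mul_assoc]
      rw [← Matrix.mul_assoc (signMat δ) (signMat δ), signMat_mul_self hδ, Matrix.one_mul]
  θ_eq p v i := by
    have hF := (h.contMDiff_isoMap h' hδ p).mdiff
    have h1 := dmap_mfderiv (𝓒'.contMDiff_q _).mdiff hF v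
    simp only [q_isoMap] at h1
    refine (h'.θ_eq' _ _ i).trans ?_
    rw [h.θ_eq' p v]
    refine (congrFun (congrArg₂ (fun B w => (B⁻¹ * modelMat ε') *ᵥ w) (h.frame_isoMap h' hδ p)
      h1.symm) i).trans ?_
    change (((signMat δ * b p * signMat δ)⁻¹ * modelMat ε') *ᵥ dmap (𝓡 11) 𝓒.q p v) i = _
    rw [inv_signMat_conj hδ hε, ← Matrix.mulVec_mulVec, signMat, Matrix.mulVec_diagonal,
      Matrix.diagonal_apply_eq]
  Γ_eq p v i j := by
    have hF := (h.contMDiff_isoMap h' hδ p).mdiff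
    have h1 := dMat_mfderiv h'.smooth hF v
    simp only [frame_isoMap] at h1
    have h2 := dMat_mul ((matSmooth_const (signMat δ)).mul h.smooth) (matSmooth_const (signMat δ)) p v
    have h3 := dMat_mul (matSmooth_const (signMat δ)) h.smooth p v
    rw [dMat_const, Matrix.mul_zero, add_zero] at h2
    rw [dMat_const, Matrix.zero_mul, zero_add] at h3
    rw [h2, h3] at h1
    have h4 : (b' (h.isoMap h' hδ p))⁻¹ * dMat (𝓡 11) b' (h.isoMap h' hδ p)
        (mfderiv (𝓡 11) (𝓡 11) (h.isoMap h' hδ) p v)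
        = signMat δ * ((b p)⁻¹ * dMat (𝓡 11) b p v) * signMat δ := by
      rw [← h1, h.frame_isoMap h' hδ, Matrix.mul_inv_rev, Matrix.mul_inv_rev, signMat_inv hδ]
      simp only [Matrix.mul_assoc]
      rw [← Matrix.mul_assoc (signMat δ) (signMat δ), signMat_mul_self hδ, Matrix.one_mul]
    refine (congrFun (congrFun ((h'.Γ_eq _ _).trans h4) i) j).trans ?_
    rw [mul_signMat_apply, signMat_mul_apply, ← h.Γ_eq]
    rfl
  dom_iff p := by
    rw [h.mem_dom_iff hΦ, h'.mem_dom_iff hΦ]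
    change (nullRow ε' b' (h.isoMap h' hδ p) 0 ≠ 0
      ∧ nullPoint ε' 𝓒'.q b' (h.isoMap h' hδ p) ∈ range Φ) ↔ _
    rw [nullRow_isoMap h h' hδ hε, nullPoint_isoMap h h' hδ hε]
  ρ_eq p hp := by
    have hp' : h.isoMap h' hδ p ∈ 𝓒'.dom := by
      rw [h'.mem_dom_iff hΦ, nullRow_isoMap h h' hδ hε, nullPoint_isoMap h h' hδ hε]
      exact (h.mem_dom_iff hΦ).1 hp
    refine hΦ.isOpenEmbedding.injective ((comp_ρ_eq_nullPoint h'.θ_eq hΦ hp').trans ?_)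
    rw [nullPoint_isoMap h h' hδ hε, comp_ρ_eq_nullPoint h.θ_eq hΦ hp]

/-- An isomorphism transforms the frame maps by `b' = J b J`; its sign is determined by the
signs of the two bundles. -/
theorem frame_of_isIso (hδ : δ = 1 ∨ δ = -1) (hε : δ * ε = ε') {δ' : ℝ}
    (hδ' : δ' = 1 ∨ δ' = -1) {F : P → P'} (hF : ContMDiff (𝓡 11) (𝓡 11) ∞ F)
    (hI : 𝓒.IsIso 𝓒' δ' F) (p : P) : b' (F p) = signMat δ * b p * signMat δ := by
  have h1 : (b' (F p))⁻¹ * modelMat ε' = signMat δ' * ((b p)⁻¹ * modelMat ε) := by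
    refine Matrix.ext_of_mulVec_single fun k => ?_
    obtain ⟨v, hv⟩ := 𝓒.surjective_dmap_q p (Pi.single k 1)
    have h2 := dmap_mfderiv (𝓒'.contMDiff_q _).mdiff (hF p).mdiff v
    simp only [hI.q_eq] at h2
    rw [← hv, ← Matrix.mulVec_mulVec _ (signMat δ')]
    ext i
    have h3 := hI.θ_eq p v i
    rw [h.θ_eq' p v] at h3
    rw [signMat, Matrix.mulVec_diagonal]
    rw [signMat, Matrix.diagonal_apply_eq] at h3
    refine Eq.trans ?_ h3
    rw [h'.θ_eq', h2]
  have hm := modelMat_mul_transpose h.sign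
  have h2 : (b' (F p))⁻¹ * signMat δ = signMat δ' * (b p)⁻¹ := by
    have h3 := congrArg (· * (modelMat ε)ᵀ) h1
    simp only [← hε, ← signMat_mul_modelMat] at h3
    rw [← Matrix.mul_assoc, Matrix.mul_assoc, hm, Matrix.mul_one, ← Matrix.mul_assoc,
      Matrix.mul_assoc _ (modelMat ε), hm, Matrix.mul_one] at h3
    exact h3
  have h3 : b' (F p) = signMat δ * b p * signMat δ' := by
    have h4 : b' (F p) * (signMat δ' * (b p)⁻¹) = signMat δ := by
      rw [← h2, ← Matrix.mul_assoc, (h'.co _).mul_inv, Matrix.one_mul]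
    rw [← h4]
    simp only [Matrix.mul_assoc]
    rw [← Matrix.mul_assoc (b p)⁻¹, (h.co p).inv_mul, Matrix.one_mul, signMat_mul_self hδ',
      Matrix.mul_one]
  have h4 : IsCO (signMat (δ * δ')) := by
    have h5 := ((h.co p).signMat_conj hδ).inv.mul (h'.co (F p))
    rw [h3, Matrix.mul_inv_rev, Matrix.mul_inv_rev, signMat_inv hδ] at h5
    simp only [Matrix.mul_assoc] at h5
    rw [← Matrix.mul_assoc (signMat δ) (signMat δ) (b p * _), signMat_mul_self hδ, Matrix.one_mul,
      ← Matrix.mul_assoc (b p)⁻¹, (h.co p).inv_mul, Matrix.one_mul, signMat_mul] at h5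
    exact h5
  have h5 : δ' = δ := by
    rcases hδ with rfl | rfl <;> rcases hδ' with rfl | rfl
    · rfl
    · have := eq_one_of_isCO_signMat (by norm_num) h4
      norm_num at this
    · have := eq_one_of_isCO_signMat (by norm_num) h4
      norm_num at this
    · rfl
  rw [h3, h5]

theorem existsUnique_iso (hΦ : IsParaCREmbedding 𝓜 flatParaCR Φ) :
    ∃! F : Diffeomorph (𝓡 11) (𝓡 11) P P' ∞, ∃ δ : ℝ, (δ = 1 ∨ δ = -1) ∧ 𝓒.IsIso 𝓒' δ F := by
  obtain ⟨δ, hδ, hε⟩ : ∃ δ : ℝ, (δ = 1 ∨ δ = -1) ∧ δ * ε = ε' := by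
    refine ⟨ε' * ε, ?_, ?_⟩ <;> rcases h.sign with rfl | rfl <;> rcases h'.sign with rfl | rfl <;>
      norm_num
  refine ⟨h.iso h' hδ, ⟨δ, hδ, h.isIso_iso h' hΦ hδ hε⟩, ?_⟩
  rintro F ⟨δ', hδ', hF⟩
  refine Diffeomorph.ext fun p => h'.point_ext ?_ ?_
  · exact (hF.q_eq p).trans (h.q_isoMap h' hδ p).symm
  · exact (h.frame_of_isIso h' hδ hε hδ' F.contMDiff hF p).trans (h.frame_isoMap h' hδ p).symm

end CartanBundle.IsFrameMap

/-! ### Weyl geometries conformal to the flat one -/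

section FlatWeyl

variable {V : Set R4} {g : BilinField} {A : CovField} {ε : ℝ}

theorem WeylEquiv.refl (V : Set R4) (g : BilinField) (A : CovField) : WeylEquiv V g A g A :=
  ⟨fun _ => 0, contDiffOn_const, fun s _ => by
    rw [mul_zero, Real.exp_zero, one_smul, fderiv_fun_const, Pi.zero_apply, smul_zero, sub_zero]
    exact ⟨rfl, rfl⟩⟩

theorem exists_basis_of_diagonal {B : R4 →L[ℝ] R4 →L[ℝ] ℝ} {e : Fin 4 → R4} {d : Fin 4 → ℝ}
    (hd : ∀ i, d i ≠ 0) (h : ∀ i j, B (e i) (e j) = Matrix.diagonal d i j) :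
    ∃ b : Module.Basis (Fin 4) ℝ R4, ∀ i, b i = e i := by
  have hi : LinearIndependent ℝ e := by
    rw [Fintype.linearIndependent_iff]
    intro c hc i
    have h1 := congrArg (fun v => B v (e i)) hc
    simp only [map_sum, map_smul, clm_sum_apply, map_zero] at h1
    have h2 : ∀ k, (c k • B (e k)) (e i) = if k = i then c k * d i else 0 := by
      intro k
      have h3 : (c k • B (e k)) (e i) = c k * B (e k) (e i) := rfl
      rw [h3, h, Matrix.diagonal_apply]
      split_ifs with hk
      · rw [hk]
      · rw [mul_zero]
    rw [Finset.sum_congr rfl fun k _ => h2 k, Finset.sum_ite_eq' Finset.univ i] at h1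
    simpa [hd i] using h1
  refine ⟨basisOfLinearIndependentOfCardEqFinrank hi (by simp), fun i => ?_⟩
  rw [coe_basisOfLinearIndependentOfCardEqFinrank]

/-- An orthonormal frame of `ε g₀`, up to the factor `√2`. -/
def orthoFrame (ε : ℝ) : Fin 4 → R4 :=
  ![![1, 0, 0, ε], ![0, 1, -ε, 0], ![1, 0, 0, -ε], ![0, 1, ε, 0]]

theorem orthoFrame_spec (hε : ε = 1 ∨ ε = -1) (i j : Fin 4) :
    ε * g0 (orthoFrame ε i) (orthoFrame ε j) = 2 * Matrix.diagonal ![1, 1, -1, -1] i j := by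
  rw [g0_apply]
  rcases hε with rfl | rfl <;> fin_cases i <;> fin_cases j <;> simp [orthoFrame] <;> norm_num

theorem contDiffOn_smul_const {E F : Type*} [NormedAddCommGroup E] [NormedSpace ℝ E]
    [NormedAddCommGroup F] [NormedSpace ℝ F] {c : E → ℝ} {V : Set E} (hc : ContDiffOn ℝ ∞ c V)
    (v : F) : ContDiffOn ℝ ∞ (fun x => c x • v) V := hc.smul contDiffOn_const

theorem hasFDerivAt_smul_const {E F : Type*} [NormedAddCommGroup E] [NormedSpace ℝ E]
    [NormedAddCommGroup F] [NormedSpace ℝ F] {c : E → ℝ} {c' : E →L[ℝ] ℝ} {x : E}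
    (hc : HasFDerivAt c c' x) (v : F) : HasFDerivAt (fun x => c x • v) (c'.smulRight v) x :=
  hc.smul_const v

/-- The pairs that are Weyl equivalent to `(ε g₀, 0)` are metrics of signature `(2,2)`. -/
theorem WeylEquiv.isWeylPair (hV : IsOpen V) (hε : ε = 1 ∨ ε = -1)
    (h : WeylEquiv V (fun _ => ε • g0) (fun _ => 0) g A) : IsWeylPair V g A := by
  obtain ⟨φ, hφ, h⟩ := h
  refine ⟨?_, ?_, fun s hs u v => ?_, fun s hs => ?_⟩
  · refine ContDiffOn.congr ?_ fun s hs => (h s hs).1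
    exact contDiffOn_smul_const (contDiffOn_const.mul hφ).exp (ε • g0)
  · refine ContDiffOn.congr ?_ fun s hs => (h s hs).2
    have h1 : ContDiffOn ℝ ∞ (fderiv ℝ φ) V := hφ.fderiv_of_isOpen hV (m := ∞) (by simp)
    exact contDiffOn_const.sub (h1.const_smul (2 : ℝ))
  · rw [(h s hs).1]
    change Real.exp (2 * φ s) * (ε * g0 u v) = Real.exp (2 * φ s) * (ε * g0 v u)
    rw [g0_apply, g0_apply]
    ring
  · let c : ℝ := Real.exp (-φ s) * (√2)⁻¹
    have hc : Real.exp (2 * φ s) * (c * c) * 2 = 1 := by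
      have h1 : Real.exp (2 * φ s) * (Real.exp (-φ s) * Real.exp (-φ s)) = 1 := by
        rw [← Real.exp_add, ← Real.exp_add, ← Real.exp_zero]
        congr 1
        ring
      have h2 : (√2)⁻¹ * (√2)⁻¹ * 2 = 1 := by
        rw [← mul_inv, Real.mul_self_sqrt zero_le_two]
        norm_num
      calc _ = (Real.exp (2 * φ s) * (Real.exp (-φ s) * Real.exp (-φ s)))
            * ((√2)⁻¹ * (√2)⁻¹ * 2) := by ring
        _ = 1 := by rw [h1, h2, one_mul]
    have key : ∀ i j, g s (c • orthoFrame ε i) (c • orthoFrame ε j)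
        = Matrix.diagonal ![1, 1, -1, -1] i j := by
      intro i j
      rw [(h s hs).1]
      change Real.exp (2 * φ s) * (ε * g0 (c • orthoFrame ε i) (c • orthoFrame ε j)) = _
      have h1 : g0 (c • orthoFrame ε i) (c • orthoFrame ε j)
          = c * c * g0 (orthoFrame ε i) (orthoFrame ε j) := by
        rw [map_smul, map_smul]
        change c * (c * g0 (orthoFrame ε i) (orthoFrame ε j)) = _
        ring
      rw [h1]
      linear_combination (Real.exp (2 * φ s) * (c * c)) * orthoFrame_spec hε i j
        + Matrix.diagonal ![1, 1, -1, -1] i j * hc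
    obtain ⟨b, hb⟩ := exists_basis_of_diagonal (fun i => by fin_cases i <;> norm_num) key
    exact ⟨b, fun i j => by rw [hb, hb, key]⟩

/-- The Weyl connection of a pair `(e^{2φ} ε g₀, -2 dφ)` is the flat connection of `ℝ⁴`. -/
theorem WeylEquiv.isFlatWeyl (hV : IsOpen V)
    (h : WeylEquiv V (fun _ => ε • g0) (fun _ => 0) g A) : IsFlatWeyl V g A := by
  obtain ⟨φ, hφ, h⟩ := h
  refine ⟨fun _ => 0, ⟨contDiffOn_const, fun s hs => ⟨fun x y => rfl, fun x y z => ?_⟩⟩,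
    fun s _ x y z => by simp⟩
  have h1 : g =ᶠ[𝓝 s] fun x => Real.exp (2 * φ x) • ε • g0 := by
    filter_upwards [hV.mem_nhds hs] with x hx using (h x hx).1
  have hd : HasFDerivAt φ (fderiv ℝ φ s) s :=
    ((hφ.contDiffAt (hV.mem_nhds hs)).differentiableAt (by simp)).hasFDerivAt
  have h2 := (hasFDerivAt_smul_const (hd.const_mul 2).exp (ε • g0)).congr_of_eventuallyEq h1
  rw [h2.fderiv, (h s hs).1, (h s hs).2]
  change Real.exp (2 * φ s) * (2 * fderiv ℝ φ s x) * (ε * g0 y z)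
    - Real.exp (2 * φ s) * (ε * g0 0 z) - Real.exp (2 * φ s) * (ε * g0 y 0)
    = -(0 - 2 * fderiv ℝ φ s x) * (Real.exp (2 * φ s) * (ε * g0 y z))
  rw [g0_apply 0, g0_apply y 0]
  simp only [Pi.zero_apply]
  ring

end FlatWeyl

/-! ### The Weyl geometry of a Cartan bundle -/

section

variable {P : Type*} [TopologicalSpace P] [ChartedSpace (EuclideanSpace ℝ (Fin 11)) P]

theorem dmap_comp_contDiffOn {φ : R4 → ℝ} {V : Set R4} (hV : IsOpen V) (hφ : ContDiffOn ℝ ∞ φ V)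
    {q : P → R4} (hq : ContMDiff (𝓡 11) 𝓘(ℝ, R4) ∞ q) {p : P} (hp : q p ∈ V)
    (v : TangentSpace (𝓡 11) p) :
    dmap (𝓡 11) (fun p => φ (q p)) p v = fderiv ℝ φ (q p) (dmap (𝓡 11) q p v) :=
  dmap_comp (((hφ.contDiffAt (hV.mem_nhds hp)).differentiableAt (by simp)).hasFDerivAt)
    (hq p).mdiff v

theorem contMDiff_comp_contDiffOn {φ : R4 → ℝ} {V : Set R4} (hV : IsOpen V)
    (hφ : ContDiffOn ℝ ∞ φ V) {q : P → R4} (hq : ContMDiff (𝓡 11) 𝓘(ℝ, R4) ∞ q)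
    (hqV : ∀ p, q p ∈ V) : ContMDiff (𝓡 11) 𝓘(ℝ, ℝ) ∞ fun p => φ (q p) := fun p =>
  (hφ.contDiffAt (hV.mem_nhds (hqV p))).comp_contMDiffAt (hq p)

theorem dmap_sub {f g : P → ℝ} (hf : ContMDiff (𝓡 11) 𝓘(ℝ, ℝ) ∞ f)
    (hg : ContMDiff (𝓡 11) 𝓘(ℝ, ℝ) ∞ g) (p : P) (v : TangentSpace (𝓡 11) p) :
    dmap (𝓡 11) (fun p => f p - g p) p v = dmap (𝓡 11) f p v - dmap (𝓡 11) g p v := by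
  have h1 := dmap_add ((hf.sub hg) p).mdiff (hg p).mdiff v
  simp only [sub_add_cancel] at h1
  rw [h1, add_sub_cancel_right]

end

namespace CartanBundle.IsFrameMap

variable {M : Type*} [TopologicalSpace M] [ChartedSpace (EuclideanSpace ℝ (Fin 6)) M]
  [IsManifold (𝓡 6) ∞ M] {𝓜 : ParaCR (𝓡 6) M 2 3} {Φ : M → Flat}
  {P : Type*} [TopologicalSpace P] [ChartedSpace (EuclideanSpace ℝ (Fin 11)) P]
  [IsManifold (𝓡 11) ∞ P] {𝓒 : CartanBundle 𝓜 (params Φ) P}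
  {ε : ℝ} {b : P → Matrix (Fin 4) (Fin 4) ℝ} (h : 𝓒.IsFrameMap ε b)

include h

/-- The conformal factor between `G` and `ε g₀`. -/
theorem G_eq (p : P) (u v : TangentSpace (𝓡 11) p) :
    𝓒.G p u v = (scale (b p))⁻¹ * (ε * g0 (dmap (𝓡 11) 𝓒.q p u) (dmap (𝓡 11) 𝓒.q p v)) := by
  have h1 : 𝓒.G p u v = (fun i => 𝓒.θ i p u) ⬝ᵥ (eta *ᵥ fun i => 𝓒.θ i p v) := by
    simp only [G, dotProduct, Matrix.mulVec, Finset.mul_sum]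
    exact Finset.sum_congr rfl fun i _ => Finset.sum_congr rfl fun j _ => by ring
  rw [h1, h.θ_eq, h.θ_eq, ← Matrix.vecMul_transpose, ← Matrix.dotProduct_mulVec,
    Matrix.mulVec_mulVec, Matrix.mulVec_mulVec, frame_conj (h.co p) h.sign, Matrix.smul_mulVec,
    dotProduct_smul, g0_eq_dotProduct, smul_eq_mul, mul_assoc]

theorem A_eq (p : P) (v : TangentSpace (𝓡 11) p) :
    𝓒.A p v = (scale (b p))⁻¹ * dmap (𝓡 11) (fun p => scale (b p)) p v := by
  refine smul_eta_inj ?_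
  rw [← gammaMat_conformal 𝓒.Ω 𝓒.A p v, h.Γ_eq, mcForm_conformal h.smooth h.co]

/-- The function `f = -½ log c`, where `c` is the dilation factor of `b`, relates `(G, A)` to the pair
`(ε g₀, 0)`. -/
theorem exists_factor : ∃ f : P → ℝ, ContMDiff (𝓡 11) 𝓘(ℝ, ℝ) ∞ f ∧ ∀ p,
    (∀ u v, 𝓒.G p u v = Real.exp (2 * f p)
      * (ε * g0 (dmap (𝓡 11) 𝓒.q p u) (dmap (𝓡 11) 𝓒.q p v)))
    ∧ ∀ v, 𝓒.A p v = -(2 * dmap (𝓡 11) f p v) := by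
  have hl : ∀ p, HasFDerivAt (fun x : ℝ => -(1 / 2) * Real.log x)
      (-(1 / 2 : ℝ) • ((scale (b p))⁻¹ • (ContinuousLinearMap.id ℝ ℝ))) (scale (b p)) := fun p =>
    ((hasFDerivAt_id _).log (h.co p).scale_pos.ne').const_mul _
  refine ⟨fun p => -(1 / 2) * Real.log (scale (b p)), fun p => ?_, fun p => ⟨fun u v => ?_,
    fun v => ?_⟩⟩
  · have h1 : ContDiffAt ℝ ∞ (fun x : ℝ => -(1 / 2) * Real.log x) (scale (b p)) :=
      contDiffAt_const.mul (Real.contDiffAt_log.2 (h.co p).scale_pos.ne')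
    exact ContDiffAt.comp_contMDiffAt (f := fun p => scale (b p)) h1 (h.smooth.scale p)
  · have h1 : 2 * (-(1 / 2) * Real.log (scale (b p))) = -Real.log (scale (b p)) := by ring
    rw [h.G_eq, h1, Real.exp_neg, Real.exp_log (h.co p).scale_pos]
  · have h1 := dmap_comp (f := fun p => scale (b p)) (hl p) (h.smooth.scale p).mdiff v
    rw [h1, h.A_eq]
    change _ = -(2 * (-(1 / 2) * ((scale (b p))⁻¹ * dmap (𝓡 11) (fun p => scale (b p)) p v)))
    ring

/-- The pairs induced by a Cartan bundle form the Weyl class of `(ε g₀, 0)`. -/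
theorem induces_iff (hΦ : IsParaCREmbedding 𝓜 flatParaCR Φ) (g : BilinField) (A : CovField) :
    𝓒.Induces g A ↔ WeylEquiv (range (params Φ)) (fun _ => ε • g0) (fun _ => 0) g A := by
  have hV := hΦ.isOpen_range_params
  have hq := 𝓒.contMDiff_q
  obtain ⟨f, hf, hfG⟩ := h.exists_factor
  have hε : ε * ε = 1 := by rcases h.sign with rfl | rfl <;> norm_num
  constructor
  · rintro ⟨hW, f', hf', hfG'⟩
    -- the conformal factor is read off from the pair of null vectors `e₀, e₃`
    let k : R4 → ℝ := fun s => ε * g s (Pi.single 0 1) (Pi.single 3 1)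
    have h0 : g0 (Pi.single 0 1) (Pi.single 3 1) = 1 := by
      rw [g0_apply]
      simp
    have hg : ∀ p, g (𝓒.q p) = Real.exp (2 * (f p - f' p)) • ε • g0 := by
      intro p
      ext u v
      obtain ⟨u, rfl⟩ := 𝓒.surjective_dmap_q p u
      obtain ⟨v, rfl⟩ := 𝓒.surjective_dmap_q p v
      have h1 := ((hfG' p).1 u v).symm.trans ((hfG p).1 u v)
      have h2 : Real.exp (2 * (f p - f' p)) = Real.exp (2 * f p) / Real.exp (2 * f' p) := by
        rw [← Real.exp_sub]
        congr 1
        ring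
      change _ = Real.exp (2 * (f p - f' p)) * (ε * g0 _ _)
      rw [h2, div_mul_eq_mul_div, eq_div_iff (Real.exp_pos _).ne', ← h1, mul_comm]
    have hk : ∀ p, k (𝓒.q p) = Real.exp (2 * (f p - f' p)) := by
      intro p
      change ε * g (𝓒.q p) (Pi.single 0 1) (Pi.single 3 1) = _
      rw [hg]
      change ε * (Real.exp (2 * (f p - f' p)) * (ε * g0 (Pi.single 0 1) (Pi.single 3 1))) = _
      rw [h0]
      linear_combination Real.exp (2 * (f p - f' p)) * hε
    have hφ : ∀ p, 1 / 2 * Real.log (k (𝓒.q p)) = f p - f' p := by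
      intro p
      rw [hk, Real.log_exp]
      ring
    have hks : ContDiffOn ℝ ∞ (fun s => 1 / 2 * Real.log (k s)) (range (params Φ)) := by
      refine contDiffOn_const.mul (ContDiffOn.log ?_ ?_)
      · exact contDiffOn_const.mul ((hW.contDiffOn_g.clm_apply contDiffOn_const).clm_apply
          contDiffOn_const)
      · rw [← 𝓒.range_q]
        rintro _ ⟨p, rfl⟩
        rw [hk]
        exact (Real.exp_pos _).ne'
    refine ⟨fun s => 1 / 2 * Real.log (k s), hks, ?_⟩
    rw [← 𝓒.range_q]
    rintro _ ⟨p, rfl⟩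
    refine ⟨by rw [hg, ← hφ], ?_⟩
    ext y
    obtain ⟨v, rfl⟩ := 𝓒.surjective_dmap_q p y
    have h1 := dmap_comp_contDiffOn hV hks hq (𝓒.q_mem_range p) v
    simp only [hφ] at h1
    rw [dmap_sub hf hf'] at h1
    have h2 := ((hfG' p).2 v).symm.trans ((hfG p).2 v)
    change _ = 0 - 2 * fderiv ℝ (fun s => 1 / 2 * Real.log (k s)) (𝓒.q p) (dmap (𝓡 11) 𝓒.q p v)
    rw [← h1]
    linarith
  · intro hE
    refine ⟨hE.isWeylPair hV h.sign, ?_⟩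
    obtain ⟨φ, hφ, hφg⟩ := hE
    have hφq := contMDiff_comp_contDiffOn hV hφ hq 𝓒.q_mem_range
    refine ⟨fun p => f p - φ (𝓒.q p), hf.sub hφq, fun p => ⟨fun u v => ?_, fun v => ?_⟩⟩
    · rw [(hφg _ (𝓒.q_mem_range p)).1, (hfG p).1]
      have h1 : Real.exp (2 * f p)
          = Real.exp (2 * (f p - φ (𝓒.q p))) * Real.exp (2 * φ (𝓒.q p)) := by
        rw [← Real.exp_add]
        congr 1
        ring
      rw [h1, mul_assoc]
      rfl
    · rw [(hφg _ (𝓒.q_mem_range p)).2, (hfG p).2, dmap_sub hf hφq,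
        dmap_comp_contDiffOn hV hφ hq (𝓒.q_mem_range p)]
      change _ = 0 - 2 * fderiv ℝ φ (𝓒.q p) (dmap (𝓡 11) 𝓒.q p v) - _
      ring

end CartanBundle.IsFrameMap

/-! ### Change of the parameters -/

/-- The inverse of a diffeomorphism is a diffeomorphism. -/
theorem IsDiffeoOn.exists_inverse {X : Type*} [NormedAddCommGroup X] [NormedSpace ℝ X]
    [FiniteDimensional ℝ X] {f : X → X} {O : Set X} (hf : IsDiffeoOn f O) :
    ∃ k : X → X, IsDiffeoOn k (f '' O) ∧ ∀ x ∈ O, k (f x) = x := by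
  have : CompleteSpace X := FiniteDimensional.complete ℝ X
  let e : OpenPartialHomeomorph X X := OpenPartialHomeomorph.ofContinuousOpenRestrict
    (InjOn.toPartialEquiv f O hf.2.2.1) hf.2.1.continuousOn hf.isOpenEmbedding.isOpenMap hf.1
  have hl : ∀ x ∈ O, e.symm (f x) = x := fun x hx => e.left_inv hx
  have ht : ∀ y ∈ f '' O, y ∈ e.target := fun y hy => hy
  have hd : ∀ x ∈ O, ContDiffAt ℝ ∞ e.symm (f x) ∧ ∃ e' : X ≃L[ℝ] X,
      HasFDerivAt e.symm (e' : X →L[ℝ] X) (f x) := by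
    intro x hx
    obtain ⟨l, hl'⟩ := hf.exists_equiv hx
    have h1 : HasFDerivAt e (l : X →L[ℝ] X) (e.symm (f x)) := by rwa [hl x hx]
    refine ⟨e.contDiffAt_symm (ht _ (mem_image_of_mem f hx)) h1 ?_, l.symm,
      e.hasFDerivAt_symm (ht _ (mem_image_of_mem f hx)) h1⟩
    rw [hl x hx]
    exact hf.contDiffAt hx
  refine ⟨e.symm, ⟨e.open_target, ?_, ?_, ?_⟩, hl⟩
  · rintro _ ⟨x, hx, rfl⟩
    exact (hd x hx).1.contDiffWithinAt
  · rintro _ ⟨x, hx, rfl⟩ _ ⟨y, hy, rfl⟩ h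
    rw [hl x hx, hl y hy] at h
    rw [h]
  · rintro _ ⟨x, hx, rfl⟩
    obtain ⟨l, hl'⟩ := (hd x hx).2
    rw [hl'.fderiv]
    exact l.bijective

theorem isEmbedding_prodMap_domRestrict {X Y Z : Type*} [TopologicalSpace X] [TopologicalSpace Y]
    [TopologicalSpace Z] {q : X → Y} {t : X → Z} {β : Y → Y} {U : Set X} {V W : Set Y}
    (hWV : W ⊆ V) (hU : ∀ x ∈ U, q x ∈ W) (hβ : IsEmbedding (V.domRestrict β))
    (h : IsEmbedding (U.domRestrict fun x => (q x, t x))) :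
    IsEmbedding (U.domRestrict fun x => (β (q x), t x)) := by
  let e : U → W × Z := fun x => (⟨q x, hU x x.2⟩, t x)
  have hc : Continuous e := by
    refine Continuous.prodMk ?_ (continuous_snd.comp h.continuous)
    exact Continuous.subtype_mk (continuous_fst.comp h.continuous) _
  have he : IsEmbedding e :=
    IsEmbedding.of_comp hc (continuous_subtype_val.prodMap continuous_id) h
  exact ((hβ.comp (IsEmbedding.inclusion hWV)).prodMap IsEmbedding.id).comp he

namespace CartanBundle

variable {M : Type*} [TopologicalSpace M] [ChartedSpace (EuclideanSpace ℝ (Fin 6)) M]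
  [IsManifold (𝓡 6) ∞ M] {𝓜 : ParaCR (𝓡 6) M 2 3} {π π' : M → R4}
  {P : Type*} [TopologicalSpace P] [ChartedSpace (EuclideanSpace ℝ (Fin 11)) P]
  [IsManifold (𝓡 11) ∞ P] (𝓒 : CartanBundle 𝓜 π P) {β : R4 → R4} (hβ : IsDiffeoOn β (range π))

include hβ in
theorem dmap_β_q (p : P) (v : TangentSpace (𝓡 11) p) :
    dmap (𝓡 11) (fun p => β (𝓒.q p)) p v = fderiv ℝ β (𝓒.q p) (dmap (𝓡 11) 𝓒.q p v) :=
  dmap_comp (hβ.hasFDerivAt (𝓒.q_mem_range p)) (𝓒.contMDiff_q p).mdiff v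

include hβ in
theorem dmap_β_q_eq_zero (p : P) (v : TangentSpace (𝓡 11) p) :
    dmap (𝓡 11) (fun p => β (𝓒.q p)) p v = 0 ↔ dmap (𝓡 11) 𝓒.q p v = 0 := by
  rw [𝓒.dmap_β_q hβ]
  exact map_eq_zero_iff _ (hβ.2.2.2 _ (𝓒.q_mem_range p)).1

/-- A Cartan bundle for `π` is a Cartan bundle for `β ∘ π`, with the projection `β ∘ q`. -/
def transport (hπ : ContMDiff (𝓡 6) 𝓘(ℝ, R4) ∞ π) (hπ' : ∀ m, π' m = β (π m)) :
    CartanBundle 𝓜 π' P where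
  q p := β (𝓒.q p)
  act := 𝓒.act
  contMDiff_q p := (hβ.contDiffAt (𝓒.q_mem_range p)).comp_contMDiffAt (𝓒.contMDiff_q p)
  range_q := by
    refine (range_comp β 𝓒.q).trans ?_
    rw [𝓒.range_q, ← range_comp]
    exact congrArg range (funext fun m => (hπ' m).symm)
  act_one := 𝓒.act_one
  act_mul := 𝓒.act_mul
  q_act p b := congrArg β (𝓒.q_act p b)
  local_triv s hs := by
    obtain ⟨m, rfl⟩ := hs
    obtain ⟨W, hW, hs, hWV, t, ht, hbij, hsm, hinj, hemb⟩ := 𝓒.local_triv (π m) (mem_range_self m)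
    have hpre : (fun p => β (𝓒.q p)) ⁻¹' (β '' W) = 𝓒.q ⁻¹' W := by
      ext p
      refine ⟨?_, fun hp => mem_image_of_mem β hp⟩
      rintro ⟨w, hw, h⟩
      rwa [mem_preimage, ← hβ.2.2.1 (hWV hw) (𝓒.q_mem_range p) h]
    have ho : IsOpen (β '' W) := by
      have h1 := hβ.isOpenEmbedding.isOpenMap _ (hW.preimage continuous_subtype_val)
      have h2 : β '' W = (range π).domRestrict β '' (Subtype.val ⁻¹' W) := by
        ext y
        constructor
        · rintro ⟨w, hw, rfl⟩
          exact ⟨⟨w, hWV hw⟩, hw, rfl⟩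
        · rintro ⟨w, hw, rfl⟩
          exact ⟨w, hw, rfl⟩
      rwa [h2]
    have hd : ∀ p ∈ 𝓒.q ⁻¹' W, ContMDiffAt (𝓡 11) 𝓘(ℝ, R4 × (Fin 4 → Fin 4 → ℝ)) ∞
        (fun p => (𝓒.q p, coEntries (t p))) p := fun p hp =>
      hsm.contMDiffAt ((hW.preimage 𝓒.contMDiff_q.continuous).mem_nhds hp)
    have hd' : ∀ p ∈ 𝓒.q ⁻¹' W, ContMDiffAt (𝓡 11) 𝓘(ℝ, R4 × (Fin 4 → Fin 4 → ℝ)) ∞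
        (fun p => (β (𝓒.q p), coEntries (t p))) p := fun p hp =>
      ((hβ.contDiffAt (𝓒.q_mem_range p)).comp_contMDiffAt (𝓒.contMDiff_q p)).prodMk_space
        (contDiff_snd.contDiffAt.comp_contMDiffAt (hd p hp))
    refine ⟨β '' W, ho, ⟨π m, hs, (hπ' m).symm⟩, ?_, t, ?_, ?_, ?_, ?_, ?_⟩
    · rintro _ ⟨w, hw, rfl⟩
      obtain ⟨m', rfl⟩ := hWV hw
      exact ⟨m', hπ' m'⟩
    · intro p hp
      exact ht p (hpre.subset hp)
    · rw [hpre]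
      refine ⟨fun p hp => ⟨mem_image_of_mem β hp, mem_univ _⟩, fun p hp p' hp' h => ?_, ?_⟩
      · obtain ⟨h1, h2⟩ := Prod.ext_iff.1 h
        exact hbij.injOn hp hp' (Prod.ext
          (hβ.2.2.1 (𝓒.q_mem_range p) (𝓒.q_mem_range p') h1) h2)
      · rintro ⟨_, b⟩ ⟨⟨w, hw, rfl⟩, -⟩
        obtain ⟨p, hp, h⟩ := hbij.surjOn (mk_mem_prod hw (mem_univ b))
        obtain ⟨h1, h2⟩ := Prod.ext_iff.1 h
        exact ⟨p, hp, Prod.ext (congrArg β h1) h2⟩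
    · rw [hpre]
      exact fun p hp => (hd' p hp).contMDiffWithinAt
    · rw [hpre]
      intro p hp
      refine (injective_iff_map_eq_zero _).2 fun v hv => ?_
      refine (injective_iff_map_eq_zero _).1 (hinj p hp) v (Prod.ext ?_ ?_)
      · rw [← dmap_fst (hd p hp).mdiff]
        refine (𝓒.dmap_β_q_eq_zero hβ p v).1 ?_
        exact (dmap_fst (hd' p hp).mdiff v).trans (congrArg Prod.fst hv)
      · rw [← dmap_snd (hd p hp).mdiff]
        exact (dmap_snd (hd' p hp).mdiff v).trans (congrArg Prod.snd hv)
    · rw [hpre]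
      exact isEmbedding_prodMap_domRestrict hWV (fun p hp => hp) hβ.isOpenEmbedding.isEmbedding hemb
  θ := 𝓒.θ
  Ω := 𝓒.Ω
  A := 𝓒.A
  smooth_θ := 𝓒.smooth_θ
  smooth_Ω := 𝓒.smooth_Ω
  smooth_A := 𝓒.smooth_A
  coframe := 𝓒.coframe
  dθ_eq := 𝓒.dθ_eq
  dΓ_eq := 𝓒.dΓ_eq
  θ_vertical p v := (𝓒.θ_vertical p v).trans (𝓒.dmap_β_q_eq_zero hβ p v).symm
  θ_act := 𝓒.θ_act
  Γ_act := 𝓒.Γ_act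
  Γ_vertical := 𝓒.Γ_vertical
  dom := 𝓒.dom
  ρ := 𝓒.ρ
  isOpen_dom := 𝓒.isOpen_dom
  contMDiffOn_ρ := 𝓒.contMDiffOn_ρ
  image_dom := 𝓒.image_dom
  π_ρ p hp := (hπ' _).trans (congrArg β (𝓒.π_ρ p hp))
  adapted_plus := 𝓒.adapted_plus
  adapted_minus := 𝓒.adapted_minus
  dom_maximal p m hm h := by
    have hq : π m = 𝓒.q p :=
      hβ.2.2.1 (mem_range_self m) (𝓒.q_mem_range p) ((hπ' m).symm.trans hm)
    refine 𝓒.dom_maximal p m hq fun v w hw hvw => h v w hw ?_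
    have h1 : dmap (𝓡 6) π' m w = fderiv ℝ β (π m) (dmap (𝓡 6) π m w) := by
      rw [funext hπ']
      exact dmap_comp (hβ.hasFDerivAt (mem_range_self m)) (hπ m).mdiff w
    rw [h1, 𝓒.dmap_β_q hβ, hvw, hq]

end CartanBundle

/-- The frame map of the bundle `V × CO(2,2)` is the projection to `CO(2,2)`. -/
theorem Model.isFrameMap_mat {M : Type*} [TopologicalSpace M]
    [ChartedSpace (EuclideanSpace ℝ (Fin 6)) M] [IsManifold (𝓡 6) ∞ M] [Nonempty M]
    {𝓜 : ParaCR (𝓡 6) M 2 3} {Φ : M → Flat} (hΦ : IsParaCREmbedding 𝓜 flatParaCR Φ) :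
    (Model.cartanBundle hΦ).IsFrameMap 1 Model.mat where
  sign := Or.inl rfl
  smooth := Model.matSmooth_mat
  co := Model.isCO_mat
  act := Model.mat_act
  θ_eq _ _ := rfl
  Γ_eq p v := by
    rw [← Model.of_mcForm]
    ext i j
    exact Model.gamma_eq i j p v

/-! ### The pull-back of Weyl geometries -/

/-- The pull-back of a field of bilinear forms. -/
def BilinField.pullback (g : BilinField) (γ : R4 → R4) : BilinField := fun s =>
  (((ContinuousLinearMap.compL ℝ R4 R4 ℝ).flip (fderiv ℝ γ s)).comp (g (γ s))).comp (fderiv ℝ γ s)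

/-- The pull-back of a field of covectors. -/
def CovField.pullback (A : CovField) (γ : R4 → R4) : CovField := fun s =>
  (A (γ s)).comp (fderiv ℝ γ s)

theorem BilinField.pullback_apply (g : BilinField) (γ : R4 → R4) (s u v : R4) :
    g.pullback γ s u v = g (γ s) (fderiv ℝ γ s u) (fderiv ℝ γ s v) := rfl

theorem CovField.pullback_apply (A : CovField) (γ : R4 → R4) (s u : R4) :
    A.pullback γ s u = A (γ s) (fderiv ℝ γ s u) := rfl

theorem IsWeylPair.pullback {V O : Set R4} {g : BilinField} {A : CovField} (h : IsWeylPair V g A)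
    {γ : R4 → R4} (hγ : IsDiffeoOn γ O) (hO : MapsTo γ O V) :
    IsWeylPair O (g.pullback γ) (A.pullback γ) where
  contDiffOn_g := by
    have h1 : ContDiffOn ℝ ∞ (fderiv ℝ γ) O := hγ.2.1.fderiv_of_isOpen hγ.1 (m := ∞) (by simp)
    have h2 : ContDiffOn ℝ ∞ (fun s => (ContinuousLinearMap.compL ℝ R4 R4 ℝ).flip (fderiv ℝ γ s)) O :=
      (ContinuousLinearMap.contDiff _).comp_contDiffOn h1
    exact (h2.clm_comp (h.contDiffOn_g.comp hγ.2.1 hO)).clm_comp h1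
  contDiffOn_A := by
    have h1 : ContDiffOn ℝ ∞ (fderiv ℝ γ) O := hγ.2.1.fderiv_of_isOpen hγ.1 (m := ∞) (by simp)
    exact (h.contDiffOn_A.comp hγ.2.1 hO).clm_comp h1
  symm s hs u v := h.symm _ (hO hs) _ _
  signature s hs := by
    obtain ⟨e, he⟩ := h.signature _ (hO hs)
    let l : R4 ≃ₗ[ℝ] R4 := LinearEquiv.ofBijective (fderiv ℝ γ s).toLinearMap (hγ.2.2.2 s hs)
    have hl : ∀ y, fderiv ℝ γ s (l.symm y) = y := fun y => l.apply_symm_apply y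
    refine ⟨e.map l.symm, fun i j => ?_⟩
    rw [BilinField.pullback_apply, Module.Basis.map_apply, Module.Basis.map_apply, hl, hl, he]

namespace CartanBundle

variable {M : Type*} [TopologicalSpace M] [ChartedSpace (EuclideanSpace ℝ (Fin 6)) M]
  [IsManifold (𝓡 6) ∞ M] {𝓜 : ParaCR (𝓡 6) M 2 3} {π π' : M → R4}
  {P : Type*} [TopologicalSpace P] [ChartedSpace (EuclideanSpace ℝ (Fin 11)) P]
  [IsManifold (𝓡 11) ∞ P] {𝓒 : CartanBundle 𝓜 π P} {β γ : R4 → R4}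

theorem Induces.transport {g : BilinField} {A : CovField} (h : 𝓒.Induces g A)
    (hβ : IsDiffeoOn β (range π)) (hπ : ContMDiff (𝓡 6) 𝓘(ℝ, R4) ∞ π)
    (hπ' : ∀ m, π' m = β (π m)) (hγ : IsDiffeoOn γ (range π')) (hγβ : ∀ m, γ (π' m) = π m) :
    (𝓒.transport hβ hπ hπ').Induces (g.pullback γ) (A.pullback γ) := by
  have hm : MapsTo γ (range π') (range π) := by
    rintro _ ⟨m, rfl⟩
    exact ⟨m, (hγβ m).symm⟩
  obtain ⟨hW, f, hf, hfG⟩ := h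
  refine ⟨hW.pullback hγ hm, f, hf, fun p => ?_⟩
  have h1 : ∀ p, γ (β (𝓒.q p)) = 𝓒.q p := fun p => by
    obtain ⟨m, hm⟩ := 𝓒.q_mem_range p
    rw [← hm, ← hπ', hγβ]
  have h2 : ∀ v, fderiv ℝ γ (β (𝓒.q p)) (dmap (𝓡 11) (fun p => β (𝓒.q p)) p v)
      = dmap (𝓡 11) 𝓒.q p v := fun v => by
    have h3 := (𝓒.transport hβ hπ hπ').dmap_β_q hγ p v
    refine h3.symm.trans ?_
    exact congrArg (fun f : P → R4 => dmap (𝓡 11) f p v) (funext h1)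
  refine ⟨fun u v => ?_, fun v => ?_⟩
  · refine ((hfG p).1 u v).trans ?_
    change _ = Real.exp (2 * f p) * g (γ (β (𝓒.q p)))
      (fderiv ℝ γ (β (𝓒.q p)) (dmap (𝓡 11) (fun p => β (𝓒.q p)) p u))
      (fderiv ℝ γ (β (𝓒.q p)) (dmap (𝓡 11) (fun p => β (𝓒.q p)) p v))
    rw [h2, h2, h1]
  · refine ((hfG p).2 v).trans ?_
    change _ = A (γ (β (𝓒.q p)))
      (fderiv ℝ γ (β (𝓒.q p)) (dmap (𝓡 11) (fun p => β (𝓒.q p)) p v)) - _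
    rw [h2, h1]

end CartanBundle

/-- Two pull-backs of the flat Weyl geometry differ by a conformal change. -/
theorem changesConformally_of_weylEquiv {V : Set R4} (hV : IsOpen V) {ε ε' : ℝ}
    (hε : ε = 1 ∨ ε = -1) (hε' : ε' = 1 ∨ ε' = -1) {β : R4 → R4} {g g' : BilinField}
    {A A' : CovField} (h : WeylEquiv V (fun _ => ε • g0) (fun _ => 0) g A)
    (h' : WeylEquiv V (fun _ => ε' • g0) (fun _ => 0) (g'.pullback β) (A'.pullback β)) :
    ChangesConformally V β g A g' A' := by
  obtain ⟨φ, hφ, h⟩ := h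
  obtain ⟨ψ, hψ, h'⟩ := h'
  have hs : ε * ε = 1 := by rcases hε with rfl | rfl <;> norm_num
  refine ⟨ε' * ε, fun s => ψ s - φ s, ?_, hψ.sub hφ, fun s hsV => ⟨fun u v => ?_, fun u => ?_⟩⟩
  · rcases hε with rfl | rfl <;> rcases hε' with rfl | rfl <;> norm_num
  · rw [← BilinField.pullback_apply, (h' s hsV).1, (h s hsV).1]
    have h1 : Real.exp (2 * ψ s) = Real.exp (2 * (ψ s - φ s)) * Real.exp (2 * φ s) := by
      rw [← Real.exp_add]
      congr 1
      ring
    change Real.exp (2 * ψ s) * (ε' * g0 u v)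
      = ε' * ε * Real.exp (2 * (ψ s - φ s)) * (Real.exp (2 * φ s) * (ε * g0 u v))
    rw [h1]
    linear_combination (-Real.exp (2 * (ψ s - φ s)) * Real.exp (2 * φ s) * ε' * g0 u v) * hs
  · have hd : ∀ {f : R4 → ℝ}, ContDiffOn ℝ ∞ f V → DifferentiableAt ℝ f s := fun hf =>
      (hf.contDiffAt (hV.mem_nhds hsV)).differentiableAt (by simp)
    rw [← CovField.pullback_apply, (h' s hsV).2, (h s hsV).2, fderiv_fun_sub (hd hψ) (hd hφ)]
    change 0 - 2 * fderiv ℝ ψ s u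
      = 0 - 2 * fderiv ℝ φ s u - 2 * (fderiv ℝ ψ s u - fderiv ℝ φ s u)
    ring

theorem isDiffeoOn_id {X : Type*} [NormedAddCommGroup X] [NormedSpace ℝ X] :
    IsDiffeoOn (id : X → X) univ :=
  ⟨isOpen_univ, contDiffOn_id, injOn_id _, fun x _ => by
    rw [fderiv_id]
    exact Function.bijective_id⟩

section LeafSpace

variable {M : Type*} [TopologicalSpace M] [ChartedSpace (EuclideanSpace ℝ (Fin 6)) M]
  [IsManifold (𝓡 6) ∞ M] {𝓜 : ParaCR (𝓡 6) M 2 3} {Φ : M → Flat}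

/-- If `Φ` is onto, then the fibres of the projection are the planes `ℝ² × {s}`. -/
theorem IsParaCREmbedding.isConnected_fibre (hΦ : IsParaCREmbedding 𝓜 flatParaCR Φ)
    (hs : Function.Surjective Φ) (s : R4) : IsConnected (params Φ ⁻¹' {s}) := by
  let e := hΦ.isOpenEmbedding.isEmbedding.toHomeomorphOfSurjective hs
  have he : ∀ x, Φ (e.symm x) = x := e.apply_symm_apply
  have h1 : params Φ ⁻¹' {s} = range fun w : ℝ × ℝ => e.symm (w, s) := by
    ext m
    constructor
    · intro hm
      refine ⟨(Φ m).1, ?_⟩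
      have h2 : ((Φ m).1, s) = Φ m := Prod.ext rfl (Eq.symm hm)
      exact (congrArg e.symm h2).trans (e.symm_apply_apply m)
    · rintro ⟨w, rfl⟩
      exact congrArg Prod.snd (he (w, s))
  rw [h1]
  exact isConnected_range (e.symm.continuous.comp (by fun_prop))

end LeafSpace

end ParaCRFlat

end
open ParaCRFlat in
theorem mainTheorem5 {M : Type*} [TopologicalSpace M]
    [ChartedSpace (EuclideanSpace ℝ (Fin 6)) M] [IsManifold (𝓡 6) ∞ M] [ConnectedSpace M]
    (𝓜 : ParaCR (𝓡 6) M 2 3) (Φ : M → Flat) (hΦ : IsParaCREmbedding 𝓜 flatParaCR Φ) :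
    -- the leaf space of the foliation by the leaves of `H⁺` is an open set of the solution space
    (BijOn solution univ solutionSpace ∧
      IsLeafProjection 𝓜 (params Φ) ∧
      (Function.Surjective Φ → Function.Surjective (params Φ) ∧
        ∀ s, IsConnected (params Φ ⁻¹' {s}))) ∧
    -- existence of the bundle, with the Weyl geometry represented by the flat pair
    (∃ (P : Type) (_ : TopologicalSpace P) (_ : ChartedSpace (EuclideanSpace ℝ (Fin 11)) P)
      (_ : IsManifold (𝓡 11) ∞ P) (𝓒 : CartanBundle 𝓜 (params Φ) P),
      𝓒.Induces (fun _ => g0) (fun _ => 0)) ∧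
    -- uniqueness of the bundle
    (∀ (P : Type*) [TopologicalSpace P] [ChartedSpace (EuclideanSpace ℝ (Fin 11)) P]
      [IsManifold (𝓡 11) ∞ P] (𝓒 : CartanBundle 𝓜 (params Φ) P)
      (P' : Type*) [TopologicalSpace P'] [ChartedSpace (EuclideanSpace ℝ (Fin 11)) P']
      [IsManifold (𝓡 11) ∞ P'] (𝓒' : CartanBundle 𝓜 (params Φ) P'),
      ∃! F : Diffeomorph (𝓡 11) (𝓡 11) P P' ∞,
        ∃ ε : ℝ, (ε = 1 ∨ ε = -1) ∧ 𝓒.IsIso 𝓒' ε F) ∧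
    -- the bundle is the affine homothetic group, and its Weyl geometry is the flat one
    (∀ (P : Type*) [TopologicalSpace P] [ChartedSpace (EuclideanSpace ℝ (Fin 11)) P]
      [IsManifold (𝓡 11) ∞ P] (𝓒 : CartanBundle 𝓜 (params Φ) P),
      ∃ ε : ℝ, (ε = 1 ∨ ε = -1) ∧
        (∃ (L : R4 ≃L[ℝ] R4) (T : P → Sim),
          (∀ u v, L u ⬝ᵥ (eta *ᵥ L v) = ε * g0 u v) ∧ 𝓒.IsGroupModel L T ∧
          (Function.Surjective Φ → Function.Bijective T)) ∧
        (∀ g A, 𝓒.Induces g A ↔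
          WeylEquiv (range (params Φ)) (fun _ => ε • g0) (fun _ => 0) g A) ∧
        ∀ g A, 𝓒.Induces g A →
          IsWeylPair (range (params Φ)) g A ∧ IsFlatWeyl (range (params Φ)) g A) ∧
    -- point transformations `(x, y, z) ↦ f (x, y, z)`, with new parameters `β a` for the solutions
    (IsCorrespondence 𝓜 (fun m => (surf Φ m, params Φ m)) ∧
      ∀ (f : ℝ × ℝ × ℝ → ℝ × ℝ × ℝ) (O : Set (ℝ × ℝ × ℝ)) (β : R4 → R4),
        IsDiffeoOn f O → (∀ m, surf Φ m ∈ O) → IsDiffeoOn β (range (params Φ)) →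
        IsCorrespondence 𝓜 (fun m => (f (surf Φ m), β (params Φ m))) ∧
        (∃ (P : Type) (_ : TopologicalSpace P)
          (_ : ChartedSpace (EuclideanSpace ℝ (Fin 11)) P) (_ : IsManifold (𝓡 11) ∞ P)
          (𝓒' : CartanBundle 𝓜 (fun m => β (params Φ m)) P) (g' : BilinField) (A' : CovField),
          𝓒'.Induces g' A') ∧
        ∀ (P : Type*) [TopologicalSpace P] [ChartedSpace (EuclideanSpace ℝ (Fin 11)) P]
          [IsManifold (𝓡 11) ∞ P] (𝓒 : CartanBundle 𝓜 (params Φ) P)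
          (P' : Type*) [TopologicalSpace P'] [ChartedSpace (EuclideanSpace ℝ (Fin 11)) P']
          [IsManifold (𝓡 11) ∞ P'] (𝓒' : CartanBundle 𝓜 (fun m => β (params Φ m)) P')
          (g : BilinField) (A : CovField) (g' : BilinField) (A' : CovField),
          𝓒.Induces g A → 𝓒'.Induces g' A' →
          ChangesConformally (range (params Φ)) β g A g' A') := by
  have hV := hΦ.isOpen_range_params
  have hπ := hΦ.contMDiff_params
  refine ⟨⟨bijOn_solution, hΦ.isLeafProjection, fun hs =>
    ⟨fun s => ?_, hΦ.isConnected_fibre hs⟩⟩, ?_, ?_, ?_, ?_, ?_⟩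
  · obtain ⟨m, hm⟩ := hs (0, s)
    exact ⟨m, congrArg Prod.snd hm⟩
  · refine ⟨_, _, _, inferInstance, Model.cartanBundle hΦ, ?_⟩
    refine ((Model.isFrameMap_mat hΦ).induces_iff hΦ _ _).2 ?_
    rw [one_smul]
    exact WeylEquiv.refl _ _ _
  · intro P _ _ _ 𝓒 P' _ _ _ 𝓒'
    obtain ⟨ε, b, h⟩ := 𝓒.exists_isFrameMap hΦ
    obtain ⟨ε', b', h'⟩ := 𝓒'.exists_isFrameMap hΦ
    exact h.existsUnique_iso h' hΦ
  · intro P _ _ _ 𝓒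
    obtain ⟨ε, b, h⟩ := 𝓒.exists_isFrameMap hΦ
    refine ⟨ε, h.sign, ⟨modelEquiv h.sign, h.toSim, modelEquiv_dotProduct h.sign, h.isGroupModel,
      fun hs => h.bijective_toSim fun s => ?_⟩, h.induces_iff hΦ, fun g A hg => ?_⟩
    · obtain ⟨m, hm⟩ := hs (0, s)
      exact ⟨m, congrArg Prod.snd hm⟩
    · exact ⟨hg.1, ((h.induces_iff hΦ g A).1 hg).isFlatWeyl hV⟩
  · exact hΦ.isCorrespondence isDiffeoOn_id (fun _ => mem_univ _) isDiffeoOn_id fun _ => mem_univ _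
  · intro f O β hf hO hβ
    obtain ⟨γ, hγ, hγβ⟩ := hβ.exists_inverse
    have hr : range (fun m => β (params Φ m)) = β '' range (params Φ) := range_comp β (params Φ)
    rw [← hr] at hγ
    have hγβ' : ∀ m, γ (β (params Φ m)) = params Φ m := fun m => hγβ _ (mem_range_self m)
    refine ⟨hΦ.isCorrespondence hf hO hβ mem_range_self, ?_, ?_⟩
    · refine ⟨_, _, _, inferInstance, (Model.cartanBundle hΦ).transport hβ hπ fun _ => rfl, _, _,
        CartanBundle.Induces.transport (((Model.isFrameMap_mat hΦ).induces_iff hΦ _ _).2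
          (WeylEquiv.refl _ _ _)) hβ hπ (fun _ => rfl) hγ hγβ'⟩
    · intro P _ _ _ 𝓒 P' _ _ _ 𝓒' g A g' A' h h'
      have hπ' : ContMDiff (𝓡 6) 𝓘(ℝ, R4) ∞ fun m => β (params Φ m) := fun m =>
        (hβ.contDiffAt (mem_range_self m)).comp_contMDiffAt (hπ m)
      obtain ⟨ε, b, hb⟩ := 𝓒.exists_isFrameMap hΦ
      have h'' := h'.transport hγ hπ' (fun m => (hγβ' m).symm) hβ fun _ => rfl
      obtain ⟨ε', b', hb'⟩ := (𝓒'.transport hγ hπ' fun m => (hγβ' m).symm).exists_isFrameMap hΦ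
      exact changesConformally_of_weylEquiv hV hb.sign hb'.sign ((hb.induces_iff hΦ g A).1 h)
        ((hb'.induces_iff hΦ _ _).1 h'')
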